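/- **Definitions.** A *PROP* is a symmetric strict monoidal category with objects the natural numbers and tensor product on objects given by addition; a morphism of PROPs is an identity-on-objects symmetric strict monoidal functor. A *finite interfaced dag (idag)* from a set $I$ to a set $O$ is a finite set $N$ of internal nodes with a relation $R\subseteq (I+N)\times(O+N)$ such that the transitive closure of the restriction of $R$ to $N$ is irreflexive. Two idags $(N,R)$, $(N',R')$ from $I$ to $O$ are isomorphic if there is a bijection $\sigma:N\cong N'$ with $(\mathrm{id}+\sigma)\circ R=R'\circ(\mathrm{id}+\sigma)$. The *concatenation* of $(N,R)$ from $I$ to $M$ and $(N',R')$ from $M$ to $O$ has internal nodes $N+N'$ and edge relation the composite $$I+N+N'\xrightarrow{R+\mathrm{id}}M+N+N'\cong M+N'+N\xrightarrow{R'+\mathrm{id}}O+N'+N\cong O+N+N',$$ and the *juxtaposition* of $(N,R)$ from $I$ to $O$ and $(N',R')$ from $I'$ to $O'$ is the idag from $I+I'$ to $O+O'$ with internal nodes $N+N'$ and edges $R+R'$. Let $\mathbf D$ be the PROP whose morphisms $n\to m$ are the isomorphism classes of finite idags from $\{0,\dots,n-1\}$ to $\{0,\dots,m-1\}$, with composition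 by concatenation, tensor by juxtaposition, and identities and symmetries given by the idags without internal nodes on the evident bijections. A *symmetric monoidal equational theory* $T$ is a set of operators with arities and coarities together with a set of equations between expressions of equal arity and coarity, built from the operators, identities, composition, $\otimes$ and symmetries. The *free PROP* on $T$ has as morphisms $n\to m$ the expressions of arity $n$ and coarity $m$ modulo the laws of symmetric strict monoidal categories and the equations of $T$. A *$T$-algebra* in a symmetric monoidal category $\mathcal C$ is an object $A$ with a morphism $A^{\otimes n}\to A^{\otimes m}$ for every operator $n\to m$, satisfying the equations; homomorphisms are the morphisms of $\mathcal C$ that commute with the operators. Let $T$ be the theory of degenerate commutative bialgebras with a node, that is, the sum (disjoint union of operators and of equations) of the theory with one operator $\lambda:1\to1$ and no equations and the theory of degenerate commutative bialgebras, with operators $\eta:0\to1$, $\nabla:2\to1$, $\epsilon:1\to0$, $\Delta:1\to2$ and equations, for $\gamma$ the symmetry $1\otimes 1\to 1\otimes 1$, $$\nabla(\eta\otimes\mathrm{id}_1)=\mathrm{id}_1=\nabla(\mathrm{id}_1\otimes\eta),\quad \nabla(\nabla\otimes\mathrm{id}_1)=\nabla(\mathrm{id}_1\otimes\nabla),\quad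 \nabla\gamma=\nabla,$$ $$(\epsilon\otimes\mathrm{id}_1)\Delta=\mathrm{id}_1=(\mathrm{id}_1\otimes\epsilon)\Delta,\quad (\Delta\otimes\mathrm{id}_1)\Delta=(\mathrm{id}_1\otimes\Delta)\Delta,\quad \gamma\Delta=\Delta,$$ $$\epsilon\eta=\mathrm{id}_0,\quad \epsilon\nabla=\epsilon\otimes\epsilon,\quad \Delta\eta=\eta\otimes\eta,\quad \Delta\nabla=(\nabla\otimes\nabla)(\mathrm{id}_1\otimes\gamma\otimes\mathrm{id}_1)(\Delta\otimes\Delta),\quad \nabla\Delta=\mathrm{id}_1.$$ **Theorem.** The PROP $\mathbf D$ of finite abstract idags is free on $T$. Explicitly, interpret $\eta,\nabla,\epsilon,\Delta$ as the idags without internal nodes and with an edge from every input to every output, and $\lambda$ as the idag $1\to1$ with one internal node $x$ and exactly the two edges from the input to $x$ and from $x$ to the output. Then: 1. these idags satisfy the equations of $T$ in $\mathbf D$; 2. there is an isomorphism of PROPs from the free PROP on $T$ to $\mathbf D$ that sends every operator to its idag; 3. for every symmetric monoidal category $\mathcal C$, evaluation at the object $1$ with these idags is an equivalence from the category of symmetric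 (strong) monoidal functors $\mathbf D\to\mathcal C$ and monoidal natural transformations to the category of $T$-algebras in $\mathcal C$; and these equivalences are natural in $\mathcal C$ with respect to symmetric monoidal functors. -/

import Mathlib

universe w w' v v' u u'

open CategoryTheory MonoidalCategory

/-- Transport of a family indexed by arity and coarity along equalities of natural numbers. -/
def castHom {H : ℕ → ℕ → Type*} {a a' b b' : ℕ} (ha : a = a') (hb : b = b') (f : H a b) : H a' b' :=
  ha ▸ hb ▸ f

/-- A PROP: a symmetric strict monoidal category with objects the natural numbers and tensor
product on objects given by addition. Composition is written in diagrammatic order. The casts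
only move between hom-sets whose indices are equal natural numbers, such as `(a + b) + c` and
`a + (b + c)`. -/
structure PROP where
  Hom : ℕ → ℕ → Type w
  id : ∀ a, Hom a a
  comp : ∀ {a b c}, Hom a b → Hom b c → Hom a c
  tensor : ∀ {a b c d}, Hom a b → Hom c d → Hom (a + c) (b + d)
  symm : ∀ a b, Hom (a + b) (b + a)
  id_comp : ∀ {a b} (f : Hom a b), comp (id a) f = f
  comp_id : ∀ {a b} (f : Hom a b), comp f (id b) = f
  assoc : ∀ {a b c d} (f : Hom a b) (g : Hom b c) (h : Hom c d),
    comp (comp f g) h = comp f (comp g h)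
  tensor_id : ∀ a b, tensor (id a) (id b) = id (a + b)
  tensor_comp : ∀ {a b c a' b' c'} (f : Hom a b) (g : Hom b c) (f' : Hom a' b') (g' : Hom b' c'),
    tensor (comp f g) (comp f' g') = comp (tensor f f') (tensor g g')
  tensor_assoc : ∀ {a b a' b' a'' b''} (f : Hom a b) (g : Hom a' b') (h : Hom a'' b''),
    castHom (Nat.add_assoc a a' a'') (Nat.add_assoc b b' b'') (tensor (tensor f g) h)
      = tensor f (tensor g h)
  unit_tensor : ∀ {a b} (f : Hom a b),
    castHom (Nat.zero_add a) (Nat.zero_add b) (tensor (id 0) f) = f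
  tensor_unit : ∀ {a b} (f : Hom a b), tensor f (id 0) = f
  symm_naturality : ∀ {a b c d} (f : Hom a b) (g : Hom c d),
    comp (tensor f g) (symm b d) = comp (symm a c) (tensor g f)
  symm_symm : ∀ a b, comp (symm a b) (symm b a) = id (a + b)
  hexagon : ∀ a b c,
    symm a (b + c) =
      comp (castHom (Nat.add_assoc a b c) (Nat.add_assoc b a c) (tensor (symm a b) (id c)))
        (castHom rfl (Nat.add_assoc b c a).symm (tensor (id b) (symm a c)))

namespace PROP

/-- The objects of a PROP, that is, the natural numbers. -/
@[ext]
structure Obj (P : PROP.{w}) where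
  n : ℕ

instance (P : PROP.{w}) : Category.{w} P.Obj where
  Hom a b := P.Hom a.n b.n
  id a := P.id a.n
  comp f g := P.comp f g
  id_comp := P.id_comp
  comp_id := P.comp_id
  assoc := P.assoc

theorem castHom_eq (P : PROP.{w}) {a a' b b' : P.Obj} (ha : a = a') (hb : b = b') (f : a ⟶ b) :
    (castHom (H := P.Hom) (congrArg Obj.n ha) (congrArg Obj.n hb) f : a' ⟶ b') =
      eqToHom ha.symm ≫ f ≫ eqToHom hb := by
  subst ha hb
  simp [castHom]

instance (P : PROP.{w}) : MonoidalCategoryStruct P.Obj where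
  tensorObj a b := ⟨a.n + b.n⟩
  tensorUnit := ⟨0⟩
  tensorHom f g := P.tensor f g
  whiskerLeft a _ _ f := P.tensor (P.id a.n) f
  whiskerRight f a := P.tensor f (P.id a.n)
  associator a b c := eqToIso (Obj.ext (Nat.add_assoc a.n b.n c.n))
  leftUnitor a := eqToIso (Obj.ext (Nat.zero_add a.n))
  rightUnitor a := eqToIso (Obj.ext (Nat.add_zero a.n))

theorem obj_assoc (P : PROP.{w}) (a b c : P.Obj) : (a ⊗ b) ⊗ c = a ⊗ (b ⊗ c) :=
  Obj.ext (Nat.add_assoc a.n b.n c.n)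

theorem unit_obj (P : PROP.{w}) (a : P.Obj) : 𝟙_ P.Obj ⊗ a = a := Obj.ext (Nat.zero_add a.n)

theorem obj_unit (P : PROP.{w}) (a : P.Obj) : a ⊗ 𝟙_ P.Obj = a := Obj.ext (Nat.add_zero a.n)

theorem associator_hom_eq (P : PROP.{w}) (a b c : P.Obj) :
    (α_ a b c).hom = eqToHom (P.obj_assoc a b c) := rfl

theorem leftUnitor_hom_eq (P : PROP.{w}) (a : P.Obj) :
    (λ_ a).hom = eqToHom (P.unit_obj a) := rfl

theorem rightUnitor_hom_eq (P : PROP.{w}) (a : P.Obj) :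
    (ρ_ a).hom = eqToHom (P.obj_unit a) := rfl

theorem eqToHom_tensor_eqToHom (P : PROP.{w}) {a a' b b' : P.Obj} (ha : a = a') (hb : b = b') :
    (eqToHom ha ⊗ₘ eqToHom hb : a ⊗ b ⟶ a' ⊗ b') = eqToHom (by rw [ha, hb]) := by
  subst ha hb
  exact P.tensor_id a.n b.n

instance (P : PROP.{w}) : MonoidalCategory P.Obj :=
  MonoidalCategory.ofTensorHom
    (id_tensorHom_id := fun a b => P.tensor_id a.n b.n)
    (id_tensorHom := fun _ _ _ _ => rfl)
    (tensorHom_id := fun _ _ => rfl)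
    (tensorHom_comp_tensorHom := fun f g f' g' => (P.tensor_comp f f' g g').symm)
    (associator_naturality := fun {a a' a'' b b' b''} f g h => by
      have h3 : (f ⊗ₘ (g ⊗ₘ h)) = eqToHom (P.obj_assoc a a' a'').symm ≫ ((f ⊗ₘ g) ⊗ₘ h) ≫
          eqToHom (P.obj_assoc b b' b'') :=
        (P.tensor_assoc f g h).symm.trans
          (P.castHom_eq (P.obj_assoc a a' a'') (P.obj_assoc b b' b'') ((f ⊗ₘ g) ⊗ₘ h))
      rw [h3, associator_hom_eq, associator_hom_eq]
      simp)
    (leftUnitor_naturality := fun {a b} f => by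
      have h3 : f = eqToHom (P.unit_obj a).symm ≫ (𝟙 (𝟙_ P.Obj) ⊗ₘ f) ≫ eqToHom (P.unit_obj b) :=
        (P.unit_tensor f).symm.trans
          (P.castHom_eq (P.unit_obj a) (P.unit_obj b) (𝟙 (𝟙_ P.Obj) ⊗ₘ f))
      conv_rhs => rw [h3]
      rw [leftUnitor_hom_eq, leftUnitor_hom_eq]
      simp)
    (rightUnitor_naturality := fun {a b} f => by
      have h3 : f ⊗ₘ 𝟙 (𝟙_ P.Obj) = f := P.tensor_unit f
      rw [h3, rightUnitor_hom_eq, rightUnitor_hom_eq]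
      exact (Category.comp_id f).trans (Category.id_comp f).symm)
    (pentagon := fun a b c d => by
      simp only [associator_hom_eq, ← eqToHom_refl, eqToHom_tensor_eqToHom, eqToHom_trans])
    (triangle := fun a b => by
      simp only [associator_hom_eq, leftUnitor_hom_eq, rightUnitor_hom_eq, ← eqToHom_refl,
        eqToHom_tensor_eqToHom, eqToHom_trans])

/-- A PROP is a symmetric monoidal category. -/
instance (P : PROP.{w}) : SymmetricCategory P.Obj :=
  let β (a b : P.Obj) : a ⊗ b ≅ b ⊗ a :=
    ⟨P.symm a.n b.n, P.symm b.n a.n, P.symm_symm a.n b.n, P.symm_symm b.n a.n⟩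
  have hex : ∀ a b c : P.Obj, (α_ a b c).hom ≫ (β a (b ⊗ c)).hom ≫ (α_ b c a).hom =
      (β a b).hom ▷ c ≫ (α_ b a c).hom ≫ b ◁ (β a c).hom := fun a b c => by
    have h3 : (β a (b ⊗ c)).hom =
        (eqToHom (P.obj_assoc a b c).symm ≫ (β a b).hom ▷ c ≫ eqToHom (P.obj_assoc b a c)) ≫
        (eqToHom rfl ≫ b ◁ (β a c).hom ≫ eqToHom (P.obj_assoc b c a).symm) :=
      (P.hexagon a.n b.n c.n).trans (congrArg₂ P.comp
        (P.castHom_eq (P.obj_assoc a b c) (P.obj_assoc b a c) ((β a b).hom ▷ c))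
        (P.castHom_eq rfl (P.obj_assoc b c a).symm (b ◁ (β a c).hom)))
    rw [h3]
    simp only [associator_hom_eq, Category.assoc, eqToHom_trans_assoc, eqToHom_trans,
      eqToHom_refl, Category.id_comp, Category.comp_id]
  { braiding := β
    braiding_naturality_right := fun a _ _ f => P.symm_naturality (P.id a.n) f
    braiding_naturality_left := fun f c => P.symm_naturality f (P.id c.n)
    hexagon_forward := hex
    hexagon_reverse := fun a b c => by
      have h1 := hex c a b
      have h2 : ((α_ c a b) ≪≫ (β c (a ⊗ b)) ≪≫ (α_ a b c)) =
        (whiskerRightIso (β c a) b ≪≫ (α_ a c b) ≪≫ whiskerLeftIso a (β c b)) := Iso.ext h1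
      have h3 := congrArg Iso.inv h2
      simpa using h3
    symmetry := fun a b => P.symm_symm a.n b.n }

/-- A morphism of PROPs: an identity-on-objects symmetric strict monoidal functor. -/
structure Morphism (P : PROP.{w}) (Q : PROP.{w'}) where
  map : ∀ {a b}, P.Hom a b → Q.Hom a b
  map_id : ∀ a, map (P.id a) = Q.id a
  map_comp : ∀ {a b c} (f : P.Hom a b) (g : P.Hom b c), map (P.comp f g) = Q.comp (map f) (map g)
  map_tensor : ∀ {a b c d} (f : P.Hom a b) (g : P.Hom c d),
    map (P.tensor f g) = Q.tensor (map f) (map g)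
  map_symm : ∀ a b, map (P.symm a b) = Q.symm a b

/-- A morphism of PROPs is an isomorphism when it is bijective on all hom-sets. -/
def Morphism.IsIso {P : PROP.{w}} {Q : PROP.{w'}} (φ : P.Morphism Q) : Prop :=
  ∀ a b, Function.Bijective (φ.map : P.Hom a b → Q.Hom a b)

end PROP

/-- A signature: a set of operators with an assignment of arity/coarity pairs. -/
structure Signature where
  Op : Type
  dom : Op → ℕ
  cod : Op → ℕ

/-- Expressions, with their arity and coarity, in the language of symmetric strict monoidal
categories over the additive monoid of natural numbers together with the operators of `S`. -/
inductive Expr (S : Signature) : ℕ → ℕ → Type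
  | op (o : S.Op) : Expr S (S.dom o) (S.cod o)
  | id (a : ℕ) : Expr S a a
  | comp {a b c : ℕ} (f : Expr S a b) (g : Expr S b c) : Expr S a c
  | tensor {a b c d : ℕ} (f : Expr S a b) (g : Expr S c d) : Expr S (a + c) (b + d)
  | symm (a b : ℕ) : Expr S (a + b) (b + a)

/-- Substitution of expressions for operators. -/
def Expr.bind {S S' : Signature} (φ : ∀ o : S.Op, Expr S' (S.dom o) (S.cod o)) :
    ∀ {a b : ℕ}, Expr S a b → Expr S' a b
  | _, _, .op o => φ o
  | _, _, .id a => .id a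
  | _, _, .comp f g => .comp (f.bind φ) (g.bind φ)
  | _, _, .tensor f g => .tensor (f.bind φ) (g.bind φ)
  | _, _, .symm a b => .symm a b

/-- A symmetric monoidal equational theory: a signature with a set of pairs of expressions of the
same arity and coarity. -/
structure SMTheory extends Signature where
  Eqn : ∀ {a b : ℕ}, Expr toSignature a b → Expr toSignature a b → Prop

/-- The congruence on expressions generated by the laws of symmetric strict monoidal categories
and the equations of the theory `T`. -/
inductive SMTheory.Provable (T : SMTheory) :
    ∀ {a b : ℕ}, Expr T.toSignature a b → Expr T.toSignature a b → Prop
  | eqn {a b} {f g : Expr T.toSignature a b} : T.Eqn f g → Provable T f g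
  | refl {a b} (f : Expr T.toSignature a b) : Provable T f f
  | symm {a b} {f g : Expr T.toSignature a b} : Provable T f g → Provable T g f
  | trans {a b} {f g h : Expr T.toSignature a b} :
      Provable T f g → Provable T g h → Provable T f h
  | comp_congr {a b c} {f f' : Expr T.toSignature a b} {g g' : Expr T.toSignature b c} :
      Provable T f f' → Provable T g g' → Provable T (f.comp g) (f'.comp g')
  | tensor_congr {a b c d} {f f' : Expr T.toSignature a b} {g g' : Expr T.toSignature c d} :
      Provable T f f' → Provable T g g' → Provable T (f.tensor g) (f'.tensor g')
  | id_comp {a b} (f : Expr T.toSignature a b) : Provable T ((Expr.id a).comp f) f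
  | comp_id {a b} (f : Expr T.toSignature a b) : Provable T (f.comp (Expr.id b)) f
  | assoc {a b c d} (f : Expr T.toSignature a b) (g : Expr T.toSignature b c)
      (h : Expr T.toSignature c d) : Provable T ((f.comp g).comp h) (f.comp (g.comp h))
  | tensor_id (a b : ℕ) : Provable T ((Expr.id a).tensor (Expr.id b)) (Expr.id (a + b))
  | tensor_comp {a b c a' b' c'} (f : Expr T.toSignature a b) (g : Expr T.toSignature b c)
      (f' : Expr T.toSignature a' b') (g' : Expr T.toSignature b' c') :
      Provable T ((f.comp g).tensor (f'.comp g')) ((f.tensor f').comp (g.tensor g'))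
  | tensor_assoc {a b a' b' a'' b''} (f : Expr T.toSignature a b) (g : Expr T.toSignature a' b')
      (h : Expr T.toSignature a'' b'') :
      Provable T
        (castHom (Nat.add_assoc a a' a'') (Nat.add_assoc b b' b'') ((f.tensor g).tensor h))
        (f.tensor (g.tensor h))
  | unit_tensor {a b} (f : Expr T.toSignature a b) :
      Provable T (castHom (Nat.zero_add a) (Nat.zero_add b) ((Expr.id 0).tensor f)) f
  | tensor_unit {a b} (f : Expr T.toSignature a b) : Provable T (f.tensor (Expr.id 0)) f
  | symm_naturality {a b c d} (f : Expr T.toSignature a b) (g : Expr T.toSignature c d) :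
      Provable T ((f.tensor g).comp (Expr.symm b d)) ((Expr.symm a c).comp (g.tensor f))
  | symm_symm (a b : ℕ) :
      Provable T ((Expr.symm a b).comp (Expr.symm b a)) (Expr.id (a + b))
  | hexagon (a b c : ℕ) :
      Provable T (Expr.symm a (b + c))
        ((castHom (Nat.add_assoc a b c) (Nat.add_assoc b a c)
            ((Expr.symm a b).tensor (Expr.id c))).comp
          (castHom rfl (Nat.add_assoc b c a).symm ((Expr.id b).tensor (Expr.symm a c))))

/-- Provable equality as an equivalence relation. -/
def SMTheory.setoid (T : SMTheory) (a b : ℕ) : Setoid (Expr T.toSignature a b) where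
  r := T.Provable
  iseqv := ⟨.refl, .symm, .trans⟩

theorem castHom_natural {H : ℕ → ℕ → Type*} {K : ℕ → ℕ → Type*} (φ : ∀ {a b}, H a b → K a b)
    {a a' b b' : ℕ} (ha : a = a') (hb : b = b') (f : H a b) :
    castHom ha hb (φ f) = φ (castHom ha hb f) := by
  subst ha hb
  rfl

/-- The free PROP on a theory: expressions modulo provable equality. -/
def SMTheory.freeProp (T : SMTheory) : PROP.{0} where
  Hom a b := Quotient (T.setoid a b)
  id a := Quotient.mk _ (.id a)
  comp := Quotient.map₂ Expr.comp fun _ _ h _ _ h' => .comp_congr h h'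
  tensor := Quotient.map₂ Expr.tensor fun _ _ h _ _ h' => .tensor_congr h h'
  symm a b := Quotient.mk _ (.symm a b)
  id_comp := by rintro a b ⟨f⟩; exact Quotient.sound (.id_comp f)
  comp_id := by rintro a b ⟨f⟩; exact Quotient.sound (.comp_id f)
  assoc := by rintro a b c d ⟨f⟩ ⟨g⟩ ⟨h⟩; exact Quotient.sound (.assoc f g h)
  tensor_id a b := Quotient.sound (.tensor_id a b)
  tensor_comp := by
    rintro a b c a' b' c' ⟨f⟩ ⟨g⟩ ⟨f'⟩ ⟨g'⟩; exact Quotient.sound (.tensor_comp f g f' g')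
  tensor_assoc := by
    rintro a b a' b' a'' b'' ⟨f⟩ ⟨g⟩ ⟨h⟩
    exact (castHom_natural (fun {a b} => Quotient.mk (T.setoid a b)) _ _ _).trans
      (Quotient.sound (.tensor_assoc f g h))
  unit_tensor := by
    rintro a b ⟨f⟩
    exact (castHom_natural (fun {a b} => Quotient.mk (T.setoid a b)) _ _ _).trans
      (Quotient.sound (.unit_tensor f))
  tensor_unit := by rintro a b ⟨f⟩; exact Quotient.sound (.tensor_unit f)
  symm_naturality := by rintro a b c d ⟨f⟩ ⟨g⟩; exact Quotient.sound (.symm_naturality f g)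
  symm_symm a b := Quotient.sound (.symm_symm a b)
  hexagon a b c := by
    have e1 := castHom_natural (fun {a b} => Quotient.mk (T.setoid a b)) (Nat.add_assoc a b c)
      (Nat.add_assoc b a c) ((Expr.symm a b).tensor (Expr.id c))
    have e2 := castHom_natural (fun {a b} => Quotient.mk (T.setoid a b)) rfl
      (Nat.add_assoc b c a).symm ((Expr.id b).tensor (Expr.symm a c))
    refine (Quotient.sound (.hexagon a b c) : _ = Quotient.mk (T.setoid _ _) _).trans ?_
    exact (congrArg₂ 
      (Quotient.map₂ Expr.comp fun _ _ h _ _ h' => SMTheory.Provable.comp_congr h h') e1 e2).symm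

/-- The class of an operator in the free PROP. -/
def SMTheory.gen (T : SMTheory) (o : T.Op) : T.freeProp.Hom (T.dom o) (T.cod o) :=
  Quotient.mk _ (.op o)

/-- The interpretation of expressions in a PROP, given an interpretation of the operators as
morphisms of the same arity and coarity. -/
def Expr.evalProp {S : Signature} (P : PROP.{w}) (m : ∀ o : S.Op, P.Hom (S.dom o) (S.cod o)) :
    ∀ {a b : ℕ}, Expr S a b → P.Hom a b
  | _, _, .op o => m o
  | _, _, .id a => P.id a
  | _, _, .comp f g => P.comp (f.evalProp P m) (g.evalProp P m)
  | _, _, .tensor f g => P.tensor (f.evalProp P m) (g.evalProp P m)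
  | _, _, .symm a b => P.symm a b

/-- An algebra structure for the theory `T` on the generating object `1` of a PROP, whose tensor
powers are the objects `a`. -/
structure GenAlg (T : SMTheory) (P : PROP.{w}) where
  op : ∀ o : T.Op, P.Hom (T.dom o) (T.cod o)
  eqn : ∀ {a b : ℕ} {f g : Expr T.toSignature a b}, T.Eqn f g →
    f.evalProp P op = g.evalProp P op

/-- The disjoint union of two signatures. -/
def Signature.sum (S S' : Signature) : Signature where
  Op := S.Op ⊕ S'.Op
  dom := Sum.elim S.dom S'.dom
  cod := Sum.elim S.cod S'.cod

/-- Expressions over the first signature, seen over the sum. -/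
def Expr.inl {S S' : Signature} {a b : ℕ} (f : Expr S a b) : Expr (S.sum S') a b :=
  f.bind fun o => .op (S := S.sum S') (Sum.inl o)

/-- Expressions over the second signature, seen over the sum. -/
def Expr.inr {S S' : Signature} {a b : ℕ} (f : Expr S' a b) : Expr (S.sum S') a b :=
  f.bind fun o => .op (S := S.sum S') (Sum.inr o)

/-- The equations of the sum of two theories: those of either theory. -/
inductive SumEqn (T T' : SMTheory) : ∀ {a b : ℕ},
    Expr (T.toSignature.sum T'.toSignature) a b →
    Expr (T.toSignature.sum T'.toSignature) a b → Prop
  | inl {a b} {f g : Expr T.toSignature a b} : T.Eqn f g → SumEqn T T' f.inl g.inl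
  | inr {a b} {f g : Expr T'.toSignature a b} : T'.Eqn f g → SumEqn T T' f.inr g.inr

/-- The sum of two theories. -/
def SMTheory.sum (T T' : SMTheory) : SMTheory where
  toSignature := T.toSignature.sum T'.toSignature
  Eqn := SumEqn T T'

/-- The operators of bialgebras. -/
inductive BialgOp
  | eta
  | nabla
  | eps
  | delta

/-- The signature of bialgebras: `η : 0 → 1`, `∇ : 2 → 1`, `ε : 1 → 0`, `Δ : 1 → 2`. -/
def bialgSig : Signature where
  Op := BialgOp
  dom
    | .eta => 0
    | .nabla => 2
    | .eps => 1
    | .delta => 1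
  cod
    | .eta => 1
    | .nabla => 1
    | .eps => 0
    | .delta => 2

namespace Bialg

/-- The unit. -/
def η : Expr bialgSig 0 1 := .op (S := bialgSig) .eta

/-- The multiplication. -/
def m : Expr bialgSig 2 1 := .op (S := bialgSig) .nabla

/-- The counit. -/
def ε : Expr bialgSig 1 0 := .op (S := bialgSig) .eps

/-- The comultiplication. -/
def Δ : Expr bialgSig 1 2 := .op (S := bialgSig) .delta

/-- The identity on `1`. -/
def i : Expr bialgSig 1 1 := .id 1

/-- The symmetry on `1, 1`. -/
def γ : Expr bialgSig 2 2 := .symm 1 1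

/-- The equations of degenerate commutative bialgebras; `m` stands for the multiplication `∇` and
compositions are in diagrammatic order. -/
inductive Eqn : ∀ {a b : ℕ}, Expr bialgSig a b → Expr bialgSig a b → Prop
  | unit_left : Eqn ((η.tensor i).comp m) i
  | unit_right : Eqn ((i.tensor η).comp m) i
  | mul_assoc : Eqn ((m.tensor i).comp m) ((i.tensor m).comp m)
  | mul_comm : Eqn (γ.comp m) m
  | counit_left : Eqn (Δ.comp (ε.tensor i)) i
  | counit_right : Eqn (Δ.comp (i.tensor ε)) i
  | comul_assoc : Eqn (Δ.comp (Δ.tensor i)) (Δ.comp (i.tensor Δ))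
  | comul_comm : Eqn (Δ.comp γ) Δ
  | unit_counit : Eqn (η.comp ε) (.id 0)
  | mul_counit : Eqn (m.comp ε) (ε.tensor ε)
  | unit_comul : Eqn (η.comp Δ) (η.tensor η)
  | mul_comul : Eqn (m.comp Δ) (((Δ.tensor Δ).comp ((i.tensor γ).tensor i)).comp (m.tensor m))
  | degenerate : Eqn (Δ.comp m) i

end Bialg

/-- The theory of degenerate commutative bialgebras. -/
def degCommBialg : SMTheory where
  toSignature := bialgSig
  Eqn := Bialg.Eqn

/-- The theory of nodes labelled by `L`: unary operators `1 → 1` without equations. -/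
def nodes (L : Type) : SMTheory where
  Op := L
  dom _ := 1
  cod _ := 1
  Eqn _ _ := False

/-- The theory of degenerate commutative bialgebras with a node. -/
def dagTheory : SMTheory := degCommBialg.sum (nodes Unit)

/-- A finite interfaced dag with input interface `I` and output interface `O`: a finite set `N` of
internal nodes and a relation `R ⊆ (I + N) × (O + N)` such that the transitive closure of its
restriction to `N` is irreflexive. -/
structure IDag (I O : Type) where
  N : Type
  finite : Finite N
  R : I ⊕ N → O ⊕ N → Prop
  acyclic : ∀ n, ¬ Relation.TransGen (fun x y => R (Sum.inr x) (Sum.inr y)) n n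

namespace IDag

/-- Isomorphism of idags over fixed interfaces. -/
def Iso {I O : Type} (D D' : IDag I O) : Prop :=
  ∃ σ : D.N ≃ D'.N, ∀ x y, D.R x y ↔ D'.R (Sum.map id σ x) (Sum.map id σ y)

/-- Isomorphism as an equivalence relation. -/
def setoid (I O : Type) : Setoid (IDag I O) where
  r := Iso
  iseqv :=
    ⟨fun D => ⟨Equiv.refl _, by simp⟩,
     fun {D D'} ⟨σ, h⟩ => ⟨σ.symm, fun x y => by simp [h, Sum.map_map]⟩,
     fun {D D' D''} ⟨σ, h⟩ ⟨τ, k⟩ => ⟨σ.trans τ, fun x y => by simp [h, k, Sum.map_map]⟩⟩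

/-- The edges of the concatenation. Edges of the first idag into the middle interface `M` are
composed with the edges of the second one out of `M`; all the other edges are kept. -/
def concatRel {I M O N N' : Type} (R : I ⊕ N → M ⊕ N → Prop) (R' : M ⊕ N' → O ⊕ N' → Prop) :
    I ⊕ (N ⊕ N') → O ⊕ (N ⊕ N') → Prop
  | .inl i, .inl o => ∃ m, R (.inl i) (.inl m) ∧ R' (.inl m) (.inl o)
  | .inl i, .inr (.inl n) => R (.inl i) (.inr n)
  | .inl i, .inr (.inr n') => ∃ m, R (.inl i) (.inl m) ∧ R' (.inl m) (.inr n')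
  | .inr (.inl n), .inl o => ∃ m, R (.inr n) (.inl m) ∧ R' (.inl m) (.inl o)
  | .inr (.inl n), .inr (.inl k) => R (.inr n) (.inr k)
  | .inr (.inl n), .inr (.inr n') => ∃ m, R (.inr n) (.inl m) ∧ R' (.inl m) (.inr n')
  | .inr (.inr n'), .inl o => R' (.inr n') (.inl o)
  | .inr (.inr _), .inr (.inl _) => False
  | .inr (.inr n'), .inr (.inr k') => R' (.inr n') (.inr k')

/-- If a relation on `N + N'` has no step from `N'` to `N`, and restricts to irreflexive
transitive closures on both parts, then its transitive closure is irreflexive. -/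
theorem acyclic_sum {N N' : Type} {r : N ⊕ N' → N ⊕ N' → Prop} {p : N → N → Prop}
    {q : N' → N' → Prop} (hp : ∀ n, ¬ Relation.TransGen p n n)
    (hq : ∀ n, ¬ Relation.TransGen q n n) (h₁ : ∀ x y, r (.inl x) (.inl y) → p x y)
    (h₂ : ∀ x y, r (.inr x) (.inr y) → q x y) (h₃ : ∀ x y, ¬ r (.inr x) (.inl y)) :
    ∀ n, ¬ Relation.TransGen r n n := by
  have key : ∀ x y, Relation.TransGen r x y →
      match x, y with
      | .inl a, .inl b => Relation.TransGen p a b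
      | .inl _, .inr _ => True
      | .inr _, .inl _ => False
      | .inr a, .inr b => Relation.TransGen q a b := by
    intro x y h
    induction h with
    | single h =>
      rename_i z
      rcases x with x | x <;> rcases z with z | z
      · exact .single (h₁ _ _ h)
      · trivial
      · exact h₃ _ _ h
      · exact .single (h₂ _ _ h)
    | tail _ h ih =>
      rename_i z t _
      rcases x with x | x <;> rcases z with z | z <;> rcases t with t | t
      · exact ih.tail (h₁ _ _ h)
      · trivial
      · exact (h₃ _ _ h).elim
      · trivial
      · exact ih.elim
      · exact ih.elim
      · exact h₃ _ _ h
      · exact ih.tail (h₂ _ _ h)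
  rintro (n | n) h
  · exact hp n (key _ _ h)
  · exact hq n (key _ _ h)

/-- Concatenation, in diagrammatic order: first `D`, then `D'`. -/
def concat {I M O : Type} (D : IDag I M) (D' : IDag M O) : IDag I O where
  N := D.N ⊕ D'.N
  finite := by
    have := D.finite
    have := D'.finite
    infer_instance
  R := concatRel D.R D'.R
  acyclic := acyclic_sum D.acyclic D'.acyclic (fun _ _ h => h) (fun _ _ h => h) (fun _ _ h => h)

/-- The edges of the juxtaposition: those of both idags. -/
def juxtRel {I O I' O' N N' : Type} (R : I ⊕ N → O ⊕ N → Prop) (R' : I' ⊕ N' → O' ⊕ N' → Prop) :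
    (I ⊕ I') ⊕ (N ⊕ N') → (O ⊕ O') ⊕ (N ⊕ N') → Prop
  | .inl (.inl i), .inl (.inl o) => R (.inl i) (.inl o)
  | .inl (.inl i), .inr (.inl n) => R (.inl i) (.inr n)
  | .inr (.inl n), .inl (.inl o) => R (.inr n) (.inl o)
  | .inr (.inl n), .inr (.inl k) => R (.inr n) (.inr k)
  | .inl (.inr i), .inl (.inr o) => R' (.inl i) (.inl o)
  | .inl (.inr i), .inr (.inr n) => R' (.inl i) (.inr n)
  | .inr (.inr n), .inl (.inr o) => R' (.inr n) (.inl o)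
  | .inr (.inr n), .inr (.inr k) => R' (.inr n) (.inr k)
  | _, _ => False

/-- Juxtaposition. -/
def juxt {I O I' O' : Type} (D : IDag I O) (D' : IDag I' O') : IDag (I ⊕ I') (O ⊕ O') where
  N := D.N ⊕ D'.N
  finite := by
    have := D.finite
    have := D'.finite
    infer_instance
  R := juxtRel D.R D'.R
  acyclic := acyclic_sum D.acyclic D'.acyclic (fun _ _ h => h) (fun _ _ h => h) (fun _ _ h => h)

/-- Renaming of the interfaces along bijections, on edges. -/
def reindexRel {I I' O O' N : Type} (e : I ≃ I') (f : O ≃ O') (R : I ⊕ N → O ⊕ N → Prop) :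
    I' ⊕ N → O' ⊕ N → Prop :=
  fun x y => R (Sum.map e.symm id x) (Sum.map f.symm id y)

/-- Renaming of the interfaces along bijections. -/
def reindex {I I' O O' : Type} (e : I ≃ I') (f : O ≃ O') (D : IDag I O) : IDag I' O' where
  N := D.N
  finite := D.finite
  R := reindexRel e f D.R
  acyclic := D.acyclic

/-- Juxtaposition of idags between finite ordinals, where the sum of the ordinals `a` and `b` is
identified with the ordinal `a + b` in the usual way. -/
def juxtFin {a b c d : ℕ} (D : IDag (Fin a) (Fin b)) (D' : IDag (Fin c) (Fin d)) :
    IDag (Fin (a + c)) (Fin (b + d)) :=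
  (D.juxt D').reindex finSumFinEquiv finSumFinEquiv

/-- The edges of an idag without internal nodes. -/
def ofRelRel {I O : Type} (r : I → O → Prop) : I ⊕ Empty → O ⊕ Empty → Prop
  | .inl i, .inl o => r i o

/-- A relation as an idag without internal nodes. -/
def ofRel {I O : Type} (r : I → O → Prop) : IDag I O where
  N := Empty
  finite := inferInstance
  R := ofRelRel r
  acyclic n := n.elim

theorem concatRel_congr {I M O N N' L L' : Type} {R : I ⊕ N → M ⊕ N → Prop}
    {R' : M ⊕ N' → O ⊕ N' → Prop} {S : I ⊕ L → M ⊕ L → Prop} {S' : M ⊕ L' → O ⊕ L' → Prop}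
    {σ : N ≃ L} {σ' : N' ≃ L'} (h : ∀ x y, R x y ↔ S (Sum.map id σ x) (Sum.map id σ y))
    (h' : ∀ x y, R' x y ↔ S' (Sum.map id σ' x) (Sum.map id σ' y)) (x y) :
    concatRel R R' x y ↔ concatRel S S' (Sum.map id (Equiv.sumCongr σ σ') x)
      (Sum.map id (Equiv.sumCongr σ σ') y) := by
  rcases x with x | x | x <;> rcases y with y | y | y <;> simp [concatRel, h, h']

theorem concatRel_assoc {I M O P N N' N'' : Type} (R : I ⊕ N → M ⊕ N → Prop)
    (R' : M ⊕ N' → O ⊕ N' → Prop) (R'' : O ⊕ N'' → P ⊕ N'' → Prop) (x y) :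
    concatRel (concatRel R R') R'' x y ↔ concatRel R (concatRel R' R'')
      (Sum.map id (Equiv.sumAssoc N N' N'') x) (Sum.map id (Equiv.sumAssoc N N' N'') y) := by
  rcases x with x | (x | x) | x <;> rcases y with y | (y | y) | y <;> simp [concatRel] <;> grind

theorem concatRel_id {I O N : Type} (R : I ⊕ N → O ⊕ N → Prop) (x y) :
    concatRel R (ofRelRel Eq) x y ↔ R (Sum.map id (Equiv.sumEmpty N Empty) x)
      (Sum.map id (Equiv.sumEmpty N Empty) y) := by
  rcases x with x | x | ⟨⟨⟩⟩ <;> rcases y with y | y | ⟨⟨⟩⟩ <;> simp [concatRel, ofRelRel]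

theorem id_concatRel {I O N : Type} (R : I ⊕ N → O ⊕ N → Prop) (x y) :
    concatRel (ofRelRel Eq) R x y ↔ R (Sum.map id (Equiv.emptySum Empty N) x)
      (Sum.map id (Equiv.emptySum Empty N) y) := by
  rcases x with x | ⟨⟨⟩⟩ | x <;> rcases y with y | ⟨⟨⟩⟩ | y <;> simp [concatRel, ofRelRel]

theorem juxtRel_congr {I O I' O' N N' L L' : Type} {R : I ⊕ N → O ⊕ N → Prop}
    {R' : I' ⊕ N' → O' ⊕ N' → Prop} {S : I ⊕ L → O ⊕ L → Prop} {S' : I' ⊕ L' → O' ⊕ L' → Prop}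
    {σ : N ≃ L} {σ' : N' ≃ L'} (h : ∀ x y, R x y ↔ S (Sum.map id σ x) (Sum.map id σ y))
    (h' : ∀ x y, R' x y ↔ S' (Sum.map id σ' x) (Sum.map id σ' y)) (x y) :
    juxtRel R R' x y ↔ juxtRel S S' (Sum.map id (Equiv.sumCongr σ σ') x)
      (Sum.map id (Equiv.sumCongr σ σ') y) := by
  rcases x with (x | x) | x | x <;> rcases y with (y | y) | y | y <;> simp [juxtRel, h, h']

theorem juxtRel_concatRel {I M O I' M' O' N₁ N₂ N₁' N₂' : Type} (R₁ : I ⊕ N₁ → M ⊕ N₁ → Prop)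
    (R₂ : M ⊕ N₂ → O ⊕ N₂ → Prop) (R₁' : I' ⊕ N₁' → M' ⊕ N₁' → Prop)
    (R₂' : M' ⊕ N₂' → O' ⊕ N₂' → Prop) (x y) :
    juxtRel (concatRel R₁ R₂) (concatRel R₁' R₂') x y ↔
      concatRel (juxtRel R₁ R₁') (juxtRel R₂ R₂')
        (Sum.map id (Equiv.sumSumSumComm N₁ N₂ N₁' N₂') x)
        (Sum.map id (Equiv.sumSumSumComm N₁ N₂ N₁' N₂') y) := by
  rcases x with (x | x) | (x | x) | x | x <;> rcases y with (y | y) | (y | y) | y | y <;>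
    simp [juxtRel, concatRel]

theorem concatRel_reindexRel {I I' M M' O O' N N' : Type} (e : I ≃ I') (f : M ≃ M') (g : O ≃ O')
    (R : I ⊕ N → M ⊕ N → Prop) (R' : M ⊕ N' → O ⊕ N' → Prop) :
    concatRel (reindexRel e f R) (reindexRel f g R') = reindexRel e g (concatRel R R') := by
  ext x y
  rcases x with x | x | x <;> rcases y with y | y | y <;>
    simp [reindexRel, concatRel, f.symm.exists_congr_left]

/-- Case distinction on `Fin (a + (b + c))`. -/
theorem addCases₃ {a b c : ℕ} {p : Fin (a + (b + c)) → Prop}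
    (h₁ : ∀ i, p (Fin.castAdd (b + c) i)) (h₂ : ∀ i, p (Fin.natAdd a (Fin.castAdd c i)))
    (h₃ : ∀ i, p (Fin.natAdd a (Fin.natAdd b i))) (x : Fin (a + (b + c))) : p x :=
  Fin.addCases h₁ (fun y => Fin.addCases h₂ h₃ y) x

theorem cast_left {a b c : ℕ} (h : a + (b + c) = a + b + c) (i : Fin a) :
    Fin.cast h (Fin.castAdd (b + c) i) = Fin.castAdd c (Fin.castAdd b i) := rfl

theorem cast_middle {a b c : ℕ} (h : a + (b + c) = a + b + c) (i : Fin b) :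
    Fin.cast h (Fin.natAdd a (Fin.castAdd c i)) = Fin.castAdd c (Fin.natAdd a i) := rfl

theorem cast_right {a b c : ℕ} (h : a + (b + c) = a + b + c) (i : Fin c) :
    Fin.cast h (Fin.natAdd a (Fin.natAdd b i)) = Fin.natAdd (a + b) i :=
  Fin.ext (Nat.add_assoc a b i).symm

theorem cast_zero {a : ℕ} (h : a = 0 + a) (i : Fin a) : Fin.cast h i = Fin.natAdd 0 i :=
  Fin.ext (Nat.zero_add i).symm

theorem juxtFinRel_assoc {a b a' b' a'' b'' : ℕ} {N N' N'' : Type}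
    (h : a + a' + a'' = a + (a' + a'')) (k : b + b' + b'' = b + (b' + b''))
    (R : Fin a ⊕ N → Fin b ⊕ N → Prop) (R' : Fin a' ⊕ N' → Fin b' ⊕ N' → Prop)
    (R'' : Fin a'' ⊕ N'' → Fin b'' ⊕ N'' → Prop) (x y) :
    reindexRel (finCongr h) (finCongr k) (reindexRel finSumFinEquiv finSumFinEquiv
      (juxtRel (reindexRel finSumFinEquiv finSumFinEquiv (juxtRel R R')) R'')) x y ↔
    reindexRel finSumFinEquiv finSumFinEquiv
      (juxtRel R (reindexRel finSumFinEquiv finSumFinEquiv (juxtRel R' R'')))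
      (Sum.map id (Equiv.sumAssoc N N' N'') x) (Sum.map id (Equiv.sumAssoc N N' N'') y) := by
  rcases x with x | (x | x) | x
  · induction x using addCases₃ <;> rcases y with y | (y | y) | y <;>
      (try induction y using addCases₃) <;>
      simp [reindexRel, juxtRel, cast_left, cast_middle, cast_right]
  all_goals
    rcases y with y | (y | y) | y <;> (try induction y using addCases₃) <;>
      simp [reindexRel, juxtRel, cast_left, cast_middle, cast_right]

theorem unit_juxtFinRel {a b : ℕ} {N : Type} (h : 0 + a = a) (k : 0 + b = b)
    (R : Fin a ⊕ N → Fin b ⊕ N → Prop) (x y) :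
    reindexRel (finCongr h) (finCongr k) (reindexRel finSumFinEquiv finSumFinEquiv
      (juxtRel (ofRelRel (Eq : Fin 0 → Fin 0 → Prop)) R)) x y ↔
    R (Sum.map id (Equiv.emptySum Empty N) x) (Sum.map id (Equiv.emptySum Empty N) y) := by
  rcases x with x | ⟨⟨⟩⟩ | x <;> rcases y with y | ⟨⟨⟩⟩ | y <;>
    simp [reindexRel, juxtRel, cast_zero, -Fin.natAdd_zero]

theorem juxtFinRel_unit {a b : ℕ} {N : Type} (R : Fin a ⊕ N → Fin b ⊕ N → Prop)
    (x : Fin a ⊕ (N ⊕ Empty)) (y : Fin b ⊕ (N ⊕ Empty)) :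
    reindexRel (finSumFinEquiv (n := 0)) (finSumFinEquiv (n := 0))
      (juxtRel R (ofRelRel (Eq : Fin 0 → Fin 0 → Prop))) x y ↔
    R (Sum.map id (Equiv.sumEmpty N Empty) x) (Sum.map id (Equiv.sumEmpty N Empty) y) := by
  have h (n : ℕ) (z : Fin n) : (finSumFinEquiv (n := 0)).symm z = Sum.inl z :=
    finSumFinEquiv_symm_apply_castAdd z
  rcases x with x | x | ⟨⟨⟩⟩ <;> rcases y with y | y | ⟨⟨⟩⟩ <;> simp [reindexRel, juxtRel, h]

theorem flipRel_naturality {a b c d : ℕ} {N N' : Type} (R : Fin a ⊕ N → Fin b ⊕ N → Prop)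
    (R' : Fin c ⊕ N' → Fin d ⊕ N' → Prop) (x y) :
    concatRel (reindexRel finSumFinEquiv finSumFinEquiv (juxtRel R R'))
      (ofRelRel fun x y => finAddFlip x = y) x y ↔
    concatRel (ofRelRel fun x y => finAddFlip x = y)
      (reindexRel finSumFinEquiv finSumFinEquiv (juxtRel R' R))
      (Sum.map id (((Equiv.sumEmpty _ _).trans (Equiv.sumComm _ _)).trans
        (Equiv.emptySum Empty _).symm) x)
      (Sum.map id (((Equiv.sumEmpty _ _).trans (Equiv.sumComm _ _)).trans
        (Equiv.emptySum Empty _).symm) y) := by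
  have h1 : ∀ {m n : ℕ} (x : Fin (m + n)) (y : Fin (n + m)),
    finAddFlip x = y ↔ x = finAddFlip y := fun x y => by
      rw [← Equiv.eq_symm_apply]; rfl
  rcases x with x | (x | x) | ⟨⟨⟩⟩ <;> rcases y with y | (y | y) | ⟨⟨⟩⟩ <;>
    (try induction x using Fin.addCases) <;> (try induction y using Fin.addCases) <;>
    simp [reindexRel, juxtRel, concatRel, ofRelRel, h1]

theorem flipRel_hexagon {a b c : ℕ} (h : a + b + c = a + (b + c)) (k : b + a + c = b + (a + c))
    (l : b + (c + a) = b + c + a) (x : Fin (a + (b + c))) (y : Fin (b + c + a)) :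
    finAddFlip x = y ↔
    concatRel (reindexRel (finCongr h) (finCongr k) (reindexRel finSumFinEquiv finSumFinEquiv
        (juxtRel (ofRelRel fun (x : Fin (a + b)) y => finAddFlip x = y)
          (ofRelRel (Eq : Fin c → Fin c → Prop)))))
      (reindexRel (finCongr rfl) (finCongr l) (reindexRel finSumFinEquiv finSumFinEquiv
        (juxtRel (ofRelRel (Eq : Fin b → Fin b → Prop))
          (ofRelRel fun (x : Fin (a + c)) y => finAddFlip x = y))))
      (Sum.inl x) (Sum.inl y) := by
  have hy : ∃ y', y = Fin.cast l y' := ⟨Fin.cast l.symm y, rfl⟩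
  obtain ⟨y, rfl⟩ := hy
  have e : ∀ p : Fin (b + (a + c)) → Prop, (∃ z, p z) ↔ (∃ i, p (Fin.castAdd _ i)) ∨
      (∃ i, p (Fin.natAdd _ (Fin.castAdd _ i))) ∨ (∃ i, p (Fin.natAdd _ (Fin.natAdd _ i))) := by
    intro p
    refine ⟨fun ⟨z, hz⟩ => ?_, by rintro (⟨i, h⟩ | ⟨i, h⟩ | ⟨i, h⟩) <;> exact ⟨_, h⟩⟩
    induction z using addCases₃
    · exact .inl ⟨_, hz⟩
    · exact .inr (.inl ⟨_, hz⟩)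
    · exact .inr (.inr ⟨_, hz⟩)
  have hy : (finCongr l).symm (Fin.cast l y) = y := (finCongr l).symm_apply_apply y
  have ne : ∀ {m n : ℕ} (i : Fin m) (j : Fin n), Fin.castAdd n i ≠ Fin.natAdd m j := by
    intro m n i j hij
    have := congrArg Fin.val hij
    simp at this
    omega
  have ne' : ∀ {m n : ℕ} (i : Fin m) (j : Fin n), Fin.natAdd m j ≠ Fin.castAdd n i :=
    fun i j => (ne i j).symm
  simp only [concatRel, reindexRel, Sum.map_inl, hy, e]
  induction x using addCases₃ <;> induction y using addCases₃ <;>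
    simp [juxtRel, ofRelRel, ne, ne', cast_left, cast_middle, cast_right]

theorem concat_iso {I M O : Type} {D E : IDag I M} {D' E' : IDag M O} (h : D.Iso E)
    (h' : D'.Iso E') : (D.concat D').Iso (E.concat E') := by
  obtain ⟨σ, h⟩ := h
  obtain ⟨σ', h'⟩ := h'
  exact ⟨Equiv.sumCongr σ σ', concatRel_congr h h'⟩

theorem juxtFin_iso {a b c d : ℕ} {D E : IDag (Fin a) (Fin b)} {D' E' : IDag (Fin c) (Fin d)}
    (h : D.Iso E) (h' : D'.Iso E') : (D.juxtFin D').Iso (E.juxtFin E') := by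
  obtain ⟨σ, h⟩ := h
  obtain ⟨σ', h'⟩ := h'
  refine ⟨Equiv.sumCongr σ σ', fun x y => (juxtRel_congr h h' _ _).trans ?_⟩
  rcases x with x | x <;> rcases y with y | y <;> exact Iff.rfl

/-- The idag of the node `λ : 1 → 1`: one internal node, with an edge from the input and an edge
to the output. -/
def nodeRel : Fin 1 ⊕ Unit → Fin 1 ⊕ Unit → Prop
  | .inl _, .inr _ => True
  | .inr _, .inl _ => True
  | _, _ => False

/-- The idag of the node `λ : 1 → 1`. -/
def node : IDag (Fin 1) (Fin 1) where
  N := Unit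
  finite := inferInstance
  R := nodeRel
  acyclic n h := by
    obtain ⟨_, _, h⟩ := Relation.TransGen.tail'_iff.1 h
    exact h

end IDag

/-- Abstract idags between finite ordinals: isomorphism classes of finite idags. -/
def AbsIDag (a b : ℕ) : Type 1 := Quotient (IDag.setoid (Fin a) (Fin b))

namespace AbsIDag

/-- The abstract idag of an idag. -/
def mk {a b : ℕ} (D : IDag (Fin a) (Fin b)) : AbsIDag a b := Quotient.mk _ D

theorem castHom_mk {a a' b b' : ℕ} (ha : a = a') (hb : b = b') (D : IDag (Fin a) (Fin b)) :
    castHom ha hb (mk D) = mk (D.reindex (finCongr ha) (finCongr hb)) := by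
  subst ha hb
  exact Quotient.sound ⟨Equiv.refl _, fun x y => by
    rcases x with x | x <;> rcases y with y | y <;> exact Iff.rfl⟩

end AbsIDag

open IDag AbsIDag in
/-- The PROP of finite abstract idags: the objects are the finite ordinals, the morphisms are
isomorphism classes of finite idags, composition is concatenation, tensor is juxtaposition, and
identities and symmetries are the graphs of the evident bijections. -/
def dagProp : PROP.{1} where
  Hom := AbsIDag
  id a := mk (ofRel Eq)
  comp := Quotient.map₂ concat fun _ _ h _ _ h' => concat_iso h h'
  tensor := Quotient.map₂ juxtFin fun _ _ h _ _ h' => juxtFin_iso h h'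
  symm a b := mk (ofRel fun x y => finAddFlip x = y)
  id_comp := by
    rintro a b ⟨D⟩
    exact Quotient.sound ⟨Equiv.emptySum Empty D.N, id_concatRel D.R⟩
  comp_id := by
    rintro a b ⟨D⟩
    exact Quotient.sound ⟨Equiv.sumEmpty D.N Empty, concatRel_id D.R⟩
  assoc := by
    rintro a b c d ⟨D⟩ ⟨D'⟩ ⟨D''⟩
    exact Quotient.sound ⟨Equiv.sumAssoc _ _ _, concatRel_assoc D.R D'.R D''.R⟩
  tensor_id a b := by
    refine Quotient.sound ⟨Equiv.sumEmpty Empty Empty, ?_⟩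
    rintro (x | ⟨⟨⟩⟩ | ⟨⟨⟩⟩) (y | ⟨⟨⟩⟩ | ⟨⟨⟩⟩)
    change juxtRel (ofRelRel Eq) (ofRelRel Eq) (Sum.inl (finSumFinEquiv.symm x))
      (Sum.inl (finSumFinEquiv.symm y)) ↔ x = y
    rw [← finSumFinEquiv.symm.apply_eq_iff_eq (x := x)]
    rcases finSumFinEquiv.symm x with x | x <;> rcases finSumFinEquiv.symm y with y | y <;>
      simp [juxtRel, ofRelRel]
  tensor_comp := by
    rintro a b c a' b' c' ⟨D⟩ ⟨E⟩ ⟨D'⟩ ⟨E'⟩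
    refine Quotient.sound ⟨Equiv.sumSumSumComm _ _ _ _, fun x y => ?_⟩
    change reindexRel finSumFinEquiv finSumFinEquiv
      (juxtRel (concatRel D.R E.R) (concatRel D'.R E'.R)) x y ↔
      concatRel (reindexRel finSumFinEquiv finSumFinEquiv (juxtRel D.R D'.R))
        (reindexRel finSumFinEquiv finSumFinEquiv (juxtRel E.R E'.R)) _ _
    rw [concatRel_reindexRel]
    refine (juxtRel_concatRel _ _ _ _ _ _).trans ?_
    rcases x with x | x <;> rcases y with y | y <;> exact Iff.rfl
  tensor_assoc := by
    rintro a b a' b' a'' b'' ⟨D⟩ ⟨D'⟩ ⟨D''⟩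
    exact (castHom_mk _ _ _).trans (Quotient.sound
      ⟨Equiv.sumAssoc _ _ _, juxtFinRel_assoc _ _ D.R D'.R D''.R⟩)
  unit_tensor := by
    rintro a b ⟨D⟩
    exact (castHom_mk _ _ _).trans (Quotient.sound
      ⟨Equiv.emptySum Empty D.N, unit_juxtFinRel _ _ D.R⟩)
  tensor_unit := by
    rintro a b ⟨D⟩
    exact Quotient.sound ⟨Equiv.sumEmpty D.N Empty, juxtFinRel_unit D.R⟩
  symm_naturality := by
    rintro a b c d ⟨D⟩ ⟨D'⟩
    exact Quotient.sound ⟨_, flipRel_naturality D.R D'.R⟩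
  symm_symm a b := by
    refine Quotient.sound ⟨Equiv.sumEmpty Empty Empty, fun x y => ?_⟩
    change concatRel (ofRelRel fun x y => finAddFlip x = y)
      (ofRelRel fun x y => finAddFlip x = y) x y ↔ ofRelRel Eq _ _
    rcases x with x | ⟨⟨⟩⟩ | ⟨⟨⟩⟩
    rcases y with y | ⟨⟨⟩⟩ | ⟨⟨⟩⟩
    induction x using Fin.addCases <;> simp [concatRel, ofRelRel]
  hexagon a b c := by
    refine Eq.trans ?_ (congrArg₂ (Quotient.map₂ concat fun _ _ h _ _ h' => concat_iso h h')
      (castHom_mk _ _ _) (castHom_mk _ _ _)).symm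
    refine Quotient.sound ⟨(Equiv.equivEmpty ((Empty ⊕ Empty) ⊕ (Empty ⊕ Empty))).symm, ?_⟩
    rintro (x | ⟨⟨⟩⟩) (y | ⟨⟨⟩⟩)
    exact flipRel_hexagon _ _ _ x y

open IDag AbsIDag in
/-- The operators as idags between finite ordinals: `η`, `∇`, `ε` and `Δ` have no internal node and
an edge from every input to every output; `λ` is the idag with one internal node on the edge from
the input to the output. -/
def dagOp : ∀ o : dagTheory.Op, dagProp.Hom (dagTheory.dom o) (dagTheory.cod o)
  | .inl .eta => mk (ofRel fun (_ : Fin 0) (_ : Fin 1) => True)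
  | .inl .nabla => mk (ofRel fun (_ : Fin 2) (_ : Fin 1) => True)
  | .inl .eps => mk (ofRel fun (_ : Fin 1) (_ : Fin 0) => True)
  | .inl .delta => mk (ofRel fun (_ : Fin 1) (_ : Fin 2) => True)
  | .inr _ => mk node

section Algebras

variable {C : Type u} [Category.{v} C] [MonoidalCategory C]

/-- The tensor powers of an object, bracketed to the left:
`𝟙`, `𝟙 ⊗ A`, `(𝟙 ⊗ A) ⊗ A`, and so on. -/
def tpow (A : C) : ℕ → C
  | 0 => 𝟙_ C
  | n + 1 => tpow A n ⊗ A

/-- The canonical isomorphism between the `(a + b)`-th tensor power and the tensor product of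
the `a`-th and the `b`-th one. -/
def tpowAdd (A : C) (a : ℕ) : ∀ b : ℕ, tpow A (a + b) ≅ tpow A a ⊗ tpow A b
  | 0 => (ρ_ (tpow A a)).symm
  | b + 1 => whiskerRightIso (tpowAdd A a b) A ≪≫ α_ (tpow A a) (tpow A b) A

/-- The tensor powers of a morphism. -/
def tpowMap {A B : C} (f : A ⟶ B) : ∀ n : ℕ, tpow A n ⟶ tpow B n
  | 0 => 𝟙 _
  | n + 1 => tpowMap f n ⊗ₘ f

theorem tpowMap_id (A : C) (n : ℕ) : tpowMap (𝟙 A) n = 𝟙 _ := by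
  induction n with
  | zero => rfl
  | succ n ih => simp [tpowMap, ih, tpow]

theorem tpowMap_comp {A B D : C} (f : A ⟶ B) (g : B ⟶ D) (n : ℕ) :
    tpowMap (f ≫ g) n = tpowMap f n ≫ tpowMap g n := by
  induction n with
  | zero => exact (Category.id_comp _).symm
  | succ n ih => exact (congrArg (· ⊗ₘ (f ≫ g)) ih).trans (tensorHom_comp_tensorHom _ _ _ _).symm

variable [SymmetricCategory C]

/-- The interpretation of expressions in a symmetric monoidal category, given an object `A` and
an interpretation of the operators as morphisms between tensor powers of `A`. -/
def Expr.interp {S : Signature} (A : C) (m : ∀ o : S.Op, tpow A (S.dom o) ⟶ tpow A (S.cod o)) :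
    ∀ {a b : ℕ}, Expr S a b → (tpow A a ⟶ tpow A b)
  | _, _, .op o => m o
  | _, _, .id a => 𝟙 (tpow A a)
  | _, _, .comp f g => f.interp A m ≫ g.interp A m
  | _, _, .tensor (a := a) (b := b) (c := c) (d := d) f g =>
      (tpowAdd A a c).hom ≫ (f.interp A m ⊗ₘ g.interp A m) ≫ (tpowAdd A b d).inv
  | _, _, .symm a b =>
      (tpowAdd A a b).hom ≫ (β_ (tpow A a) (tpow A b)).hom ≫ (tpowAdd A b a).inv

variable (C) in
/-- The algebras of a theory in a symmetric monoidal category. -/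
structure Alg (T : SMTheory) where
  carrier : C
  op : ∀ o : T.Op, tpow carrier (T.dom o) ⟶ tpow carrier (T.cod o)
  eqn : ∀ {a b : ℕ} {f g : Expr T.toSignature a b}, T.Eqn f g →
    f.interp carrier op = g.interp carrier op

namespace Alg

/-- Homomorphisms of algebras. -/
@[ext]
structure Hom {T : SMTheory} (A B : Alg C T) where
  hom : A.carrier ⟶ B.carrier
  comm : ∀ o : T.Op, tpowMap hom (T.dom o) ≫ B.op o = A.op o ≫ tpowMap hom (T.cod o)

instance (T : SMTheory) : Category (Alg C T) where
  Hom := Hom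
  id A := ⟨𝟙 _, by simp [tpowMap_id]⟩
  comp f g := ⟨f.hom ≫ g.hom, fun o => by
    rw [tpowMap_comp, tpowMap_comp, Category.assoc, g.comm, ← Category.assoc, f.comm,
      Category.assoc]⟩
  id_comp f := Hom.ext (Category.id_comp f.hom)
  comp_id f := Hom.ext (Category.comp_id f.hom)
  assoc f g h := Hom.ext (Category.assoc f.hom g.hom h.hom)

end Alg

end Algebras

section Powers

open Functor.LaxMonoidal Functor.OplaxMonoidal Functor.Monoidal

variable {D : Type u'} [Category.{v'} D] [MonoidalCategory D]
variable {C : Type u} [Category.{v} C] [MonoidalCategory C]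

/-- A monoidal functor preserves tensor powers up to a canonical isomorphism. -/
def tpowIso (G : D ⥤ C) [G.Monoidal] (A : D) : ∀ n : ℕ, tpow (G.obj A) n ≅ G.obj (tpow A n)
  | 0 => εIso G
  | n + 1 => whiskerRightIso (tpowIso G A n) (G.obj A) ≪≫ μIso G (tpow A n) A

theorem tpowIso_add (G : D ⥤ C) [G.Monoidal] (A : D) (a b : ℕ) :
    tpowIso G A (a + b) = tpowAdd (G.obj A) a b ≪≫ (tpowIso G A a ⊗ᵢ tpowIso G A b) ≪≫
      μIso G (tpow A a) (tpow A b) ≪≫ (G.mapIso (tpowAdd A a b)).symm := by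
  suffices h : (tpowIso G A (a + b)).hom ≫ G.map (tpowAdd A a b).hom =
      (tpowAdd (G.obj A) a b).hom ≫ ((tpowIso G A a).hom ⊗ₘ (tpowIso G A b).hom) ≫
        μ G (tpow A a) (tpow A b) by
    ext
    rw [← cancel_mono (G.map (tpowAdd A a b).hom), h]
    simp [← G.map_comp]
  induction b with
  | zero =>
    change (tpowIso G A a).hom ≫ G.map (ρ_ (tpow A a)).inv =
      (ρ_ (tpow (G.obj A) a)).inv ≫ ((tpowIso G A a).hom ⊗ₘ ε G) ≫ μ G (tpow A a) (𝟙_ D)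
    rw [MonoidalCategory.tensorHom_def, Category.assoc, ← rightUnitor_inv_naturality_assoc,
      Functor.Monoidal.map_rightUnitor_inv]
  | succ b ih =>
    change ((tpowIso G A (a + b)).hom ▷ G.obj A ≫ μ G (tpow A (a + b)) A) ≫
        G.map ((tpowAdd A a b).hom ▷ A ≫ (α_ (tpow A a) (tpow A b) A).hom) =
      ((tpowAdd (G.obj A) a b).hom ▷ G.obj A ≫
        (α_ (tpow (G.obj A) a) (tpow (G.obj A) b) (G.obj A)).hom) ≫
        ((tpowIso G A a).hom ⊗ₘ ((tpowIso G A b).hom ▷ G.obj A ≫ μ G (tpow A b) A)) ≫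
          μ G (tpow A a) (tpow A b ⊗ A)
    rw [G.map_comp, Category.assoc, ← μ_natural_left_assoc, ← comp_whiskerRight_assoc, ih]
    simp [MonoidalCategory.tensorHom_def]

theorem tpowIso_natural (G : D ⥤ C) [G.Monoidal] {A B : D} (f : A ⟶ B) (n : ℕ) :
    tpowMap (G.map f) n ≫ (tpowIso G B n).hom = (tpowIso G A n).hom ≫ G.map (tpowMap f n) := by
  induction n with
  | zero =>
    change 𝟙 _ ≫ ε G = ε G ≫ G.map (𝟙 _)
    simp
  | succ n ih =>
    change (tpowMap (G.map f) n ⊗ₘ G.map f) ≫ (tpowIso G B n).hom ▷ G.obj B ≫ μ G (tpow B n) B =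
      ((tpowIso G A n).hom ▷ G.obj A ≫ μ G (tpow A n) A) ≫ G.map (tpowMap f n ⊗ₘ f)
    rw [Category.assoc, ← μ_natural, ← tensorHom_id, ← tensorHom_id,
      tensorHom_comp_tensorHom_assoc, tensorHom_comp_tensorHom_assoc, ih]
    simp

/-- The value of a monoidal functor on the object `n` of a PROP is canonically the `n`-th tensor
power of its value on the object `1`. -/
def genIso {P : PROP.{w}} (F : P.Obj ⥤ C) [F.Monoidal] :
    ∀ n : ℕ, tpow (F.obj ⟨1⟩) n ≅ F.obj ⟨n⟩
  | 0 => εIso F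
  | n + 1 => whiskerRightIso (genIso F n) (F.obj ⟨1⟩) ≪≫ μIso F ⟨n⟩ ⟨1⟩

theorem genIso_add {P : PROP.{w}} (F : P.Obj ⥤ C) [F.Monoidal] (a b : ℕ) :
    genIso F (a + b) = tpowAdd (F.obj ⟨1⟩) a b ≪≫ (genIso F a ⊗ᵢ genIso F b) ≪≫
      μIso F ⟨a⟩ ⟨b⟩ := by
  ext
  induction b with
  | zero =>
    change (genIso F a).hom = (ρ_ (tpow (F.obj ⟨1⟩) a)).inv ≫ ((genIso F a).hom ⊗ₘ ε F) ≫
      μ F ⟨a⟩ (𝟙_ P.Obj)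
    have h : F.map (ρ_ (⟨a⟩ : P.Obj)).inv = 𝟙 (F.obj ⟨a⟩) := F.map_id _
    rw [MonoidalCategory.tensorHom_def, Category.assoc, ← rightUnitor_inv_naturality_assoc,
      ← Functor.Monoidal.map_rightUnitor_inv, h]
    exact (Category.comp_id _).symm
  | succ b ih =>
    change (genIso F (a + b)).hom ▷ F.obj ⟨1⟩ ≫ μ F ⟨a + b⟩ ⟨1⟩ =
      ((tpowAdd (F.obj ⟨1⟩) a b).hom ▷ F.obj ⟨1⟩ ≫
        (α_ (tpow (F.obj ⟨1⟩) a) (tpow (F.obj ⟨1⟩) b) (F.obj ⟨1⟩)).hom) ≫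
        ((genIso F a).hom ⊗ₘ ((genIso F b).hom ▷ F.obj ⟨1⟩ ≫ μ F ⟨b⟩ ⟨1⟩)) ≫
          μ F ⟨a⟩ (⟨b⟩ ⊗ ⟨1⟩)
    have h : F.map (α_ (⟨a⟩ : P.Obj) ⟨b⟩ ⟨1⟩).hom = 𝟙 (F.obj ⟨a + b + 1⟩) := F.map_id _
    have h2 := Functor.LaxMonoidal.associativity F (⟨a⟩ : P.Obj) ⟨b⟩ ⟨1⟩
    rw [h] at h2
    have h3 : μ F (⟨a⟩ : P.Obj) ⟨b⟩ ▷ F.obj ⟨1⟩ ≫ μ F ⟨a + b⟩ ⟨1⟩ =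
      (α_ (F.obj ⟨a⟩) (F.obj ⟨b⟩) (F.obj ⟨1⟩)).hom ≫ F.obj ⟨a⟩ ◁ μ F ⟨b⟩ ⟨1⟩ ≫
        μ F ⟨a⟩ (⟨b⟩ ⊗ ⟨1⟩) := by
      rw [← h2]
      exact congrArg (_ ≫ ·) (Category.comp_id _).symm
    rw [ih]
    simp [MonoidalCategory.tensorHom_def, h3]

theorem genIso_natural {P : PROP.{w}} {F G : P.Obj ⥤ C} [F.Monoidal] [G.Monoidal] (α : F ⟶ G)
    [NatTrans.IsMonoidal α] (n : ℕ) :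
    tpowMap (α.app ⟨1⟩) n ≫ (genIso G n).hom = (genIso F n).hom ≫ α.app ⟨n⟩ := by
  induction n with
  | zero =>
    change 𝟙 _ ≫ ε G = ε F ≫ α.app (𝟙_ P.Obj)
    simp
  | succ n ih =>
    change (tpowMap (α.app ⟨1⟩) n ⊗ₘ α.app ⟨1⟩) ≫ (genIso G n).hom ▷ G.obj ⟨1⟩ ≫ μ G ⟨n⟩ ⟨1⟩ =
      ((genIso F n).hom ▷ F.obj ⟨1⟩ ≫ μ F ⟨n⟩ ⟨1⟩) ≫ α.app (⟨n⟩ ⊗ ⟨1⟩)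
    rw [Category.assoc, NatTrans.IsMonoidal.tensor, ← tensorHom_id, ← tensorHom_id,
      tensorHom_comp_tensorHom_assoc, tensorHom_comp_tensorHom_assoc, ih]
    simp

end Powers

section Functors

open Functor.LaxMonoidal Functor.OplaxMonoidal Functor.Monoidal

variable (D : Type u') [Category.{v'} D] [MonoidalCategory D] [SymmetricCategory D]
variable (C : Type u) [Category.{v} C] [MonoidalCategory C] [SymmetricCategory C]

/-- Symmetric (strong) monoidal functors. -/
structure SymMonFunctor where
  F : D ⥤ C
  braided : F.Braided

attribute [instance] SymMonFunctor.braided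

variable {D C}

namespace SymMonFunctor

/-- Monoidal natural transformations between symmetric monoidal functors. -/
@[ext]
structure Hom (F G : SymMonFunctor D C) where
  nat : F.F ⟶ G.F
  isMonoidal : NatTrans.IsMonoidal nat

attribute [instance] Hom.isMonoidal

instance : Category (SymMonFunctor D C) where
  Hom := Hom
  id F := ⟨𝟙 F.F, inferInstance⟩
  comp f g := ⟨f.nat ≫ g.nat, inferInstance⟩
  id_comp f := Hom.ext (Category.id_comp f.nat)
  comp_id f := Hom.ext (Category.comp_id f.nat)
  assoc f g h := Hom.ext (Category.assoc f.nat g.nat h.nat)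

/-- Postcomposition with a symmetric monoidal functor. -/
def postcomp {E : Type*} [Category* E] [MonoidalCategory E] [SymmetricCategory E]
    (G : SymMonFunctor D C) : SymMonFunctor E D ⥤ SymMonFunctor E C where
  obj F := ⟨F.F ⋙ G.F, inferInstance⟩
  map α := ⟨Functor.whiskerRight α.nat G.F, inferInstance⟩
  map_id _ := Hom.ext (Functor.whiskerRight_id' G.F)
  map_comp α β := Hom.ext (Functor.whiskerRight_comp α.nat β.nat G.F)

end SymMonFunctor

theorem interp_map {S : Signature} (G : D ⥤ C) [G.Braided] (A : D)
    (m : ∀ o : S.Op, tpow A (S.dom o) ⟶ tpow A (S.cod o)) {a b : ℕ} (f : Expr S a b) :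
    f.interp (G.obj A)
        (fun o => (tpowIso G A (S.dom o)).hom ≫ G.map (m o) ≫ (tpowIso G A (S.cod o)).inv) =
      (tpowIso G A a).hom ≫ G.map (f.interp A m) ≫ (tpowIso G A b).inv := by
  induction f with
  | op o => rfl
  | id a => simp [Expr.interp]
  | comp f g hf hg => simp [Expr.interp, hf, hg]
  | tensor f g hf hg =>
    simp only [Expr.interp, hf, hg, tpowIso_add, ← tensorHom_comp_tensorHom]
    simp [-tensorHom_comp_tensorHom, -tensorHom_comp_tensorHom_assoc]
    rw [← μ_natural_assoc, Functor.Monoidal.μ_δ_assoc]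
  | symm a b =>
    simp only [Expr.interp, tpowIso_add]
    simp

/-- The image of an algebra under a symmetric monoidal functor. -/
def Alg.map {T : SMTheory} (G : SymMonFunctor D C) : Alg D T ⥤ Alg C T where
  obj A :=
    { carrier := G.F.obj A.carrier
      op := fun o => (tpowIso G.F A.carrier (T.dom o)).hom ≫ G.F.map (A.op o) ≫
        (tpowIso G.F A.carrier (T.cod o)).inv
      eqn := fun h => by rw [interp_map, interp_map, A.eqn h] }
  map {A B} f :=
    { hom := G.F.map f.hom
      comm := fun o => by
        have h := tpowIso_natural G.F f.hom
        have h' : (tpowIso G.F A.carrier (T.cod o)).inv ≫ tpowMap (G.F.map f.hom) (T.cod o) =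
            G.F.map (tpowMap f.hom (T.cod o)) ≫ (tpowIso G.F B.carrier (T.cod o)).inv := by
          rw [Iso.inv_comp_eq, ← Category.assoc, ← h, Category.assoc, Iso.hom_inv_id,
            Category.comp_id]
        rw [Category.assoc, Category.assoc, h', ← G.F.map_comp_assoc, ← f.comm,
          G.F.map_comp_assoc, ← Category.assoc, h, Category.assoc] }
  map_id A := Hom.ext (G.F.map_id _)
  map_comp f g := Hom.ext (G.F.map_comp f.hom g.hom)

theorem interp_gen {S : Signature} {P : PROP.{w}} (F : P.Obj ⥤ C) [F.Braided]
    (m : ∀ o : S.Op, P.Hom (S.dom o) (S.cod o)) {a b : ℕ} (f : Expr S a b) :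
    f.interp (F.obj ⟨1⟩) (fun o => (genIso F (S.dom o)).hom ≫
        F.map (m o : (⟨S.dom o⟩ : P.Obj) ⟶ ⟨S.cod o⟩) ≫ (genIso F (S.cod o)).inv) =
      (genIso F a).hom ≫ F.map (f.evalProp P m : (⟨a⟩ : P.Obj) ⟶ ⟨b⟩) ≫ (genIso F b).inv := by
  induction f with
  | op o => rfl
  | id a =>
    change 𝟙 _ = (genIso F a).hom ≫ F.map (𝟙 (⟨a⟩ : P.Obj)) ≫ (genIso F a).inv
    simp
  | @comp a b c f g hf hg =>
    change _ ≫ _ = (genIso F a).hom ≫ F.map ((f.evalProp P m : (⟨a⟩ : P.Obj) ⟶ ⟨b⟩) ≫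
      (g.evalProp P m : (⟨b⟩ : P.Obj) ⟶ ⟨c⟩)) ≫ (genIso F c).inv
    rw [hf, hg]
    simp
  | @tensor a b c d f g hf hg =>
    change _ ≫ (_ ⊗ₘ _) ≫ _ = (genIso F (a + c)).hom ≫ F.map
      ((f.evalProp P m : (⟨a⟩ : P.Obj) ⟶ ⟨b⟩) ⊗ₘ (g.evalProp P m : (⟨c⟩ : P.Obj) ⟶ ⟨d⟩)) ≫
        (genIso F (b + d)).inv
    rw [hf, hg, genIso_add, genIso_add]
    simp only [← tensorHom_comp_tensorHom]
    simp [-tensorHom_comp_tensorHom, -tensorHom_comp_tensorHom_assoc]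
    rw [← μ_natural_assoc, Functor.Monoidal.μ_δ_assoc]
  | symm a b =>
    change _ = (genIso F (a + b)).hom ≫ F.map (β_ (⟨a⟩ : P.Obj) ⟨b⟩).hom ≫ (genIso F (b + a)).inv
    rw [genIso_add, genIso_add]
    simp [Expr.interp]

/-- Evaluation at the generic algebra: a symmetric monoidal functor `F` on a PROP carrying an
algebra structure on its generating object `1` goes to the induced algebra structure on `F 1`. -/
def GenAlg.ev {T : SMTheory} {P : PROP.{w}} (M : GenAlg T P) (C : Type u) [Category.{v} C]
    [MonoidalCategory C] [SymmetricCategory C] : SymMonFunctor P.Obj C ⥤ Alg C T where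
  obj F :=
    { carrier := F.F.obj ⟨1⟩
      op := fun o => (genIso F.F (T.dom o)).hom ≫
        F.F.map (M.op o : (⟨T.dom o⟩ : P.Obj) ⟶ ⟨T.cod o⟩) ≫ (genIso F.F (T.cod o)).inv
      eqn := fun h => by rw [interp_gen, interp_gen, M.eqn h] }
  map {F G} α :=
    { hom := α.nat.app ⟨1⟩
      comm := fun o => by
        have h := genIso_natural α.nat
        have h' : (genIso F.F (T.cod o)).inv ≫ tpowMap (α.nat.app ⟨1⟩) (T.cod o) =
            α.nat.app ⟨T.cod o⟩ ≫ (genIso G.F (T.cod o)).inv := by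
          rw [Iso.inv_comp_eq, ← Category.assoc, ← h, Category.assoc, Iso.hom_inv_id,
            Category.comp_id]
        rw [Category.assoc, Category.assoc, h', ← Category.assoc, h, Category.assoc,
          α.nat.naturality_assoc] }
  map_id _ := rfl
  map_comp _ _ := rfl

end Functors

/-!
The copyable and discardable morphisms of a PROP with a commutative comonoid on `1` form a
category with finite products (Fox), and in a degenerate commutative bialgebra the multiplication
makes the copyable morphisms `n ⟶ 1` join-semilattices in which the projections generate a copy of
the relations from `n` to `1`; so relations act as morphisms. Together with a morphism
`l : 1 ⟶ 1` this evaluates an idag: split off a minimal internal node `x` as the relation that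
collects the inputs of `x` next to the wires that go on, followed by `l`, and evaluate what is left
with the output of `x` as a new input. Two minimal nodes can be split off in either order, so the
value does not depend on the choices, and it is compatible with isomorphisms, concatenation and
juxtaposition. Since every relation is the value of an expression, the same decomposition shows
that idags are generated by the operators, and both facts together say that `dagAlg` is free among
the algebras in PROPs. An algebra in a symmetric monoidal category is one in the PROP of morphisms
between the tensor powers of its carrier.
-/

section TensorRightComm

variable {C : Type u} [Category.{v} C] [MonoidalCategory C] [SymmetricCategory C]

/-- The exchange of the last two factors of a tensor product of three. -/
def tensorRightComm (X Y Z : C) : (X ⊗ Y) ⊗ Z ⟶ (X ⊗ Z) ⊗ Y :=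
  (α_ X Y Z).hom ≫ X ◁ (β_ Y Z).hom ≫ (α_ X Z Y).inv

theorem tensorRightComm_tensorRightComm (X Y Z : C) :
    tensorRightComm X Y Z ≫ tensorRightComm X Z Y = 𝟙 _ := by
  simp only [tensorRightComm, Category.assoc, Iso.inv_hom_id_assoc,
    ← MonoidalCategory.whiskerLeft_comp_assoc, SymmetricCategory.symmetry,
    MonoidalCategory.whiskerLeft_id, Category.id_comp, Iso.hom_inv_id]

theorem tensorRightComm_natural {X Y Z T U : C} (h : Y ⟶ T) (k : Z ⟶ U) :
    (X ◁ k) ▷ Y ≫ (X ⊗ U) ◁ h ≫ tensorRightComm X U T =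
      tensorRightComm X Z Y ≫ (X ◁ h) ▷ Z ≫ (X ⊗ T) ◁ k := by
  have hβ : k ▷ Y ≫ U ◁ h ≫ (β_ U T).hom = (β_ Z Y).hom ≫ h ▷ Z ≫ T ◁ k := by
    rw [BraidedCategory.braiding_naturality_right, BraidedCategory.braiding_naturality_left_assoc,
      whisker_exchange]
  simp only [tensorRightComm, whisker_assoc, tensor_whiskerLeft, Category.assoc,
    Iso.inv_hom_id_assoc, ← MonoidalCategory.whiskerLeft_comp_assoc, hβ]

end TensorRightComm

section Comonoids

open ComonObj

variable {C : Type u} [Category.{v} C] [MonoidalCategory C] {X Y Z : C}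

theorem comonObj_ext {s t : ComonObj X} (counit : s.counit = t.counit) (comul : s.comul = t.comul) :
    s = t := by
  cases s
  cases t
  congr

theorem comonObj_eq_of_isComonHom_id (s t : ComonObj X) (h : @IsComonHom C _ _ X X s t (𝟙 X)) :
    s = t :=
  comonObj_ext (by simpa using h.hom_counit.symm) (by simpa using h.hom_comul.symm)

variable [SymmetricCategory C] [ComonObj X] [ComonObj Y] [ComonObj Z]

theorem isComonHom_associator_hom : IsComonHom (α_ X Y Z).hom := by
  have e : (α_ (Comon.mk X) (Comon.mk Y) (Comon.mk Z)).hom.hom = (α_ X Y Z).hom := by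
    rw [Comon.monoidal_associator_hom_hom]
    change 𝟙 (X ⊗ Y) ▷ Z ≫ (α_ X Y Z).hom ≫ X ◁ 𝟙 (Y ⊗ Z) = _
    simp
  exact e ▸ (α_ (Comon.mk X) (Comon.mk Y) (Comon.mk Z)).hom.isComonHom_hom

theorem isComonHom_leftUnitor_hom :
    letI := ComonObj.instTensorUnit C
    IsComonHom (λ_ X).hom := by
  have e : (λ_ (Comon.mk X)).hom.hom = (λ_ X).hom := by
    rw [Comon.monoidal_leftUnitor_hom_hom]
    change 𝟙 (𝟙_ C) ▷ X ≫ (λ_ X).hom = _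
    simp
  exact e ▸ (λ_ (Comon.mk X)).hom.isComonHom_hom

theorem isComonHom_rightUnitor_hom :
    letI := ComonObj.instTensorUnit C
    IsComonHom (ρ_ X).hom := by
  have e : (ρ_ (Comon.mk X)).hom.hom = (ρ_ X).hom := by
    rw [Comon.monoidal_rightUnitor_hom_hom]
    change X ◁ 𝟙 (𝟙_ C) ≫ (ρ_ X).hom = _
    simp
  exact e ▸ (ρ_ (Comon.mk X)).hom.isComonHom_hom

end Comonoids

section Deterministic

open ComonObj CopyDiscardCategory

variable (C : Type u) [Category.{v} C] [MonoidalCategory C] [CopyDiscardCategory C]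

-- The copying of a tensor product is used as an operation of its own, rather than unfolded.
local instance (X Y : C) : ComonObj (X ⊗ Y) := comonObj (X ⊗ Y)

/-- The property of being a deterministic morphism of a copy-discard category. The deterministic
morphisms form a category in which the tensor product is the cartesian product. -/
def deterministic : MorphismProperty C := fun _ _ f => Deterministic f

variable {C}

instance (X : C) : Deterministic ε[X] where
  hom_counit := by rw [discard_unit, Category.comp_id]
  hom_comul := by
    rw [copy_unit, MonoidalCategory.tensorHom_def', ← Category.assoc, comul_counit,
      unitors_inv_equal, rightUnitor_inv_naturality]

instance (X : C) : Deterministic Δ[X] where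
  hom_counit := by
    rw [discard_tensor, ← Category.assoc, counit_comul_hom]
    simp
  hom_comul := by
    have h : Δ[X] ≫ (Δ[X] ⊗ₘ Δ[X]) = Δ[X] ≫ X ◁ (Δ[X] ≫ Δ[X] ▷ X ≫ (α_ X X X).hom) ≫
        (α_ X X (X ⊗ X)).inv := by
      rw [← comul_assoc, MonoidalCategory.whiskerLeft_comp_assoc,
        associator_inv_naturality_right, ← comul_assoc_flip_assoc,
        MonoidalCategory.tensorHom_def]
    rw [copy_tensor, ← Category.assoc, h]
    simp only [tensorμ, Category.assoc, Iso.inv_hom_id_assoc, Iso.hom_inv_id_assoc,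
      ← MonoidalCategory.whiskerLeft_comp_assoc]
    rw [← comp_whiskerRight_assoc, IsCommComonObj.comul_comm]

instance {X Y Z W : C} (f : X ⟶ Y) (g : Z ⟶ W) [Deterministic f] [Deterministic g] :
    Deterministic (f ⊗ₘ g) where
  hom_counit := by
    rw [discard_tensor, discard_tensor, tensorHom_comp_tensorHom_assoc, IsComonHom.hom_counit,
      IsComonHom.hom_counit]
  hom_comul := by
    rw [copy_tensor, copy_tensor, tensorHom_comp_tensorHom_assoc, IsComonHom.hom_comul,
      IsComonHom.hom_comul, ← tensorHom_comp_tensorHom, Category.assoc, Category.assoc,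
      tensorμ_natural]

theorem comonObj_tensor (X Y : C) : comonObj (X ⊗ Y) = Comon.instComonObjTensorObj X Y :=
  comonObj_ext (discard_tensor X Y) ((copy_tensor X Y).trans (Comon.tensorObj_comul X Y).symm)

theorem comonObj_unit : comonObj (𝟙_ C) = ComonObj.instTensorUnit C :=
  comonObj_ext discard_unit copy_unit

instance (X Y Z : C) : Deterministic (α_ X Y Z).hom := by
  unfold Deterministic
  rw [comonObj_tensor, comonObj_tensor, comonObj_tensor, comonObj_tensor]
  exact @isComonHom_associator_hom C _ _ X Y Z _ _ _ _

instance (X : C) : Deterministic (λ_ X).hom := by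
  unfold Deterministic
  rw [comonObj_tensor, comonObj_unit]
  exact @isComonHom_leftUnitor_hom C _ _ X _ _

instance (X : C) : Deterministic (ρ_ X).hom := by
  unfold Deterministic
  rw [comonObj_tensor, comonObj_unit]
  exact @isComonHom_rightUnitor_hom C _ _ X _ _

instance {X Y : C} (f : X ⟶ Y) (Z : C) [Deterministic f] : Deterministic (Z ◁ f) :=
  MonoidalCategory.id_tensorHom Z f ▸ inferInstance

instance {X Y : C} (f : X ⟶ Y) (Z : C) [Deterministic f] : Deterministic (f ▷ Z) :=
  MonoidalCategory.tensorHom_id f Z ▸ inferInstance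

theorem copy_tensor_projections (X Y : C) :
    Δ[X ⊗ Y] ≫ (X ◁ ε[Y] ≫ (ρ_ X).hom ⊗ₘ ε[X] ▷ Y ≫ (λ_ Y).hom) = 𝟙 (X ⊗ Y) := by
  rw [copy_tensor, ← tensorHom_comp_tensorHom, ← id_tensorHom, ← tensorHom_id, Category.assoc,
    ← tensorμ_natural_assoc, tensorHom_comp_tensorHom_assoc, id_tensorHom, comul_counit,
    tensorHom_id, counit_comul, tensorμ, braiding_tensorUnit_left]
  monoidal

instance (X Y : C) : Deterministic (β_ X Y).hom := by
  have h : (β_ X Y).hom = Δ[X ⊗ Y] ≫ (ε[X] ▷ Y ≫ (λ_ Y).hom ⊗ₘ X ◁ ε[Y] ≫ (ρ_ X).hom) := by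
    rw [← Category.id_comp (β_ X Y).hom, ← copy_tensor_projections, Category.assoc,
      BraidedCategory.braiding_naturality, ← Category.assoc, IsCommComonObj.comul_comm]
  rw [h]
  infer_instance

/-- The graph of a morphism, which keeps its argument and appends the value. -/
def graphHom {X T : C} (h : X ⟶ T) : X ⟶ X ⊗ T := Δ[X] ≫ X ◁ h

theorem graphHom_comp {X Y T : C} (h : X ⟶ Y) (k : Y ⟶ T) :
    graphHom (h ≫ k) = graphHom h ≫ X ◁ k := by
  rw [graphHom, graphHom, MonoidalCategory.whiskerLeft_comp, Category.assoc]

theorem comp_graphHom {X Y T : C} (g : X ⟶ Y) [Deterministic g] (h : Y ⟶ T) :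
    g ≫ graphHom h = graphHom (g ≫ h) ≫ g ▷ T := by
  rw [graphHom, IsComonHom.hom_comul_assoc, graphHom, MonoidalCategory.whiskerLeft_comp,
    Category.assoc, Category.assoc, whisker_exchange, tensorHom_def'_assoc]

theorem comul_tensor_whiskerLeft_fst (X T : C) :
    Δ[X ⊗ T] ≫ (X ⊗ T) ◁ (X ◁ ε[T] ≫ (ρ_ X).hom) =
      Δ[X] ▷ T ≫ tensorRightComm X X T := by
  rw [copy_tensor, MonoidalCategory.whiskerLeft_comp, Category.assoc, ← id_tensorHom (X ⊗ T),
    ← id_tensorHom X, ← id_tensorHom_id, ← tensorμ_natural_assoc, id_tensorHom_id,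
    tensorHom_comp_tensorHom_assoc, Category.comp_id, id_tensorHom, comul_counit, tensorμ,
    tensorRightComm]
  monoidal

theorem comul_comul_tensorRightComm (X : C) :
    Δ[X] ≫ Δ[X] ▷ X ≫ tensorRightComm X X X = Δ[X] ≫ Δ[X] ▷ X := by
  rw [tensorRightComm, ← comul_assoc_assoc, ← MonoidalCategory.whiskerLeft_comp_assoc,
    IsCommComonObj.comul_comm, comul_assoc_flip]

theorem graphHom_fst_comp {X U : C} (T : C) (k : X ⟶ U) :
    graphHom ((X ◁ ε[T] ≫ (ρ_ X).hom) ≫ k) = graphHom k ▷ T ≫ tensorRightComm X U T := by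
  rw [graphHom, MonoidalCategory.whiskerLeft_comp, ← Category.assoc, comul_tensor_whiskerLeft_fst]
  simp only [graphHom, tensorRightComm, comp_whiskerRight, whisker_assoc, tensor_whiskerLeft,
    Category.assoc, Iso.inv_hom_id_assoc, ← MonoidalCategory.whiskerLeft_comp_assoc,
    BraidedCategory.braiding_naturality_left]

theorem graphHom_comp_graphHom_whiskerRight {X T U : C} (h : X ⟶ T) (k : X ⟶ U) :
    graphHom h ≫ graphHom k ▷ T ≫ tensorRightComm X U T = graphHom k ≫ graphHom h ▷ U := by
  have expand {T U : C} (h : X ⟶ T) (k : X ⟶ U) : graphHom h ≫ graphHom k ▷ T =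
      Δ[X] ≫ Δ[X] ▷ X ≫ (X ◁ k) ▷ X ≫ (X ⊗ U) ◁ h := by
    rw [graphHom, Category.assoc, whisker_exchange, graphHom, comp_whiskerRight, Category.assoc]
  rw [reassoc_of% expand h k, expand k h, tensorRightComm_natural,
    reassoc_of% comul_comul_tensorRightComm]

theorem graphHom_exchange {X T U : C} (h : X ⟶ T) (k : X ⟶ U) :
    graphHom h ≫ graphHom ((X ◁ ε[T] ≫ (ρ_ X).hom) ≫ k) ≫ tensorRightComm X T U =
      graphHom k ≫ graphHom ((X ◁ ε[U] ≫ (ρ_ X).hom) ≫ h) := by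
  rw [graphHom_fst_comp, graphHom_fst_comp, Category.assoc, tensorRightComm_tensorRightComm,
    Category.comp_id, graphHom_comp_graphHom_whiskerRight k h]

instance : (deterministic C).IsMultiplicative where
  id_mem X := inferInstanceAs (IsComonHom (𝟙 X))
  comp_mem f g (_ : IsComonHom f) (_ : IsComonHom g) := inferInstanceAs (IsComonHom (f ≫ g))

instance : (deterministic C).IsStableUnderBraiding where
  toIsMonoidal := .mk' _ fun f g (_ : Deterministic f) (_ : Deterministic g) =>
    inferInstanceAs (Deterministic (f ⊗ₘ g))
  associator_hom_mem X Y Z := inferInstanceAs (Deterministic (α_ X Y Z).hom)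
  associator_inv_mem X Y Z := inferInstanceAs (Deterministic (α_ X Y Z).inv)
  leftUnitor_hom_mem X := inferInstanceAs (Deterministic (λ_ X).hom)
  leftUnitor_inv_mem X := inferInstanceAs (Deterministic (λ_ X).inv)
  rightUnitor_hom_mem X := inferInstanceAs (Deterministic (ρ_ X).hom)
  rightUnitor_inv_mem X := inferInstanceAs (Deterministic (ρ_ X).inv)
  braiding_hom_mem X Y := inferInstanceAs (Deterministic (β_ X Y).hom)
  braiding_inv_mem X Y := inferInstanceAs (Deterministic (β_ X Y).inv)

namespace deterministic

variable {X Y Z : WideSubcategory (deterministic C)}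

instance (f : X ⟶ Y) : Deterministic f.hom := f.property

/-- The discarding of an object, as a deterministic morphism. -/
def discard (X : WideSubcategory (deterministic C)) :
    X ⟶ 𝟙_ (WideSubcategory (deterministic C)) :=
  ⟨ε[X.obj], inferInstanceAs (Deterministic ε[X.obj])⟩

/-- The pairing of two deterministic morphisms, which copies the argument. -/
def pair (f : X ⟶ Y) (g : X ⟶ Z) : X ⟶ Y ⊗ Z :=
  ⟨Δ[X.obj] ≫ (f.hom ⊗ₘ g.hom), inferInstanceAs (Deterministic (Δ[X.obj] ≫ (f.hom ⊗ₘ g.hom)))⟩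

theorem pair_discard_right (f : X ⟶ Y) (g : X ⟶ Z) :
    pair f g ≫ Y ◁ discard Z ≫ (ρ_ Y).hom = f := by
  ext
  change (Δ[X.obj] ≫ (f.hom ⊗ₘ g.hom)) ≫ Y.obj ◁ ε[Z.obj] ≫ (ρ_ Y.obj).hom = f.hom
  rw [← id_tensorHom, Category.assoc, tensorHom_comp_tensorHom_assoc, IsComonHom.hom_counit,
    ← Category.assoc, comul_counit_hom]
  simp

theorem pair_discard_left (f : X ⟶ Y) (g : X ⟶ Z) :
    pair f g ≫ discard Y ▷ Z ≫ (λ_ Z).hom = g := by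
  ext
  change (Δ[X.obj] ≫ (f.hom ⊗ₘ g.hom)) ≫ ε[Y.obj] ▷ Z.obj ≫ (λ_ Z.obj).hom = g.hom
  rw [← tensorHom_id, Category.assoc, tensorHom_comp_tensorHom_assoc, IsComonHom.hom_counit,
    ← Category.assoc, counit_comul_hom]
  simp

theorem eq_pair (f : X ⟶ Y ⊗ Z) :
    f = pair (f ≫ Y ◁ discard Z ≫ (ρ_ Y).hom) (f ≫ discard Y ▷ Z ≫ (λ_ Z).hom) := by
  ext
  change f.hom = Δ[X.obj] ≫ (f.hom ≫ Y.obj ◁ ε[Z.obj] ≫ (ρ_ Y.obj).hom ⊗ₘ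
    f.hom ≫ ε[Y.obj] ▷ Z.obj ≫ (λ_ Z.obj).hom)
  rw [← tensorHom_comp_tensorHom]
  exact ((Category.assoc _ _ _).symm.trans (((IsComonHom.hom_comul f.hom).symm =≫ _).trans
    ((Category.assoc _ _ _).trans ((f.hom ≫= copy_tensor_projections _ _).trans
      (Category.comp_id _))))).symm

instance : CartesianMonoidalCategory (WideSubcategory (deterministic C)) where
  isTerminalTensorUnit := .ofUniqueHom discard fun X f => by
    ext
    exact (Category.comp_id _).symm.trans
      ((f.hom ≫= discard_unit.symm).trans (IsComonHom.hom_counit f.hom))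
  fst X Y := X ◁ discard Y ≫ (ρ_ X).hom
  snd X Y := discard X ▷ Y ≫ (λ_ Y).hom
  tensorProductIsBinaryProduct X Y := Limits.BinaryFan.IsLimit.mk _ pair
    pair_discard_right pair_discard_left
    fun f g m hf hg => (eq_pair m).trans (congrArg₂ pair hf hg)

end deterministic

end Deterministic

section SemilatticeObj

open CartesianMonoidalCategory MonObj

variable {C : Type u} [Category.{v} C] [CartesianMonoidalCategory C] [BraidedCategory C]

/-- Semilattices in a cartesian category: the idempotent commutative monoids. -/
class IsSemilatticeObj (A : C) [MonObj A] : Prop extends IsCommMonObj A where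
  lift_id_mul : lift (𝟙 A) (𝟙 A) ≫ μ[A] = 𝟙 A

variable {A X Y : C} [MonObj A] [IsSemilatticeObj A]

open scoped MonObj

theorem hom_mul_self (f : X ⟶ A) : f * f = f := by
  rw [Hom.mul_def, ← Category.comp_id f, ← comp_lift, Category.assoc,
    IsSemilatticeObj.lift_id_mul]

/-- The morphisms to a semilattice, with the multiplication as the join. -/
abbrev homSemilatticeSup (X A : C) [MonObj A] [IsSemilatticeObj A] : SemilatticeSup (X ⟶ A) :=
  letI : Max (X ⟶ A) := ⟨(· * ·)⟩
  SemilatticeSup.mk' mul_comm mul_assoc hom_mul_self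

attribute [local instance] homSemilatticeSup

/-- The neutral element as the least morphism to a semilattice object. -/
abbrev homOrderBot (X A : C) [MonObj A] [IsSemilatticeObj A] : OrderBot (X ⟶ A) where
  bot := 1
  bot_le f := one_mul f

attribute [local instance] homOrderBot

theorem comp_finset_sup (f : X ⟶ Y) {I : Type*} (s : Finset I) (g : I → (Y ⟶ A)) :
    f ≫ s.sup g = s.sup fun i => f ≫ g i := by
  classical
  induction s using Finset.induction_on with
  | empty => exact comp_one f
  | insert i s _ ih => rw [Finset.sup_insert, Finset.sup_insert, ← ih]; exact comp_mul f _ _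

end SemilatticeObj

section Relations

/-- The disjoint union of two relations between finite ordinals. -/
def relSum {a b c d : ℕ} (r : Fin a → Fin b → Prop) (s : Fin c → Fin d → Prop) :
    Fin (a + c) → Fin (b + d) → Prop :=
  fun x y => Sum.LiftRel r s (finSumFinEquiv.symm x) (finSumFinEquiv.symm y)

/-- The relation that keeps every point and relates the points that satisfy `p` to a new last
point. -/
def dupRel {a : ℕ} (p : Fin a → Prop) (i : Fin a) (j : Fin (a + 1)) : Prop :=
  Fin.lastCases (motive := fun _ => Prop) (p i) (fun j => i = j) j

/-- The relation that exchanges the last two points. -/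
def swapRel (a : ℕ) : Fin (a + 2) → Fin (a + 2) → Prop :=
  relSum (fun i j : Fin a => i = j) fun (x : Fin (1 + 1)) y => finAddFlip x = y

variable {a b c d : ℕ}

theorem dupRel_last (p : Fin a → Prop) (i : Fin a) : dupRel p i (Fin.last a) ↔ p i := by
  simp [dupRel]

theorem dupRel_castSucc (p : Fin a → Prop) (i j : Fin a) : dupRel p i j.castSucc ↔ i = j := by
  simp [dupRel]

theorem relSum_inl_iff (r : Fin a → Fin b → Prop) (s : Fin c → Fin d → Prop) (i : Fin a)
    (y : Fin (b + d)) :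
    relSum r s (finSumFinEquiv (.inl i)) y ↔ ∃ j, r i j ∧ y = finSumFinEquiv (.inl j) := by
  simp only [relSum, Equiv.symm_apply_apply, ← Equiv.symm_apply_eq]
  rcases finSumFinEquiv.symm y with j | j <;> simp

theorem relSum_inr_iff (r : Fin a → Fin b → Prop) (s : Fin c → Fin d → Prop) (i : Fin c)
    (y : Fin (b + d)) :
    relSum r s (finSumFinEquiv (.inr i)) y ↔ ∃ j, s i j ∧ y = finSumFinEquiv (.inr j) := by
  simp only [relSum, Equiv.symm_apply_apply, ← Equiv.symm_apply_eq]
  rcases finSumFinEquiv.symm y with j | j <;> simp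

theorem relSum_id_castSucc_iff (r : Fin a → Fin b → Prop) (i : Fin a) (j : Fin (b + 1)) :
    relSum r (fun x y : Fin 1 => x = y) i.castSucc j ↔ ∃ k, r i k ∧ j = k.castSucc :=
  relSum_inl_iff r _ i j

theorem relSum_id_last_iff (r : Fin a → Fin b → Prop) (j : Fin (b + 1)) :
    relSum r (fun x y : Fin 1 => x = y) (Fin.last a) j ↔ j = Fin.last b :=
  (relSum_inr_iff r _ 0 j).trans exists_eq_left'

theorem id_relSum_castSucc_castSucc (s : Fin 2 → Fin 2 → Prop) (i : Fin a) (j : Fin (a + 2)) :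
    relSum (fun i j : Fin a => i = j) s i.castSucc.castSucc j ↔ j = i.castSucc.castSucc :=
  (relSum_inl_iff _ s i j).trans exists_eq_left'

theorem id_relSum_castSucc_last (s : Fin 2 → Fin 2 → Prop) (j : Fin (a + 2)) :
    relSum (fun i j : Fin a => i = j) s (Fin.last a).castSucc j ↔
      s 0 0 ∧ j = (Fin.last a).castSucc ∨ s 0 1 ∧ j = Fin.last (a + 1) :=
  (relSum_inr_iff _ s 0 j).trans Fin.exists_fin_two

theorem id_relSum_last (s : Fin 2 → Fin 2 → Prop) (j : Fin (a + 2)) :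
    relSum (fun i j : Fin a => i = j) s (Fin.last (a + 1)) j ↔
      s 1 0 ∧ j = (Fin.last a).castSucc ∨ s 1 1 ∧ j = Fin.last (a + 1) :=
  (relSum_inr_iff _ s 1 j).trans Fin.exists_fin_two

theorem swapRel_castSucc_castSucc (i : Fin a) (j : Fin (a + 2)) :
    swapRel a i.castSucc.castSucc j ↔ j = i.castSucc.castSucc :=
  id_relSum_castSucc_castSucc _ i j

theorem swapRel_castSucc_last (j : Fin (a + 2)) :
    swapRel a (Fin.last a).castSucc j ↔ j = Fin.last (a + 1) :=
  (relSum_inr_iff _ _ 0 j).trans exists_eq_left'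

theorem swapRel_last (j : Fin (a + 2)) :
    swapRel a (Fin.last (a + 1)) j ↔ j = (Fin.last a).castSucc :=
  (relSum_inr_iff _ _ 1 j).trans exists_eq_left'

theorem dupRel_succ (p : Fin (a + 1) → Prop) : dupRel p =
    Relation.Comp (relSum (dupRel fun i => p i.castSucc) fun x y : Fin 1 => x = y)
      (relSum (a := a) (b := a) (c := 2) (d := 2) (fun i j => i = j) fun x y =>
        finAddFlip (m := 1) x = y ∨ x = 1 ∧ p (Fin.last a)) := by
  have flip_zero : finAddFlip (0 : Fin (1 + 1)) = 1 := rfl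
  have flip_one : finAddFlip (1 : Fin (1 + 1)) = 0 := rfl
  ext i j
  cases i using Fin.lastCases <;> cases j using Fin.lastCases <;>
    simp [Relation.Comp, Fin.exists_fin_succ', relSum_id_castSucc_iff, relSum_id_last_iff,
      id_relSum_castSucc_castSucc, id_relSum_castSucc_last, id_relSum_last, dupRel_last,
      dupRel_castSucc, Fin.castSucc_ne_last, flip_zero, flip_one, eq_comm]

theorem eq_dupRel_comp (r : Fin a → Fin (b + 1) → Prop) : r =
    Relation.Comp (dupRel fun i => r i (Fin.last b))
      (relSum (fun i j => r i (Fin.castSucc j)) fun x y : Fin 1 => x = y) := by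
  ext i j
  cases j using Fin.lastCases <;>
    simp [Relation.Comp, Fin.exists_fin_succ', dupRel_last, dupRel_castSucc,
      relSum_id_castSucc_iff, relSum_id_last_iff, (Fin.castSucc_ne_last _).symm]

end Relations

section Bialgebra

open CartesianMonoidalCategory

namespace GenAlg

variable {P : PROP.{w}} (M : GenAlg degCommBialg P)

/-- The comonoid structure on the object `1` of an algebra. -/
abbrev comonOne : ComonObj (⟨1⟩ : P.Obj) where
  counit := M.op .eps
  comul := M.op .delta
  counit_comul := M.eqn .counit_left
  comul_counit := M.eqn .counit_right
  comul_assoc := (M.eqn .comul_assoc).symm.trans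
    (congrArg (P.comp (M.op .delta)) (P.comp_id (P.tensor (M.op .delta) (P.id 1))).symm)

theorem isCommComonObj_comonOne : @IsCommComonObj P.Obj _ _ _ ⟨1⟩ M.comonOne :=
  letI := M.comonOne
  ⟨M.eqn .comul_comm⟩

/-- The comonoid structure on the object `n`, the `n`-fold tensor power of the one on `1`. -/
abbrev comon : ∀ n : ℕ, ComonObj (⟨n⟩ : P.Obj)
  | 0 => ComonObj.instTensorUnit P.Obj
  | n + 1 =>
    letI := comon n
    letI := M.comonOne
    (inferInstance : ComonObj ((⟨n⟩ : P.Obj) ⊗ ⟨1⟩))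

theorem isCommComonObj_comon : ∀ n : ℕ, @IsCommComonObj P.Obj _ _ _ ⟨n⟩ (M.comon n)
  | 0 => CommComon.instCommComonObjUnit
  | n + 1 =>
    letI := M.comon n
    letI := M.comonOne
    have := isCommComonObj_comon n
    have := M.isCommComonObj_comonOne
    instIsCommComonObjTensorObj _ _

theorem comon_one : M.comon 1 = M.comonOne :=
  letI := M.comonOne
  comonObj_eq_of_isComonHom_id _ _ (isComonHom_leftUnitor_hom (X := (⟨1⟩ : P.Obj)))

theorem comon_add (a b : ℕ) : M.comon (a + b) =
    (letI := M.comon a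
    letI := M.comon b
    (inferInstance : ComonObj ((⟨a⟩ : P.Obj) ⊗ ⟨b⟩))) := by
  induction b with
  | zero =>
    let _ := M.comon a
    exact (comonObj_eq_of_isComonHom_id _ _
      (isComonHom_rightUnitor_hom (X := (⟨a⟩ : P.Obj)))).symm
  | succ b ih =>
    have h : M.comon (a + (b + 1)) =
        (letI := M.comon (a + b)
        letI := M.comonOne
        (inferInstance : ComonObj ((⟨a + b⟩ : P.Obj) ⊗ ⟨1⟩))) := rfl
    rw [h, ih]
    let _ := M.comon a
    let _ := M.comon b
    let _ := M.comonOne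
    exact comonObj_eq_of_isComonHom_id _ _
      (isComonHom_associator_hom (X := (⟨a⟩ : P.Obj)) (Y := ⟨b⟩) (Z := ⟨1⟩))

/-- The objects of a PROP, as a type that depends on an algebra in order to carry the copying and
discarding that the algebra defines. -/
def CopyObj (_ : GenAlg degCommBialg P) : Type := P.Obj

instance : Category M.CopyObj := inferInstanceAs (Category P.Obj)

instance : MonoidalCategory M.CopyObj := inferInstanceAs (MonoidalCategory P.Obj)

instance : SymmetricCategory M.CopyObj := inferInstanceAs (SymmetricCategory P.Obj)

instance : CopyDiscardCategory M.CopyObj where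
  comonObj X := M.comon X.n
  isCommComonObj X := M.isCommComonObj_comon X.n
  copy_tensor X Y :=
    letI := M.comon X.n
    letI := M.comon Y.n
    (congrArg (fun s : ComonObj (⟨X.n + Y.n⟩ : P.Obj) => s.comul) (M.comon_add X.n Y.n)).trans
      (Comon.tensorObj_comul (⟨X.n⟩ : P.Obj) ⟨Y.n⟩)
  discard_tensor X Y := congrArg (fun s : ComonObj (⟨X.n + Y.n⟩ : P.Obj) => s.counit)
    (M.comon_add X.n Y.n)
  copy_unit := rfl
  discard_unit := rfl

/-- The object `n`, in the cartesian category of deterministic morphisms. -/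
abbrev det (n : ℕ) : WideSubcategory (deterministic M.CopyObj) := ⟨(⟨n⟩ : P.Obj)⟩

theorem isComonHom_eta : @IsComonHom P.Obj _ _ ⟨0⟩ ⟨1⟩ (M.comon 0) (M.comon 1) (M.op .eta) := by
  rw [comon_one]
  let _ := ComonObj.instTensorUnit P.Obj
  let _ := M.comonOne
  exact IsComonHom.mk (M := 𝟙_ P.Obj) (N := ⟨1⟩) (f := M.op .eta) (M.eqn .unit_counit)
    ((M.eqn .unit_comul).trans (P.id_comp _).symm)

theorem isComonHom_nabla : @IsComonHom P.Obj _ _ ⟨2⟩ ⟨1⟩ (M.comon 2) (M.comon 1) (M.op .nabla) := by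
  rw [show M.comon 2 = _ from M.comon_add 1 1, comon_one]
  let _ := M.comonOne
  have hμ : tensorμ (⟨1⟩ : P.Obj) ⟨1⟩ ⟨1⟩ ⟨1⟩ =
      P.tensor (a := 3) (b := 3) (P.tensor (P.id 1) (P.symm 1 1)) (P.id 1) := by
    change P.comp (P.id 4) (P.comp (P.tensor (P.id 1) (P.id 3)) (P.comp (P.tensor (P.id 1)
      (P.tensor (P.symm 1 1) (P.id 1))) (P.comp (P.tensor (P.id 1) (P.id 3)) (P.id 4)))) = _
    rw [P.tensor_id 1 3]
    refine (P.id_comp _).trans ((P.id_comp _).trans ((congrArg _ (P.id_comp _)).trans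
      ((P.comp_id _).trans ?_)))
    exact (P.tensor_assoc (P.id 1) (P.symm 1 1) (P.id 1)).symm
  refine IsComonHom.mk (M := (⟨1⟩ ⊗ ⟨1⟩ : P.Obj)) (N := ⟨1⟩) (f := M.op .nabla) ?_ ?_
  · exact (M.eqn .mul_counit).trans (P.comp_id _).symm
  · rw [Comon.tensorObj_comul, hμ]
    exact M.eqn .mul_comul

instance : MonObj (M.det 1) where
  one := ⟨M.op .eta, M.isComonHom_eta⟩
  mul := ⟨M.op .nabla, M.isComonHom_nabla⟩
  one_mul := by
    ext
    exact M.eqn .unit_left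
  mul_one := by
    ext
    exact M.eqn .unit_right
  mul_assoc := by
    ext
    exact (M.eqn .mul_assoc).trans (P.id_comp _).symm

theorem discard_one : (M.comon 1).counit = M.op .eps :=
  congrArg (fun s : ComonObj (⟨1⟩ : P.Obj) => s.counit) M.comon_one

theorem copy_one : (M.comon 1).comul = M.op .delta :=
  congrArg (fun s : ComonObj (⟨1⟩ : P.Obj) => s.comul) M.comon_one

theorem lift_id_one : (lift (𝟙 (M.det 1)) (𝟙 (M.det 1))).hom = M.op .delta :=
  (congrArg₂ P.comp M.copy_one (P.tensor_id 1 1)).trans (P.comp_id _)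

instance : IsSemilatticeObj (M.det 1) where
  mul_comm := by
    ext
    exact M.eqn .mul_comm
  lift_id_mul := by
    ext
    exact (congrArg (P.comp · (M.op .nabla)) M.lift_id_one).trans (M.eqn .degenerate)

/-- The projection from a sum to its first summand. -/
abbrev fst (a b : ℕ) : M.det (a + b) ⟶ M.det a := CartesianMonoidalCategory.fst (M.det a) (M.det b)

/-- The projection from a sum to its second summand. -/
abbrev snd (a b : ℕ) : M.det (a + b) ⟶ M.det b := CartesianMonoidalCategory.snd (M.det a) (M.det b)

/-- The projections from `n` to `1`. -/
def proj : ∀ {n : ℕ}, Fin n → (M.det n ⟶ M.det 1)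
  | n + 1, j => Fin.lastCases (M.snd n 1) (fun i => M.fst n 1 ≫ proj i) j

theorem proj_last (n : ℕ) : M.proj (Fin.last n) = M.snd n 1 := by
  simp [proj]

theorem proj_castSucc {n : ℕ} (j : Fin n) : M.proj j.castSucc = M.fst n 1 ≫ M.proj j := by
  simp [proj]

theorem fst_zero (a : ℕ) : M.fst a 0 = 𝟙 (M.det a) := by
  ext
  exact (P.comp_id _).trans (P.tensor_id a 0)

theorem snd_zero_one : M.snd 0 1 = 𝟙 (M.det 1) := by
  ext
  exact (P.comp_id _).trans (P.tensor_id 0 1)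

theorem fst_add_one (a b : ℕ) : M.fst a (b + 1) = M.fst (a + b) 1 ≫ M.fst a b :=
  (Category.id_comp _).symm.trans
    (CartesianMonoidalCategory.associator_hom_fst (M.det a) (M.det b) (M.det 1))

theorem snd_fst (a b : ℕ) : M.snd a (b + 1) ≫ M.fst b 1 = M.fst (a + b) 1 ≫ M.snd a b :=
  (Category.id_comp _).symm.trans
    (CartesianMonoidalCategory.associator_hom_snd_fst (M.det a) (M.det b) (M.det 1))

theorem snd_snd (a b : ℕ) : M.snd a (b + 1) ≫ M.snd b 1 = M.snd (a + b) 1 :=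
  (Category.id_comp _).symm.trans
    (CartesianMonoidalCategory.associator_hom_snd_snd (M.det a) (M.det b) (M.det 1))

theorem proj_castAdd {a b : ℕ} (j : Fin a) :
    M.proj (Fin.castAdd b j) = M.fst a b ≫ M.proj j := by
  induction b with
  | zero => exact (Category.id_comp _).symm.trans (congrArg (· ≫ _) (M.fst_zero a).symm)
  | succ b ih =>
    rw [fst_add_one, Category.assoc, ← ih]
    exact M.proj_castSucc (Fin.castAdd b j)

theorem proj_natAdd {a b : ℕ} (j : Fin b) :
    M.proj (Fin.natAdd a j) = M.snd a b ≫ M.proj j := by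
  induction b with
  | zero => exact j.elim0
  | succ b ih =>
    cases j using Fin.lastCases with
    | last =>
      rw [proj_last, snd_snd]
      exact M.proj_last (a + b)
    | cast j =>
      rw [proj_castSucc, ← Category.assoc, snd_fst, Category.assoc, ← ih]
      exact M.proj_castSucc (Fin.natAdd a j)

end GenAlg

end Bialgebra

section Matrices

open CartesianMonoidalCategory

attribute [local instance] homSemilatticeSup homOrderBot

namespace GenAlg

variable {P : PROP.{w}} (M : GenAlg degCommBialg P) {a b c d : ℕ}
  {X : WideSubcategory (deterministic M.CopyObj)}

/-- The pairing of two deterministic morphisms. -/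
def pair (f : X ⟶ M.det a) (g : X ⟶ M.det b) : X ⟶ M.det (a + b) :=
  lift (T := X) (X := M.det a) (Y := M.det b) f g

theorem pair_fst (f : X ⟶ M.det a) (g : X ⟶ M.det b) : M.pair f g ≫ M.fst a b = f :=
  lift_fst (X := M.det a) (Y := M.det b) f g

theorem pair_snd (f : X ⟶ M.det a) (g : X ⟶ M.det b) : M.pair f g ≫ M.snd a b = g :=
  lift_snd (X := M.det a) (Y := M.det b) f g

theorem hom_ext_add {f g : X ⟶ M.det (a + b)} (fst : f ≫ M.fst a b = g ≫ M.fst a b)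
    (snd : f ≫ M.snd a b = g ≫ M.snd a b) : f = g :=
  CartesianMonoidalCategory.hom_ext (X := M.det a) (Y := M.det b) f g fst snd

theorem hom_ext_proj {f g : X ⟶ M.det b} (h : ∀ j, f ≫ M.proj j = g ≫ M.proj j) : f = g := by
  induction b with
  | zero => exact toUnit_unique (X := X) f g
  | succ b ih =>
    refine M.hom_ext_add (ih fun j => ?_) ?_
    · simpa only [proj_castSucc, Category.assoc] using h j.castSucc
    · simpa only [proj_last] using h (Fin.last b)

/-- The tuple of a family of morphisms to the object `1`. -/
def tuple : ∀ {b : ℕ}, (Fin b → (X ⟶ M.det 1)) → (X ⟶ M.det b)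
  | 0, _ => toUnit X
  | b + 1, f => M.pair (tuple fun j => f j.castSucc) (f (Fin.last b))

theorem tuple_proj (f : Fin b → (X ⟶ M.det 1)) (j : Fin b) : M.tuple f ≫ M.proj j = f j := by
  induction b with
  | zero => exact j.elim0
  | succ b ih =>
    cases j using Fin.lastCases with
    | last => rw [proj_last, tuple, pair_snd]
    | cast j => rw [proj_castSucc, ← Category.assoc, tuple, pair_fst, ih]

open Classical in
/-- The join of the projections to the elements of a set. -/
noncomputable def col (p : Fin a → Prop) : M.det a ⟶ M.det 1 :=
  (Finset.univ.filter p).sup M.proj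

theorem comp_col_le_iff {p : Fin a → Prop} {f : X ⟶ M.det a} {g : X ⟶ M.det 1} :
    f ≫ M.col p ≤ g ↔ ∀ i, p i → f ≫ M.proj i ≤ g := by
  simp [col, comp_finset_sup]

theorem col_le_iff {p : Fin a → Prop} {g : M.det a ⟶ M.det 1} :
    M.col p ≤ g ↔ ∀ i, p i → M.proj i ≤ g := by
  simp [col]

/-- The morphism whose matrix has as entries the truth values of a relation. -/
noncomputable def mat (r : Fin a → Fin b → Prop) : M.det a ⟶ M.det b :=
  M.tuple fun j => M.col fun i => r i j

theorem mat_proj (r : Fin a → Fin b → Prop) (j : Fin b) :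
    M.mat r ≫ M.proj j = M.col fun i => r i j :=
  M.tuple_proj _ j

variable {M} in
theorem eq_mat {f : M.det a ⟶ M.det b} {r : Fin a → Fin b → Prop}
    (h : ∀ j g, f ≫ M.proj j ≤ g ↔ ∀ i, r i j → M.proj i ≤ g) : f = M.mat r :=
  M.hom_ext_proj fun j => (M.mat_proj r j).symm ▸
    eq_of_forall_ge_iff fun g => (h j g).trans M.col_le_iff.symm

theorem mat_comp_col (r : Fin a → Fin b → Prop) (p : Fin b → Prop) :
    M.mat r ≫ M.col p = M.col fun i => ∃ j, r i j ∧ p j := by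
  refine eq_of_forall_ge_iff fun g => ?_
  simp only [comp_col_le_iff, mat_proj, col_le_iff]
  grind

theorem fst_comp_col {p : Fin a → Prop} {q : Fin (a + 1) → Prop} (last : ¬ q (Fin.last a))
    (castSucc : ∀ i, q i.castSucc ↔ p i) : M.fst a 1 ≫ M.col p = M.col q := by
  refine eq_of_forall_ge_iff fun g => ?_
  rw [comp_col_le_iff, col_le_iff, Fin.forall_fin_succ']
  simp [last, castSucc, proj_castSucc]

theorem mat_comp (r : Fin a → Fin b → Prop) (s : Fin b → Fin c → Prop) :
    M.mat (Relation.Comp r s) = M.mat r ≫ M.mat s :=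
  M.hom_ext_proj fun j => by
    rw [Category.assoc, mat_proj, mat_proj, mat_comp_col]
    rfl

theorem mat_id (a : ℕ) : M.mat (fun i j : Fin a => i = j) = 𝟙 (M.det a) :=
  (eq_mat fun j g => by simp).symm

/-- The tensor product of deterministic morphisms. -/
def prod (f : M.det a ⟶ M.det b) (g : M.det c ⟶ M.det d) : M.det (a + c) ⟶ M.det (b + d) :=
  f ⊗ₘ g

theorem prod_fst (f : M.det a ⟶ M.det b) (g : M.det c ⟶ M.det d) :
    M.prod f g ≫ M.fst b d = M.fst a c ≫ f :=
  tensorHom_fst f g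

theorem prod_snd (f : M.det a ⟶ M.det b) (g : M.det c ⟶ M.det d) :
    M.prod f g ≫ M.snd b d = M.snd a c ≫ g :=
  tensorHom_snd f g

theorem mat_relSum (r : Fin a → Fin b → Prop) (s : Fin c → Fin d → Prop) :
    M.mat (relSum r s) = M.prod (M.mat r) (M.mat s) := by
  refine (eq_mat fun k g => ?_).symm
  cases k using Fin.addCases with
  | left j =>
    rw [proj_castAdd, ← Category.assoc, prod_fst, Category.assoc, mat_proj, comp_col_le_iff]
    simp [Fin.forall_fin_add, relSum, ← proj_castAdd]
  | right j =>
    rw [proj_natAdd, ← Category.assoc, prod_snd, Category.assoc, mat_proj, comp_col_le_iff]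
    simp [Fin.forall_fin_add, relSum, ← proj_natAdd]

/-- The symmetry, as a deterministic morphism. -/
def swap (a b : ℕ) : M.det (a + b) ⟶ M.det (b + a) := (β_ (M.det a) (M.det b)).hom

theorem swap_fst (a b : ℕ) : M.swap a b ≫ M.fst b a = M.snd a b :=
  CartesianMonoidalCategory.braiding_hom_fst (M.det a) (M.det b)

theorem swap_snd (a b : ℕ) : M.swap a b ≫ M.snd b a = M.fst a b :=
  CartesianMonoidalCategory.braiding_hom_snd (M.det a) (M.det b)

theorem swap_proj (k : Fin (b + a)) : M.swap a b ≫ M.proj k = M.proj (finAddFlip k) := by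
  cases k using Fin.addCases with
  | left j =>
    rw [proj_castAdd, finAddFlip_apply_castAdd, proj_natAdd, ← Category.assoc, swap_fst]
  | right j =>
    rw [proj_natAdd, finAddFlip_apply_natAdd, proj_castAdd, ← Category.assoc, swap_snd]

theorem mat_finAddFlip (a b : ℕ) :
    M.mat (fun (x : Fin (a + b)) y => finAddFlip x = y) = M.swap a b := by
  refine (eq_mat fun k g => ?_).symm
  have h (x : Fin (a + b)) : finAddFlip x = k ↔ x = finAddFlip k := by
    rw [← Equiv.eq_symm_apply]
    rfl
  simp [swap_proj, h]

theorem mat_dupRel (p : Fin a → Prop) : M.mat (dupRel p) = M.pair (𝟙 _) (M.col p) := by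
  refine (eq_mat fun k g => ?_).symm
  cases k using Fin.lastCases with
  | last => simp [proj_last, pair_snd, col_le_iff, dupRel_last]
  | cast j => simp [proj_castSucc, ← Category.assoc, pair_fst, dupRel_castSucc]

theorem proj_zero_one : M.proj (0 : Fin 1) = 𝟙 (M.det 1) :=
  (M.proj_last 0).trans M.snd_zero_one

theorem bot_hom : (⊥ : M.det 0 ⟶ M.det 1).hom = M.op .eta :=
  congrArg InducedWideCategory.Hom.hom
    ((toUnit_unique (X := M.det 0) (toUnit (M.det 0)) (𝟙 (M.det 0)) =≫ _).trans
      (Category.id_comp (Y := M.det 1) _))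

theorem fst_sup_snd_hom : (M.fst 1 1 ⊔ M.snd 1 1).hom = M.op .nabla :=
  congrArg InducedWideCategory.Hom.hom
    ((lift_fst_snd (X := M.det 1) (Y := M.det 1) =≫ _).trans (Category.id_comp _))

theorem mat_eta : (M.mat fun (_ : Fin 0) (_ : Fin 1) => True).hom = M.op .eta := by
  rw [← bot_hom]
  refine congrArg InducedWideCategory.Hom.hom (eq_mat fun k g => ?_).symm
  rw [Subsingleton.elim k 0, proj_zero_one, Category.comp_id]
  simp

theorem mat_eps : (M.mat fun (_ : Fin 1) (_ : Fin 0) => True).hom = M.op .eps :=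
  M.discard_one

theorem mat_nabla : (M.mat fun (_ : Fin 2) (_ : Fin 1) => True).hom = M.op .nabla := by
  rw [← fst_sup_snd_hom]
  refine congrArg InducedWideCategory.Hom.hom (eq_mat fun k g => ?_).symm
  have h₁ : M.proj (0 : Fin 2) = M.fst 1 1 :=
    (M.proj_castAdd (0 : Fin 1)).trans (by rw [proj_zero_one, Category.comp_id])
  have h₂ : M.proj (1 : Fin 2) = M.snd 1 1 := M.proj_last 1
  rw [Subsingleton.elim k 0, proj_zero_one, Category.comp_id]
  simp [h₁, h₂]

theorem mat_delta : (M.mat fun (_ : Fin 1) (_ : Fin 2) => True).hom = M.op .delta := by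
  have h : M.pair (𝟙 (M.det 1)) (𝟙 (M.det 1)) = M.mat fun _ _ => True := eq_mat fun k g => by
    cases k using Fin.addCases (m := 1) (n := 1) with
    | left j =>
      rw [proj_castAdd, ← Category.assoc, pair_fst]
      simp [Subsingleton.elim j 0]
    | right j =>
      rw [proj_natAdd, ← Category.assoc, pair_snd]
      simp [Subsingleton.elim j 0]
  exact (congrArg InducedWideCategory.Hom.hom h.symm).trans M.lift_id_one

end GenAlg

end Matrices

section Steps

open CopyDiscardCategory

namespace GenAlg

variable {P : PROP.{w}} (M : GenAlg degCommBialg P) (l : P.Hom 1 1) {a b c d : ℕ}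

/-- The interpretation of a relation in a PROP, as the morphism with the matrix of the relation. -/
noncomputable def relHom (r : Fin a → Fin b → Prop) : P.Hom a b := (M.mat r).hom

theorem relHom_comp (r : Fin a → Fin b → Prop) (s : Fin b → Fin c → Prop) :
    M.relHom (Relation.Comp r s) = P.comp (M.relHom r) (M.relHom s) :=
  congrArg InducedWideCategory.Hom.hom (M.mat_comp r s)

theorem relHom_id (a : ℕ) : M.relHom (fun i j : Fin a => i = j) = P.id a :=
  congrArg InducedWideCategory.Hom.hom (M.mat_id a)

theorem relHom_relSum (r : Fin a → Fin b → Prop) (s : Fin c → Fin d → Prop) :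
    M.relHom (relSum r s) = P.tensor (M.relHom r) (M.relHom s) :=
  congrArg InducedWideCategory.Hom.hom (M.mat_relSum r s)

theorem relHom_finAddFlip (a b : ℕ) :
    M.relHom (fun (x : Fin (a + b)) y => finAddFlip x = y) = P.symm a b :=
  congrArg InducedWideCategory.Hom.hom (M.mat_finAddFlip a b)

/-- The morphism that keeps all inputs and appends as a new output the value of `l` on the join of
the inputs that satisfy `p`: the interpretation of a node in which these inputs end. -/
noncomputable def step (p : Fin a → Prop) : P.Hom a (a + 1) :=
  graphHom (C := M.CopyObj) (X := ⟨a⟩) (T := ⟨1⟩) (P.comp (M.col p).hom l)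

theorem step_eq (p : Fin a → Prop) :
    M.step l p = P.comp (M.relHom (dupRel p)) (P.tensor (P.id a) l) := by
  have hp : M.relHom (dupRel p) =
      graphHom (C := M.CopyObj) (X := ⟨a⟩) (T := ⟨1⟩) (M.col p).hom :=
    congrArg InducedWideCategory.Hom.hom (M.mat_dupRel p)
  rw [hp]
  exact graphHom_comp (C := M.CopyObj) (Y := ⟨1⟩) (T := ⟨1⟩) (M.col p).hom l

theorem relHom_comp_step (r : Fin a → Fin b → Prop) (p : Fin b → Prop) :
    P.comp (M.relHom r) (M.step l p) = P.comp (M.step l fun i => ∃ j, r i j ∧ p j)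
      (M.relHom (relSum r fun x y : Fin 1 => x = y)) := by
  have : Deterministic (M.mat r).hom := (M.mat r).property
  rw [relHom_relSum, relHom_id, step, step, ← mat_comp_col]
  exact (comp_graphHom (C := M.CopyObj) (T := ⟨1⟩) (M.mat r).hom (P.comp (M.col p).hom l)).trans
    (congrArg (fun k => P.comp (graphHom (C := M.CopyObj) (X := ⟨a⟩) (T := ⟨1⟩) k) _)
      (P.assoc _ _ _).symm)

theorem relHom_swapRel (a : ℕ) : M.relHom (swapRel a) =
    tensorRightComm (C := M.CopyObj) ⟨a⟩ ⟨1⟩ ⟨1⟩ := by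
  rw [swapRel, relHom_relSum, relHom_id, relHom_finAddFlip]
  exact ((P.id_comp _).trans (P.comp_id _)).symm

theorem step_exchange {p q : Fin a → Prop} {p' q' : Fin (a + 1) → Prop}
    (p_last : ¬ p' (Fin.last a)) (p_castSucc : ∀ i, p' i.castSucc ↔ p i)
    (q_last : ¬ q' (Fin.last a)) (q_castSucc : ∀ i, q' i.castSucc ↔ q i) :
    P.comp (M.step l p) (P.comp (M.step l q') (M.relHom (swapRel a))) =
      P.comp (M.step l q) (M.step l p') := by
  have graph_step {p : Fin a → Prop} {p' : Fin (a + 1) → Prop} (p_last : ¬ p' (Fin.last a))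
      (p_castSucc : ∀ i, p' i.castSucc ↔ p i) : M.step l p' =
        graphHom (C := M.CopyObj) (X := ⟨a + 1⟩) (T := ⟨1⟩)
          (P.comp (M.fst a 1).hom (P.comp (M.col p).hom l)) := by
    rw [step, ← M.fst_comp_col p_last p_castSucc]
    exact congrArg (graphHom (C := M.CopyObj) (X := ⟨a + 1⟩) (T := ⟨1⟩)) (P.assoc _ _ _)
  rw [graph_step p_last p_castSucc, graph_step q_last q_castSucc, relHom_swapRel]
  exact graphHom_exchange (C := M.CopyObj) (X := ⟨a⟩) (T := ⟨1⟩) (U := ⟨1⟩)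
    (P.comp (M.col p).hom l) (P.comp (M.col q).hom l)

end GenAlg

end Steps

section Peeling

namespace IDag

variable {a a' b c : ℕ} {D D' : IDag (Fin a) (Fin b)} {x y : D.N}
  {E E' : IDag (Fin (a + 1)) (Fin b)} {e : E.N → D.N} {e' : E'.N → D.N}

/-- The idag `E`, with internal nodes embedded into those of `D` by `e`, is obtained from `D` by
turning an internal node `x` without internal predecessors into a last input. The edges into `x`
are forgotten. -/
structure Peel (D : IDag (Fin a) (Fin b)) (x : D.N) (E : IDag (Fin (a + 1)) (Fin b))
    (e : E.N → D.N) : Prop where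
  injective : Function.Injective e
  ne : ∀ z, e z ≠ x
  exists_eq : ∀ y, y ≠ x → ∃ z, e z = y
  minimal : ∀ y, ¬ D.R (.inr y) (.inr x)
  input : ∀ i v, E.R (.inl (Fin.castSucc i)) v ↔ D.R (.inl i) (Sum.map id e v)
  last : ∀ v, E.R (.inl (Fin.last a)) v ↔ D.R (.inr x) (Sum.map id e v)
  inner : ∀ z v, E.R (.inr z) v ↔ D.R (.inr (e z)) (Sum.map id e v)

theorem Peel.card_lt (h : D.Peel x E e) : Nat.card E.N < Nat.card D.N := by
  have := D.finite
  have := E.finite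
  have := Fintype.ofFinite D.N
  have := Fintype.ofFinite E.N
  rw [Nat.card_eq_fintype_card, Nat.card_eq_fintype_card]
  exact Fintype.card_lt_of_injective_of_notMem e h.injective (b := x) fun ⟨z, hz⟩ => h.ne z hz

theorem exists_peel (hx : ∀ y, ¬ D.R (.inr y) (.inr x)) : ∃ E e, D.Peel x E e := by
  have := D.finite
  let source : Fin (a + 1) ⊕ {y // y ≠ x} → Fin a ⊕ D.N :=
    Sum.elim (Fin.snoc (α := fun _ => Fin a ⊕ D.N) Sum.inl (.inr x)) fun z => .inr z.1
  refine ⟨⟨{y // y ≠ x}, inferInstance, fun u v => D.R (source u) (Sum.map id Subtype.val v),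
    fun n hn => D.acyclic n.1 (hn.lift Subtype.val fun _ _ h => h)⟩, Subtype.val,
    Subtype.val_injective, fun z => z.2, fun y hy => ⟨⟨y, hy⟩, rfl⟩, hx, ?_, ?_, ?_⟩
  all_goals simp [source]

theorem exists_minimal (D : IDag (Fin a) (Fin b)) [Nonempty D.N] :
    ∃ x : D.N, ∀ y, ¬ D.R (.inr y) (.inr x) := by
  have := D.finite
  let r := Relation.TransGen fun x y : D.N => D.R (.inr x) (.inr y)
  have : IsTrans D.N r := ⟨fun _ _ _ => Relation.TransGen.trans⟩
  have : Std.Irrefl r := ⟨D.acyclic⟩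
  obtain ⟨x, -, hx⟩ := (Finite.wellFounded_of_trans_of_irrefl r).has_min Set.univ
    Set.univ_nonempty
  exact ⟨x, fun y hy => hx y trivial (.single hy)⟩

theorem peel_induction {motive : ∀ {a : ℕ}, IDag (Fin a) (Fin b) → Prop}
    (base : ∀ {a : ℕ} (D : IDag (Fin a) (Fin b)), IsEmpty D.N → motive D)
    (peel : ∀ {a : ℕ} {D : IDag (Fin a) (Fin b)} {x : D.N} {E : IDag (Fin (a + 1)) (Fin b)}
      {e : E.N → D.N}, D.Peel x E e → motive E → motive D)
    (D : IDag (Fin a) (Fin b)) : motive D := by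
  induction hn : Nat.card D.N using Nat.strong_induction_on generalizing a with
  | _ n ih =>
    subst hn
    rcases isEmpty_or_nonempty D.N with h | h
    · exact base D h
    · obtain ⟨x, hx⟩ := D.exists_minimal
      obtain ⟨E, e, h⟩ := exists_peel hx
      exact peel h (ih _ h.card_lt E rfl)

/-- The composite of a relation and an idag. It is isomorphic to the concatenation `(ofRel r).concat
D`, but has the same internal nodes as `D`. -/
def pre (r : Fin a' → Fin a → Prop) (D : IDag (Fin a) (Fin b)) : IDag (Fin a') (Fin b) where
  N := D.N
  finite := D.finite
  R
    | .inl i, v => ∃ j, r i j ∧ D.R (.inl j) v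
    | .inr z, v => D.R (.inr z) v
  acyclic := D.acyclic

namespace Peel

theorem pre (h : D.Peel x E e) (r : Fin a' → Fin a → Prop) :
    (D.pre r).Peel x (E.pre (relSum r fun x y : Fin 1 => x = y)) e where
  injective := h.injective
  ne := h.ne
  exists_eq := h.exists_eq
  minimal := h.minimal
  input i v := by
    simp only [IDag.pre, relSum_id_castSucc_iff]
    constructor
    · rintro ⟨_, ⟨k, hk, rfl⟩, hv⟩
      exact ⟨k, hk, (h.input k v).1 hv⟩
    · rintro ⟨k, hk, hv⟩
      exact ⟨_, ⟨k, hk, rfl⟩, (h.input k v).2 hv⟩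
  last v := by
    simp only [IDag.pre, relSum_id_last_iff, exists_eq_left]
    exact h.last v
  inner := h.inner

theorem iso (h : D.Peel x E e) {σ : D.N ≃ D'.N}
    (hσ : ∀ u v, D.R u v ↔ D'.R (Sum.map id σ u) (Sum.map id σ v)) :
    D'.Peel (σ x) E (σ ∘ e) where
  injective := σ.injective.comp h.injective
  ne z hz := h.ne z (σ.injective hz)
  exists_eq y hy := by
    obtain ⟨z, hz⟩ := h.exists_eq (σ.symm y) fun hx => hy (by simp [← hx])
    exact ⟨z, by simp [hz]⟩
  minimal y hy := h.minimal (σ.symm y) ((hσ _ _).2 (by simpa using hy))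
  input i v := by
    rw [h.input, hσ, Sum.map_map]
    rfl
  last v := by
    rw [h.last, hσ, Sum.map_map]
    rfl
  inner z v := by
    rw [h.inner, hσ, Sum.map_map]
    rfl

theorem concat (h : D.Peel x E e) (F : IDag (Fin b) (Fin c)) :
    (D.concat F).Peel (.inl x) (E.concat F) (Sum.map e id) where
  injective := h.injective.sumMap Function.injective_id
  ne := by
    rintro (z | z) hz
    · exact h.ne z (Sum.inl_injective hz)
    · cases hz
  exists_eq := by
    rintro (y | y) hy
    · obtain ⟨z, hz⟩ := h.exists_eq y fun hx => hy (congrArg Sum.inl hx)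
      exact ⟨.inl z, congrArg Sum.inl hz⟩
    · exact ⟨.inr y, rfl⟩
  minimal := by
    rintro (y | y)
    · exact h.minimal y
    · exact id
  input i v := by
    rcases v with v | v | v <;> simp [IDag.concat, concatRel, h.input]
  last v := by
    rcases v with v | v | v <;> simp [IDag.concat, concatRel, h.last]
  inner z v := by
    rcases z with z | z <;> rcases v with v | v | v <;> simp [IDag.concat, concatRel, h.inner]

theorem iso_of_peel (h : D.Peel x E e) (h' : D.Peel x E' e') : E.Iso E' := by
  choose f hf using fun z => h'.exists_eq (e z) (h.ne z)
  have f_bijective : Function.Bijective f := by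
    refine ⟨fun s t hst => h.injective (by rw [← hf, ← hf, hst]), fun t => ?_⟩
    obtain ⟨z, hz⟩ := h.exists_eq (e' t) (h'.ne t)
    exact ⟨z, h'.injective ((hf z).trans hz)⟩
  have map_e (v : Fin b ⊕ E.N) : Sum.map id e v = Sum.map id e' (Sum.map id f v) := by
    rcases v with v | v <;> simp [hf]
  refine ⟨Equiv.ofBijective f f_bijective, fun u v => ?_⟩
  change _ ↔ E'.R (Sum.map id f u) (Sum.map id f v)
  rcases u with u | u
  · cases u using Fin.lastCases with
    | last => exact (h.last v).trans (by rw [map_e, ← h'.last]; rfl)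
    | cast i => exact (h.input i v).trans (by rw [map_e, ← h'.input]; rfl)
  · exact (h.inner u v).trans (by rw [map_e, ← hf, ← h'.inner]; rfl)

theorem exchange (h : D.Peel x E e) (h' : D.Peel y E' e') {y' : E.N} (hy : e y' = y) {x' : E'.N}
    (hx : e' x' = x) {F : IDag (Fin (a + 2)) (Fin b)} {f : F.N → E.N} (hF : E.Peel y' F f) :
    ∃ f', E'.Peel x' (F.pre (swapRel a)) f' := by
  choose f' hf' using fun z : F.N =>
    h'.exists_eq (e (f z)) fun hz => hF.ne z (h.injective (hz.trans hy.symm))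
  have map_e (v : Fin b ⊕ F.N) :
      Sum.map id e (Sum.map id f v) = Sum.map id e' (Sum.map id f' v) := by
    rcases v with v | v <;> simp [hf']
  refine ⟨f', ?injective, ?ne, ?exists_eq, ?minimal, ?input, ?last, ?inner⟩
  case injective =>
    exact fun (s t : F.N) hst => hF.injective (h.injective (by rw [← hf', ← hf', hst]))
  case ne => exact fun (z : F.N) hz => h.ne (f z) (by rw [← hf', hz, hx])
  case exists_eq =>
    intro t ht
    obtain ⟨s, hs⟩ := h.exists_eq (e' t) fun ht' => ht (h'.injective (ht'.trans hx.symm))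
    obtain ⟨z, rfl⟩ := hF.exists_eq s fun hs' => h'.ne t (by rw [← hs, hs', hy])
    exact ⟨z, h'.injective ((hf' z).trans hs)⟩
  case minimal =>
    intro t ht
    refine h.minimal (e' t) ?_
    simpa only [Sum.map_inr, hx] using (h'.inner t (.inr x')).1 ht
  case input =>
    intro i (v : Fin b ⊕ F.N)
    cases i using Fin.lastCases with
    | last =>
      simp only [IDag.pre, swapRel_castSucc_last, exists_eq_left]
      rw [hF.last, h.inner, map_e, hy, h'.last]
    | cast i =>
      simp only [IDag.pre, swapRel_castSucc_castSucc, exists_eq_left]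
      rw [hF.input, h.input, map_e, h'.input]
  case last =>
    intro (v : Fin b ⊕ F.N)
    simp only [IDag.pre, swapRel_last, exists_eq_left]
    rw [hF.input, h.last, map_e, h'.inner, hx]
  case inner =>
    intro (z : F.N) (v : Fin b ⊕ F.N)
    simp only [IDag.pre]
    rw [hF.inner, h.inner, map_e, h'.inner, hf']

end Peel

end IDag

end Peeling

section Decomposition

namespace PROP

variable (P : PROP.{w}) {a b c d : ℕ}

theorem tensor_id_eq (f : P.Hom a b) (n : ℕ) : P.tensor f (P.id n) =
    P.comp (P.symm a n) (P.comp (P.tensor (P.id n) f) (P.symm n b)) := by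
  rw [P.symm_naturality, ← P.assoc, P.symm_symm, P.id_comp]

theorem tensor_eq_comp (f : P.Hom a b) (g : P.Hom c d) : P.tensor f g =
    P.comp (P.tensor f (P.id c)) (P.tensor (P.id b) g) := by
  rw [← P.tensor_comp, P.id_comp, P.comp_id]

theorem id_tensor_comp (n : ℕ) (f : P.Hom a b) (g : P.Hom b c) : P.tensor (P.id n) (P.comp f g) =
    P.comp (P.tensor (P.id n) f) (P.tensor (P.id n) g) := by
  rw [← P.tensor_comp, P.id_comp]

theorem id_tensor_id_tensor (n a : ℕ) (f : P.Hom b c) :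
    P.tensor (P.id n) (P.tensor (P.id a) f) =
      castHom (Nat.add_assoc n a b) (Nat.add_assoc n a c) (P.tensor (P.id (n + a)) f) := by
  rw [← P.tensor_assoc, P.tensor_id]

end PROP

namespace AbsIDag

variable {a b c d : ℕ}

theorem comp_ofRel (r : Fin a → Fin b → Prop) (s : Fin b → Fin c → Prop) :
    dagProp.comp (mk (.ofRel r)) (mk (.ofRel s)) = mk (.ofRel (Relation.Comp r s)) := by
  refine Quotient.sound ⟨Equiv.sumEmpty Empty Empty, ?_⟩
  rintro (x | ⟨⟨⟩⟩ | ⟨⟨⟩⟩) (y | ⟨⟨⟩⟩ | ⟨⟨⟩⟩)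
  exact Iff.rfl

theorem tensor_ofRel (r : Fin a → Fin b → Prop) (s : Fin c → Fin d → Prop) :
    dagProp.tensor (mk (.ofRel r)) (mk (.ofRel s)) = mk (.ofRel (relSum r s)) := by
  refine Quotient.sound ⟨Equiv.sumEmpty Empty Empty, ?_⟩
  rintro (x | ⟨⟨⟩⟩ | ⟨⟨⟩⟩) (y | ⟨⟨⟩⟩ | ⟨⟨⟩⟩)
  change IDag.juxtRel (IDag.ofRelRel r) (IDag.ofRelRel s) (.inl (finSumFinEquiv.symm x))
    (.inl (finSumFinEquiv.symm y)) ↔ Sum.LiftRel r s (finSumFinEquiv.symm x)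
      (finSumFinEquiv.symm y)
  rcases finSumFinEquiv.symm x with x | x <;> rcases finSumFinEquiv.symm y with y | y <;>
    simp [IDag.juxtRel, IDag.ofRelRel]

theorem mk_eq_mk_ofRel (D : IDag (Fin a) (Fin b)) [IsEmpty D.N] :
    mk D = mk (.ofRel fun i j => D.R (.inl i) (.inl j)) := by
  refine Quotient.sound ⟨Equiv.equivOfIsEmpty D.N Empty, ?_⟩
  rintro (u | u) (v | v)
  · exact Iff.rfl
  all_goals exact isEmptyElim ‹D.N›

theorem mk_eq_comp {D : IDag (Fin a) (Fin b)} {x : D.N} {E : IDag (Fin (a + 1)) (Fin b)}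
    {e : E.N → D.N} (h : D.Peel x E e) :
    mk D = dagProp.comp (mk (.ofRel (dupRel fun i => D.R (.inl i) (.inr x))))
      (dagProp.comp (dagProp.tensor (dagProp.id a) (mk .node)) (mk E)) := by
  let K := (IDag.ofRel (dupRel fun i => D.R (.inl i) (.inr x))).concat
    (((IDag.ofRel (Eq : Fin a → Fin a → Prop)).juxtFin .node).concat E)
  let g : K.N → D.N := Sum.elim Empty.elim (Sum.elim (fun _ => x) e)
  have g_bijective : Function.Bijective g := by
    refine ⟨?_, fun y => ?_⟩
    · rintro (⟨⟨⟩⟩ | (⟨⟨⟩⟩ | ⟨⟩) | y) (⟨⟨⟩⟩ | (⟨⟨⟩⟩ | ⟨⟩) | z) hyz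
      · rfl
      · exact (h.ne z hyz.symm).elim
      · exact (h.ne y hyz).elim
      · rw [h.injective hyz]
    · by_cases hy : y = x
      · exact ⟨.inr (.inl (.inr ())), hy.symm⟩
      · obtain ⟨z, rfl⟩ := h.exists_eq y hy
        exact ⟨.inr (.inr z), rfl⟩
  refine Eq.symm (Quotient.sound ⟨Equiv.ofBijective g g_bijective, ?_⟩)
  suffices K_rel : ∀ u v, K.R u v ↔ D.R (Sum.map id g u) (Sum.map id g v) from K_rel
  rintro (u | ⟨⟨⟩⟩ | (⟨⟨⟩⟩ | ⟨⟩) | u) (v | ⟨⟨⟩⟩ | (⟨⟨⟩⟩ | ⟨⟩) | v) <;>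
    simp [K, g, IDag.concat, IDag.concatRel, IDag.ofRel, IDag.ofRelRel, IDag.juxtFin,
      IDag.reindex, IDag.reindexRel, IDag.juxt, IDag.juxtRel, IDag.node, IDag.nodeRel,
      Fin.exists_fin_succ', h.input, h.last, h.inner, h.minimal, dupRel_castSucc, dupRel_last]

theorem induction {motive : ∀ {a b : ℕ}, dagProp.Hom a b → Prop}
    (ofRel : ∀ {a b : ℕ} (r : Fin a → Fin b → Prop), motive (mk (.ofRel r)))
    (id_tensor_node : ∀ a : ℕ, motive (dagProp.tensor (dagProp.id a) (mk .node)))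
    (comp : ∀ {a b c : ℕ} {x : dagProp.Hom a b} {y : dagProp.Hom b c},
      motive x → motive y → motive (dagProp.comp x y))
    (x : dagProp.Hom a b) : motive x := by
  induction x using Quotient.inductionOn with | _ D
  induction D using IDag.peel_induction with
  | base D h => exact (congrArg motive (mk_eq_mk_ofRel D)).mpr (ofRel _)
  | @peel a _ _ _ _ h ih =>
    exact (congrArg motive (mk_eq_comp h)).mpr (comp (ofRel _) (comp (id_tensor_node a) ih))

end AbsIDag

end Decomposition

section Evaluation

namespace IDag

theorem id_juxtFin_node_rel {a : ℕ} (i : Fin (a + 1)) :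
    ((ofRel (Eq : Fin a → Fin a → Prop)).juxtFin node).R (.inl i) (.inr (.inr ())) ↔
      i = Fin.last a := by
  cases i using Fin.lastCases <;>
    simp [juxtFin, juxt, reindex, reindexRel, juxtRel, node, nodeRel, Fin.castSucc_ne_last]

theorem id_juxtFin_node_peel (a : ℕ) :
    Peel ((ofRel (Eq : Fin a → Fin a → Prop)).juxtFin node) (.inr ())
      (ofRel (relSum (fun (i : Fin (a + 1)) (j : Fin a) => j.castSucc = i)
        fun x y : Fin 1 => x = y)) Empty.elim where
  injective z := z.elim
  ne z := z.elim
  exists_eq := by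
    rintro (⟨⟨⟩⟩ | ⟨⟩) h
    exact (h rfl).elim
  minimal := by
    rintro (⟨⟨⟩⟩ | ⟨⟩)
    exact id
  input i v := by
    rcases v with v | ⟨⟨⟩⟩
    cases v using Fin.lastCases <;> cases i using Fin.lastCases <;>
      simp [juxtFin, juxt, reindex, reindexRel, juxtRel, node, nodeRel, ofRel, ofRelRel,
        relSum_id_castSucc_iff, (Fin.castSucc_ne_last _).symm, eq_comm]
  last v := by
    rcases v with v | ⟨⟨⟩⟩
    cases v using Fin.lastCases <;>
      simp [juxtFin, juxt, reindex, reindexRel, juxtRel, node, nodeRel, ofRel, ofRelRel,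
        relSum_id_last_iff, Fin.castSucc_ne_last]
  inner z := z.elim

end IDag

namespace GenAlg

open IDag

variable {P : PROP.{w}} (M : GenAlg degCommBialg P) (l : P.Hom 1 1) {a a' b c d : ℕ}

/-- The evaluations of an idag: the morphisms obtained by removing its minimal internal nodes one
by one, in some order, and interpreting each of them by `l`. -/
inductive Evaluates : ∀ {a : ℕ}, IDag (Fin a) (Fin b) → P.Hom a b → Prop
  | rel {a : ℕ} {D : IDag (Fin a) (Fin b)} : IsEmpty D.N →
      Evaluates D (M.relHom fun i j => D.R (.inl i) (.inl j))
  | step {a : ℕ} {D : IDag (Fin a) (Fin b)} {x : D.N} {E : IDag (Fin (a + 1)) (Fin b)}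
      {e : E.N → D.N} {f : P.Hom (a + 1) b} : D.Peel x E e → Evaluates E f →
      Evaluates D (P.comp (M.step l fun i => D.R (.inl i) (.inr x)) f)

theorem exists_evaluates (D : IDag (Fin a) (Fin b)) : ∃ f, M.Evaluates l D f := by
  induction D using peel_induction with
  | base D h => exact ⟨_, .rel h⟩
  | peel h ih =>
    obtain ⟨f, hf⟩ := ih
    exact ⟨_, .step h hf⟩

variable {M l}

namespace Evaluates

variable {D D' : IDag (Fin a) (Fin b)} {f g : P.Hom a b}

theorem iso (h : M.Evaluates l D f) (hD : D.Iso D') : M.Evaluates l D' f := by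
  obtain ⟨σ, hσ⟩ := hD
  cases h with
  | rel h =>
    simp only [hσ]
    exact .rel σ.symm.isEmpty
  | step h hf =>
    simp only [hσ]
    exact .step (h.iso hσ) hf

theorem pre (h : M.Evaluates l D f) (r : Fin a' → Fin a → Prop) :
    M.Evaluates l (D.pre r) (P.comp (M.relHom r) f) := by
  induction h generalizing a' with
  | @rel _ D h =>
    rw [← relHom_comp]
    exact .rel (D := D.pre r) h
  | step h _ ih =>
    rw [← P.assoc, relHom_comp_step, P.assoc]
    exact .step (h.pre r) (ih _)

theorem concat {F : IDag (Fin b) (Fin c)} {k : P.Hom b c} (hf : M.Evaluates l D f)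
    (hk : M.Evaluates l F k) : M.Evaluates l (D.concat F) (P.comp f k) := by
  induction hf with
  | @rel _ D h =>
    refine (hk.pre _).iso ⟨(Equiv.emptySum D.N F.N).symm, fun u v => ?_⟩
    rcases u with u | u <;> rcases v with v | v <;> exact Iff.rfl
  | @step _ D x _ _ _ h _ ih =>
    rw [P.assoc]
    exact Evaluates.step (D := D.concat F) (x := .inl x) (h.concat F) ih

theorem exists_exchange {x y : D.N} {E E' : IDag (Fin (a + 1)) (Fin b)} {e : E.N → D.N}
    {e' : E'.N → D.N} (h : D.Peel x E e) (h' : D.Peel y E' e') (hxy : x ≠ y) :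
    ∃ k k', M.Evaluates l E k ∧ M.Evaluates l E' k' ∧
      P.comp (M.step l fun i => D.R (.inl i) (.inr x)) k =
        P.comp (M.step l fun i => D.R (.inl i) (.inr y)) k' := by
  obtain ⟨y', hy⟩ := h.exists_eq y hxy.symm
  obtain ⟨x', hx⟩ := h'.exists_eq x hxy
  have y'_minimal (z) : ¬ E.R (.inr z) (.inr y') := by
    rw [h.inner, Sum.map_inr, hy]
    exact h'.minimal (e z)
  obtain ⟨F, _, hF⟩ := exists_peel y'_minimal
  obtain ⟨k, hk⟩ := M.exists_evaluates l F
  obtain ⟨_, hF'⟩ := h.exchange h' hy hx hF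
  refine ⟨_, _, .step hF hk, .step hF' (hk.pre _), ?_⟩
  have exchange := M.step_exchange l
    (p := fun i => D.R (.inl i) (.inr y)) (p' := fun i => E.R (.inl i) (.inr y'))
    (q := fun i => D.R (.inl i) (.inr x)) (q' := fun i => E'.R (.inl i) (.inr x'))
    (by rw [h.last, Sum.map_inr, hy]; exact h'.minimal x)
    (fun i => by rw [h.input, Sum.map_inr, hy])
    (by rw [h'.last, Sum.map_inr, hx]; exact h.minimal y)
    (fun i => by rw [h'.input, Sum.map_inr, hx])
  rw [← P.assoc, ← exchange, P.assoc, P.assoc]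

theorem unique (hf : M.Evaluates l D f) (hg : M.Evaluates l D g) : f = g := by
  induction hn : Nat.card D.N using Nat.strong_induction_on generalizing a with
  | _ n ih =>
    subst hn
    cases hf with
    | rel h =>
      cases hg with
      | rel => rfl
      | @step _ _ x => exact h.elim x
    | @step _ _ x E e f h hf =>
      cases hg with
      | rel h => exact h.elim x
      | @step _ _ y E' e' g h' hg =>
        by_cases hxy : x = y
        · subst hxy
          rw [ih _ h'.card_lt (hf.iso (h.iso_of_peel h')) hg rfl]
        · obtain ⟨k, k', hk, hk', hkk'⟩ := exists_exchange h h' hxy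
          rw [ih _ h.card_lt hf hk rfl, ih _ h'.card_lt hg hk' rfl, hkk']

end Evaluates

variable (M l)

/-- The value of an idag in a PROP with a degenerate commutative bialgebra and an interpretation
`l` of the nodes. -/
noncomputable def eval : dagProp.Hom a b → P.Hom a b :=
  Quotient.lift (fun D => (M.exists_evaluates l D).choose) fun D D' h =>
    ((M.exists_evaluates l D).choose_spec.iso h).unique (M.exists_evaluates l D').choose_spec

variable {M l} in
theorem Evaluates.eval_mk {D : IDag (Fin a) (Fin b)} {f : P.Hom a b} (h : M.Evaluates l D f) :
    M.eval l (.mk D) = f :=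
  (M.exists_evaluates l D).choose_spec.unique h

theorem evaluates_eval (D : IDag (Fin a) (Fin b)) : M.Evaluates l D (M.eval l (.mk D)) :=
  (M.exists_evaluates l D).choose_spec

theorem eval_ofRel (r : Fin a → Fin b → Prop) : M.eval l (.mk (.ofRel r)) = M.relHom r :=
  (Evaluates.rel (D := .ofRel r) (inferInstanceAs (IsEmpty Empty))).eval_mk

theorem eval_mk_of_peel {D : IDag (Fin a) (Fin b)} {x : D.N} {E : IDag (Fin (a + 1)) (Fin b)}
    {e : E.N → D.N} (h : D.Peel x E e) : M.eval l (.mk D) =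
      P.comp (M.step l fun i => D.R (.inl i) (.inr x)) (M.eval l (.mk E)) :=
  (Evaluates.step h (M.evaluates_eval l E)).eval_mk

theorem eval_comp (x : dagProp.Hom a b) (y : dagProp.Hom b c) :
    M.eval l (dagProp.comp x y) = P.comp (M.eval l x) (M.eval l y) := by
  induction x using Quotient.inductionOn with | _ D
  induction y using Quotient.inductionOn with | _ E
  exact ((M.evaluates_eval l D).concat (M.evaluates_eval l E)).eval_mk

theorem eval_id_tensor_node (a : ℕ) :
    M.eval l (dagProp.tensor (dagProp.id a) (.mk .node)) = P.tensor (P.id a) l := by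
  let p : Fin (a + 1) → Prop := fun i => i = Fin.last a
  let r : Fin (a + 1) → Fin a → Prop := fun i j => j.castSucc = i
  have comp_rel : Relation.Comp (dupRel p) (relSum r fun x y : Fin 1 => x = y) =
      fun i j => i = j := by
    ext i j
    simp only [Relation.Comp, Fin.exists_fin_succ', dupRel_castSucc, dupRel_last,
      relSum_id_castSucc_iff, relSum_id_last_iff, p, r]
    cases j using Fin.lastCases <;> simp [Fin.castSucc_ne_last, eq_comm]
  have eval_eq : M.eval l (dagProp.tensor (dagProp.id a) (.mk .node)) =
      P.comp (M.step l p) (M.relHom (relSum r fun x y : Fin 1 => x = y)) := by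
    have peel := M.eval_mk_of_peel l (id_juxtFin_node_peel a)
    simp only [eval_ofRel, id_juxtFin_node_rel] at peel
    exact peel
  have interchange : P.comp (P.tensor (P.id (a + 1)) l) (P.tensor (M.relHom r) (P.id 1)) =
      P.comp (P.tensor (M.relHom r) (P.id 1)) (P.tensor (P.id a) l) := by
    simp only [← P.tensor_comp, P.id_comp, P.comp_id]
  rw [eval_eq, step_eq, P.assoc, relHom_relSum, relHom_id, interchange, ← P.assoc,
    ← M.relHom_id 1, ← relHom_relSum, ← relHom_comp, comp_rel, relHom_id, P.id_comp]

theorem eval_id_tensor (n : ℕ) (x : dagProp.Hom a b) :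
    M.eval l (dagProp.tensor (dagProp.id n) x) = P.tensor (P.id n) (M.eval l x) := by
  induction x using AbsIDag.induction with
  | ofRel r =>
    rw [eval_ofRel, ← M.relHom_id, ← relHom_relSum, ← M.eval_ofRel l]
    exact congrArg (M.eval l) (AbsIDag.tensor_ofRel _ r)
  | id_tensor_node a =>
    rw [eval_id_tensor_node, P.id_tensor_id_tensor]
    exact (congrArg (M.eval l) (dagProp.id_tensor_id_tensor n a (.mk .node))).trans
      (M.eval_id_tensor_node l (n + a))
  | comp hx hy => rw [dagProp.id_tensor_comp, eval_comp, eval_comp, hx, hy, P.id_tensor_comp]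

theorem eval_id (a : ℕ) : M.eval l (dagProp.id a) = P.id a :=
  (M.eval_ofRel l _).trans (M.relHom_id a)

theorem eval_symm (a b : ℕ) : M.eval l (dagProp.symm a b) = P.symm a b :=
  (M.eval_ofRel l _).trans (M.relHom_finAddFlip a b)

theorem eval_tensor (x : dagProp.Hom a b) (y : dagProp.Hom c d) :
    M.eval l (dagProp.tensor x y) = P.tensor (M.eval l x) (M.eval l y) := by
  rw [dagProp.tensor_eq_comp, dagProp.tensor_id_eq, P.tensor_eq_comp, P.tensor_id_eq]
  simp only [eval_comp, eval_id_tensor, eval_symm]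

/-- Evaluation of idags, as a morphism of PROPs. -/
noncomputable def evalMorphism : dagProp.Morphism P where
  map := M.eval l
  map_id := M.eval_id l
  map_comp := M.eval_comp l
  map_tensor := M.eval_tensor l
  map_symm := M.eval_symm l

theorem eval_node : M.eval l (.mk .node) = l := by
  rw [← dagProp.unit_tensor (.mk .node)]
  exact (M.eval_id_tensor_node l 0).trans (P.unit_tensor l)

end GenAlg

end Evaluation

section Generation

namespace Expr

theorem evalProp_inl {S S' : Signature} {P : PROP.{w}}
    {op : ∀ o : (S.sum S').Op, P.Hom ((S.sum S').dom o) ((S.sum S').cod o)} {a b : ℕ}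
    (f : Expr S a b) : f.inl.evalProp P op = f.evalProp P fun o => op (.inl o) := by
  induction f with
  | op | id | symm => rfl
  | comp f g hf hg => exact congrArg₂ P.comp hf hg
  | tensor f g hf hg => exact congrArg₂ P.tensor hf hg

/-- The interpretation of the expressions of bialgebras as relations, with all operators
interpreted as full relations. -/
def evalRel : ∀ {a b : ℕ}, Expr bialgSig a b → Fin a → Fin b → Prop
  | _, _, .op _ => fun _ _ => True
  | _, _, .id _ => fun i j => i = j
  | _, _, .comp f g => Relation.Comp f.evalRel g.evalRel
  | _, _, .tensor f g => relSum f.evalRel g.evalRel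
  | _, _, .symm _ _ => fun x y => finAddFlip x = y

variable {a b c d : ℕ}

theorem evalProp_inl_dagOp (f : Expr bialgSig a b) :
    (f.inl (S' := (nodes Unit).toSignature)).evalProp dagProp dagOp =
      AbsIDag.mk (.ofRel f.evalRel) := by
  refine (evalProp_inl f).trans ?_
  induction f with
  | op o => cases o <;> rfl
  | id | symm => rfl
  | comp f g hf hg => exact (congrArg₂ dagProp.comp hf hg).trans (AbsIDag.comp_ofRel _ _)
  | tensor f g hf hg => exact (congrArg₂ dagProp.tensor hf hg).trans (AbsIDag.tensor_ofRel _ _)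

instance decidableRelComp (r : Fin a → Fin b → Prop) (s : Fin b → Fin c → Prop)
    [DecidableRel r] [DecidableRel s] : DecidableRel (Relation.Comp r s) :=
  fun i k => inferInstanceAs (Decidable (∃ j, r i j ∧ s j k))

instance decidableRelRelSum (r : Fin a → Fin b → Prop) (s : Fin c → Fin d → Prop)
    [DecidableRel r] [DecidableRel s] : DecidableRel (relSum r s) :=
  fun i j => inferInstanceAs
    (Decidable (Sum.LiftRel r s (finSumFinEquiv.symm i) (finSumFinEquiv.symm j)))

instance decidableRelEvalRel : ∀ {a b : ℕ} (f : Expr bialgSig a b), DecidableRel f.evalRel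
  | _, _, .op _ => fun _ _ => inferInstanceAs (Decidable True)
  | _, _, .id _ => fun i j => inferInstanceAs (Decidable (i = j))
  | _, _, .comp f g =>
    have := decidableRelEvalRel f
    have := decidableRelEvalRel g
    decidableRelComp f.evalRel g.evalRel
  | _, _, .tensor f g =>
    have := decidableRelEvalRel f
    have := decidableRelEvalRel g
    decidableRelRelSum f.evalRel g.evalRel
  | _, _, .symm _ _ => fun x y => inferInstanceAs (Decidable (finAddFlip x = y))

open Bialg in
theorem exists_evalRel_eq_flip_or (q : Prop) : ∃ f : Expr bialgSig (1 + 1) (1 + 1),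
    f.evalRel = fun x y => finAddFlip x = y ∨ x = 1 ∧ q := by
  by_cases hq : q
  · refine ⟨((i.tensor Δ).comp (γ.tensor i)).comp (i.tensor m), ?_⟩
    simp only [hq, and_true, funext_iff, eq_iff_iff]
    decide
  · exact ⟨γ, by simp only [hq, and_false, or_false]; rfl⟩

theorem exists_evalRel_eq_dupRel (p : Fin a → Prop) :
    ∃ f : Expr bialgSig a (a + 1), f.evalRel = dupRel p := by
  induction a with
  | zero => exact ⟨Bialg.η, funext fun i => i.elim0⟩
  | succ a ih =>
    obtain ⟨f, hf⟩ := ih fun i => p i.castSucc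
    obtain ⟨g, hg⟩ := exists_evalRel_eq_flip_or (p (Fin.last a))
    refine ⟨(f.tensor Bialg.i).comp ((Expr.id a).tensor g), ?_⟩
    rw [dupRel_succ, ← hf, ← hg]
    rfl

theorem evalRel_surjective (r : Fin a → Fin b → Prop) :
    ∃ f : Expr bialgSig a b, f.evalRel = r := by
  induction b with
  | zero =>
    suffices Nonempty (Expr bialgSig a 0) by
      obtain ⟨f⟩ := this
      exact ⟨f, funext fun i => funext fun j => j.elim0⟩
    clear r
    induction a with
    | zero => exact ⟨.id 0⟩
    | succ a ih =>
      obtain ⟨f⟩ := ih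
      exact ⟨f.tensor Bialg.ε⟩
  | succ b ih =>
    obtain ⟨f, hf⟩ := exists_evalRel_eq_dupRel fun i => r i (Fin.last b)
    obtain ⟨g, hg⟩ := ih fun i j => r i j.castSucc
    refine ⟨f.comp (g.tensor Bialg.i), ?_⟩
    rw [eq_dupRel_comp r, ← hf, ← hg]
    rfl

end Expr

theorem Bialg.Eqn.evalRel_iff {a b : ℕ} {f g : Expr bialgSig a b} (h : Bialg.Eqn f g) :
    ∀ i j, f.evalRel i j ↔ g.evalRel i j := by
  cases h <;> decide

/-- The algebra of the theory of degenerate commutative bialgebras with a node in the PROP of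
idags. -/
def dagAlg : GenAlg dagTheory dagProp where
  op := dagOp
  eqn h := by
    rcases h with h | h
    · refine (Expr.evalProp_inl_dagOp _).trans (Eq.trans ?_ (Expr.evalProp_inl_dagOp _).symm)
      congr 2
      ext i j
      exact Bialg.Eqn.evalRel_iff h i j
    · exact h.elim

theorem exists_evalProp_dagOp_eq {a b : ℕ} (x : dagProp.Hom a b) :
    ∃ f : Expr dagTheory.toSignature a b, f.evalProp dagProp dagOp = x := by
  induction x using AbsIDag.induction with
  | ofRel r =>
    obtain ⟨f, rfl⟩ := Expr.evalRel_surjective r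
    exact ⟨f.inl, f.evalProp_inl_dagOp⟩
  | id_tensor_node a =>
    exact ⟨(Expr.id a).tensor (.op (S := dagTheory.toSignature) (.inr ())), rfl⟩
  | comp hx hy =>
    obtain ⟨f, rfl⟩ := hx
    obtain ⟨g, rfl⟩ := hy
    exact ⟨f.comp g, rfl⟩

namespace GenAlg

variable {P : PROP.{w}}

/-- The restriction of an algebra of a sum of theories to the first summand. -/
def inl {T T' : SMTheory} (M : GenAlg (T.sum T') P) : GenAlg T P where
  op o := M.op (.inl o)
  eqn h := by
    rw [← Expr.evalProp_inl (op := M.op), ← Expr.evalProp_inl (op := M.op)]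
    exact M.eqn (.inl h)

theorem relHom_op (M : GenAlg degCommBialg P) (o : BialgOp) :
    M.relHom (fun (_ : Fin (bialgSig.dom o)) (_ : Fin (bialgSig.cod o)) => True) = M.op o := by
  cases o with
  | eta => exact M.mat_eta
  | nabla => exact M.mat_nabla
  | eps => exact M.mat_eps
  | delta => exact M.mat_delta

theorem eval_dagOp (M : GenAlg dagTheory P) (o : dagTheory.Op) :
    (inl M).eval (M.op (.inr ())) (dagOp o) = M.op o := by
  rcases o with o | ⟨⟩
  · refine Eq.trans ?_ ((inl M).relHom_op o)
    cases o <;> exact (inl M).eval_ofRel (M.op (.inr ())) _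
  · exact (inl M).eval_node _

end GenAlg

end Generation

section FreeProp

theorem GenAlg.evalProp_eq_of_provable {T : SMTheory} {P : PROP.{w}} (M : GenAlg T P) {a b : ℕ}
    {f g : Expr T.toSignature a b} (h : T.Provable f g) :
    f.evalProp P M.op = g.evalProp P M.op := by
  have cast {a a' b b' : ℕ} (ha : a = a') (hb : b = b') (f : Expr T.toSignature a b) :
      (castHom ha hb f : Expr T.toSignature a' b').evalProp P M.op =
        castHom ha hb (f.evalProp P M.op) :=
    (castHom_natural (fun {a b} (f : Expr T.toSignature a b) => f.evalProp P M.op) ha hb f).symm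
  induction h with
  | eqn h => exact M.eqn h
  | refl f => rfl
  | symm _ h => exact h.symm
  | trans _ _ h h' => exact h.trans h'
  | comp_congr _ _ h h' => exact congrArg₂ P.comp h h'
  | tensor_congr _ _ h h' => exact congrArg₂ P.tensor h h'
  | id_comp f => exact P.id_comp _
  | comp_id f => exact P.comp_id _
  | assoc f g h => exact P.assoc _ _ _
  | tensor_id a b => exact P.tensor_id a b
  | tensor_comp f g f' g' => exact P.tensor_comp _ _ _ _
  | tensor_assoc f g h => exact (cast _ _ _).trans (P.tensor_assoc _ _ _)
  | unit_tensor f => exact (cast _ _ _).trans (P.unit_tensor _)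
  | tensor_unit f => exact P.tensor_unit _
  | symm_naturality f g => exact P.symm_naturality _ _
  | symm_symm a b => exact P.symm_symm a b
  | hexagon a b c =>
    exact (P.hexagon a b c).trans (congrArg₂ P.comp
      (cast _ _ ((Expr.symm a b).tensor (Expr.id c)))
      (cast _ _ ((Expr.id b).tensor (Expr.symm a c)))).symm

/-- The morphism from the free PROP that is determined by an algebra. -/
def GenAlg.freeLift {T : SMTheory} {P : PROP.{w}} (M : GenAlg T P) : T.freeProp.Morphism P where
  map := Quotient.lift (fun f => f.evalProp P M.op) fun _ _ h => M.evalProp_eq_of_provable h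
  map_id _ := rfl
  map_comp := by rintro a b c ⟨f⟩ ⟨g⟩; rfl
  map_tensor := by rintro a b c d ⟨f⟩ ⟨g⟩; rfl
  map_symm _ _ := rfl

theorem SMTheory.evalProp_gen (T : SMTheory) {a b : ℕ} (f : Expr T.toSignature a b) :
    f.evalProp T.freeProp T.gen = Quotient.mk (T.setoid a b) f := by
  induction f with
  | op o => rfl
  | id a => rfl
  | comp f g hf hg => exact congrArg₂ T.freeProp.comp hf hg
  | tensor f g hf hg => exact congrArg₂ T.freeProp.tensor hf hg
  | symm a b => rfl

/-- The generic algebra of a theory in its free PROP. -/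
def SMTheory.genAlg (T : SMTheory) : GenAlg T T.freeProp where
  op := T.gen
  eqn h := by
    rw [T.evalProp_gen, T.evalProp_gen]
    exact Quotient.sound (.eqn h)

theorem PROP.Morphism.map_evalProp {S : Signature} {P : PROP.{w}} {Q : PROP.{w'}}
    (φ : P.Morphism Q) (m : ∀ o : S.Op, P.Hom (S.dom o) (S.cod o)) {a b : ℕ} (f : Expr S a b) :
    φ.map (f.evalProp P m) = f.evalProp Q fun o => φ.map (m o) := by
  induction f with
  | op => rfl
  | id a => exact φ.map_id a
  | comp f g hf hg => exact (φ.map_comp _ _).trans (congrArg₂ Q.comp hf hg)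
  | tensor f g hf hg => exact (φ.map_tensor _ _).trans (congrArg₂ Q.tensor hf hg)
  | symm a b => exact φ.map_symm a b

/-- An algebra `M` in a PROP `P` is free when it generates `P` and every algebra in a PROP is the
image of `M` under a morphism of PROPs, which is unique because `M` generates `P`. The universe
`t` is that of the PROPs in which these algebras live. -/
structure GenAlg.IsFree.{s, t} {T : SMTheory} {P : PROP.{s}} (M : GenAlg T P) : Prop where
  exists_evalProp_eq {a b : ℕ} (x : P.Hom a b) :
    ∃ f : Expr T.toSignature a b, f.evalProp P M.op = x
  exists_morphism {Q : PROP.{t}} (N : GenAlg T Q) :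
    ∃ φ : P.Morphism Q, ∀ o, φ.map (M.op o) = N.op o

theorem GenAlg.IsFree.isIso_freeLift {T : SMTheory} {P : PROP.{w}} {M : GenAlg T P}
    (hM : IsFree.{w, 0} M) : M.freeLift.IsIso := by
  refine fun a b => ⟨?_, fun x => ?_⟩
  · obtain ⟨φ, hφ⟩ := hM.exists_morphism T.genAlg
    have map_evalProp (f : Expr T.toSignature a b) :
        φ.map (f.evalProp P M.op) = Quotient.mk (T.setoid a b) f := by
      rw [φ.map_evalProp, funext hφ]
      exact T.evalProp_gen f
    rintro ⟨f⟩ ⟨g⟩ h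
    exact (map_evalProp f).symm.trans ((congrArg φ.map h).trans (map_evalProp g))
  · obtain ⟨f, hf⟩ := hM.exists_evalProp_eq x
    exact ⟨Quotient.mk _ f, hf⟩

theorem dagAlg_isFree : GenAlg.IsFree.{1, w} dagAlg where
  exists_evalProp_eq := exists_evalProp_dagOp_eq
  exists_morphism N := ⟨N.inl.evalMorphism (N.op (.inr ())), N.eval_dagOp⟩

end FreeProp

section EndomorphismProp

variable {C : Type u} [Category.{v} C] [MonoidalCategory C] (A : C)

theorem castHom_tpow {a a' b b' : ℕ} (ha : a = a') (hb : b = b') (f : tpow A a ⟶ tpow A b) :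
    castHom (H := fun a b => tpow A a ⟶ tpow A b) ha hb f =
      eqToHom (congrArg (tpow A) ha.symm) ≫ f ≫ eqToHom (congrArg (tpow A) hb) := by
  subst ha hb
  simp only [castHom, eqToHom_refl, Category.id_comp, Category.comp_id]

theorem eqToHom_tpow_succ {a a' : ℕ} (h : a = a') (h' : tpow A (a + 1) = tpow A (a' + 1)) :
    (eqToHom h' : tpow A a ⊗ A ⟶ tpow A a' ⊗ A) = eqToHom (congrArg (tpow A) h) ▷ A := by
  subst h
  exact (id_whiskerRight (tpow A a) A).symm

theorem tpowAdd_zero_left (n : ℕ) : tpowAdd A 0 n =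
    eqToIso (congrArg (tpow A) (Nat.zero_add n)) ≪≫ (λ_ (tpow A n)).symm := by
  have whiskerRight_associator {X Y : C} (t : X ≅ 𝟙_ C ⊗ Y) (e : X ≅ Y)
      (h : t = e ≪≫ (λ_ Y).symm) :
      t.hom ▷ A ≫ (α_ (𝟙_ C) Y A).hom = e.hom ▷ A ≫ (λ_ (Y ⊗ A)).inv := by
    subst h
    simp
  ext
  induction n with
  | zero =>
    change (ρ_ (𝟙_ C)).inv = 𝟙 (𝟙_ C) ≫ (λ_ (𝟙_ C)).inv
    simp [unitors_inv_equal]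
  | succ n ih =>
    refine (whiskerRight_associator _ _ (Iso.ext ih)).trans ?_
    exact congrArg (· ≫ (λ_ (tpow A n ⊗ A)).inv) (eqToHom_tpow_succ A (Nat.zero_add n)
      (congrArg (tpow A) (Nat.zero_add (n + 1)))).symm

theorem tpowAdd_add (a b c : ℕ) :
    (tpowAdd A (a + b) c).hom ≫ (tpowAdd A a b).hom ▷ tpow A c ≫
        (α_ (tpow A a) (tpow A b) (tpow A c)).hom =
      eqToHom (congrArg (tpow A) (Nat.add_assoc a b c)) ≫ (tpowAdd A a (b + c)).hom ≫
        tpow A a ◁ (tpowAdd A b c).hom := by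
  induction c with
  | zero =>
    change (ρ_ (tpow A (a + b))).inv ≫ (tpowAdd A a b).hom ▷ 𝟙_ C ≫
        (α_ (tpow A a) (tpow A b) (𝟙_ C)).hom =
      𝟙 (tpow A (a + b)) ≫ (tpowAdd A a b).hom ≫ tpow A a ◁ (ρ_ (tpow A b)).inv
    simp
  | succ c ih =>
    change ((tpowAdd A (a + b) c).hom ▷ A ≫ (α_ (tpow A (a + b)) (tpow A c) A).hom) ≫
        (tpowAdd A a b).hom ▷ (tpow A c ⊗ A) ≫ (α_ (tpow A a) (tpow A b) (tpow A c ⊗ A)).hom =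
      (eqToHom (congrArg (tpow A) (Nat.add_assoc a b (c + 1))) :
        tpow A (a + b + c) ⊗ A ⟶ tpow A (a + (b + c)) ⊗ A) ≫
        ((tpowAdd A a (b + c)).hom ▷ A ≫ (α_ (tpow A a) (tpow A (b + c)) A).hom) ≫
        tpow A a ◁ ((tpowAdd A b c).hom ▷ A ≫ (α_ (tpow A b) (tpow A c) A).hom)
    rw [eqToHom_tpow_succ A (Nat.add_assoc a b c)]
    have ih' := congrArg (· ▷ A ≫ (α_ (tpow A a) (tpow A b ⊗ tpow A c) A).hom ≫
      tpow A a ◁ (α_ (tpow A b) (tpow A c) A).hom) ih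
    simp only [comp_whiskerRight, Category.assoc] at ih'
    simp only [MonoidalCategory.whiskerLeft_comp, Category.assoc]
    rw [← associator_naturality_middle_assoc]
    refine Eq.trans ?_ ih'
    rw [pentagon]
    simp

variable [SymmetricCategory C]

/-- The PROP of the morphisms between the tensor powers of an object. -/
def endProp : PROP.{v} where
  Hom a b := tpow A a ⟶ tpow A b
  id a := 𝟙 (tpow A a)
  comp f g := f ≫ g
  tensor {a b c d} f g := (tpowAdd A a c).hom ≫ (f ⊗ₘ g) ≫ (tpowAdd A b d).inv
  symm a b := (tpowAdd A a b).hom ≫ (β_ (tpow A a) (tpow A b)).hom ≫ (tpowAdd A b a).inv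
  id_comp := Category.id_comp
  comp_id := Category.comp_id
  assoc := Category.assoc
  tensor_id a b := by simp
  tensor_comp f g f' g' := by simp
  tensor_assoc {a b a' b' a'' b''} f g h := by
    rw [castHom_tpow]
    have add_dom := tpowAdd_add A a a' a''
    have add_cod := tpowAdd_add A b b' b''
    rw [← cancel_mono ((tpowAdd A b (b' + b'')).hom ≫ tpow A b ◁ (tpowAdd A b' b'').hom),
      ← cancel_epi (eqToHom (congrArg (tpow A) (Nat.add_assoc a a' a'')))]
    simp only [Category.assoc, eqToHom_trans_assoc, eqToHom_refl, Category.id_comp, ← add_cod]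
    simp only [MonoidalCategory.tensorHom_def, comp_whiskerRight, MonoidalCategory.whiskerLeft_comp,
      Category.assoc, Iso.inv_hom_id_assoc]
    rw [whisker_exchange_assoc (tpowAdd A b b').hom h,
      ← whisker_exchange_assoc f (tpowAdd A a' a'').hom, ← reassoc_of% add_dom]
    simp
  unit_tensor {a b} f := by
    have conj_eq {X X' Y Y' : C} (e : X ≅ Y) (e' : X' ≅ Y') (f : Y ⟶ Y') :
        e.inv ≫ ((e ≪≫ (λ_ Y).symm).hom ≫ (𝟙 (𝟙_ C) ⊗ₘ f) ≫ (e' ≪≫ (λ_ Y').symm).inv) ≫ e'.hom =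
          f := by
      simp
    rw [castHom_tpow, tpowAdd_zero_left, tpowAdd_zero_left]
    exact conj_eq (eqToIso (congrArg (tpow A) (Nat.zero_add a)))
      (eqToIso (congrArg (tpow A) (Nat.zero_add b))) f
  tensor_unit {a b} f := by
    change (ρ_ (tpow A a)).inv ≫ (f ⊗ₘ 𝟙 (𝟙_ C)) ≫ (ρ_ (tpow A b)).hom = f
    simp
  symm_naturality f g := by simp
  symm_symm a b := by simp
  hexagon a b c := by
    rw [castHom_tpow, castHom_tpow]
    have add_abc := tpowAdd_add A a b c
    have add_bac := tpowAdd_add A b a c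
    have add_bca := tpowAdd_add A b c a
    rw [← cancel_mono ((tpowAdd A (b + c) a).hom ≫ (tpowAdd A b c).hom ▷ tpow A a ≫
        (α_ (tpow A b) (tpow A c) (tpow A a)).hom),
      ← cancel_epi (eqToHom (congrArg (tpow A) (Nat.add_assoc a b c)))]
    conv_rhs => rw [add_bca]
    simp only [Category.assoc, eqToHom_trans_assoc, eqToHom_refl, Category.id_comp, id_tensorHom,
      tensorHom_id, comp_whiskerRight, MonoidalCategory.whiskerLeft_comp, Iso.inv_hom_id_assoc,
      whiskerLeft_inv_hom, Category.comp_id]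
    rw [← reassoc_of% add_bac]
    simp only [inv_hom_whiskerRight_assoc, Iso.inv_hom_id_assoc]
    rw [← BraidedCategory.hexagon_forward, reassoc_of% add_abc,
      BraidedCategory.braiding_naturality_right_assoc]

end EndomorphismProp

section UniversalProperty

open Functor.LaxMonoidal Functor.OplaxMonoidal Functor.Monoidal

variable {C : Type u} [Category.{v} C] [MonoidalCategory C]

theorem tpowMap_add {A B : C} (h : A ⟶ B) (a b : ℕ) :
    tpowMap h (a + b) ≫ (tpowAdd B a b).hom =
      (tpowAdd A a b).hom ≫ (tpowMap h a ⊗ₘ tpowMap h b) := by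
  induction b with
  | zero =>
    change tpowMap h a ≫ (ρ_ (tpow B a)).inv = (ρ_ (tpow A a)).inv ≫ (tpowMap h a ⊗ₘ 𝟙 (𝟙_ C))
    simp
  | succ b ih =>
    change (tpowMap h (a + b) ⊗ₘ h) ≫ (tpowAdd B a b).hom ▷ B ≫
        (α_ (tpow B a) (tpow B b) B).hom =
      ((tpowAdd A a b).hom ▷ A ≫ (α_ (tpow A a) (tpow A b) A).hom) ≫
        (tpowMap h a ⊗ₘ (tpowMap h b ⊗ₘ h))
    rw [Category.assoc, ← associator_naturality, ← tensorHom_id, ← tensorHom_id,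
      tensorHom_comp_tensorHom_assoc, tensorHom_comp_tensorHom_assoc, ih]
    simp

theorem genIso_one {P : PROP.{w}} (F : P.Obj ⥤ C) [F.Monoidal] :
    (genIso F 1).hom = (λ_ (F.obj ⟨1⟩)).hom := by
  have map_leftUnitor : F.map (λ_ (⟨1⟩ : P.Obj)).hom = 𝟙 (F.obj ⟨1⟩) := F.map_id _
  have left_unitality := Functor.LaxMonoidal.left_unitality F (⟨1⟩ : P.Obj)
  rw [map_leftUnitor] at left_unitality
  exact (left_unitality.trans (congrArg (_ ≫ ·) (Category.comp_id _))).symm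

theorem tpowMap_one {A B : C} (h : A ⟶ B) :
    tpowMap h 1 ≫ (λ_ B).hom = (λ_ A).hom ≫ h := by
  change (𝟙 (𝟙_ C) ⊗ₘ h) ≫ (λ_ B).hom = (λ_ A).hom ≫ h
  simp

theorem genIso_one_inv_tpowMap_genIso_one {P : PROP.{w}} {F G : P.Obj ⥤ C} [F.Monoidal] [G.Monoidal]
    (k : F.obj ⟨1⟩ ⟶ G.obj ⟨1⟩) :
    (genIso F 1).inv ≫ tpowMap k 1 ≫ (genIso G 1).hom = k := by
  rw [Iso.inv_comp_eq, genIso_one, genIso_one]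
  exact tpowMap_one k

/-- The tensor powers of an isomorphism, see `tpowMap`. -/
@[simps]
def tpowMapIso {A B : C} (e : A ≅ B) (n : ℕ) : tpow A n ≅ tpow B n where
  hom := tpowMap e.hom n
  inv := tpowMap e.inv n
  hom_inv_id := by rw [← tpowMap_comp, e.hom_inv_id, tpowMap_id]
  inv_hom_id := by rw [← tpowMap_comp, e.inv_hom_id, tpowMap_id]

theorem tpowMapIso_refl_conj (A : C) {a b : ℕ} (f : tpow A a ⟶ tpow A b) :
    (tpowMapIso (Iso.refl A) a).hom ≫ f ≫ (tpowMapIso (Iso.refl A) b).inv = f := by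
  simp [tpowMap_id]

theorem tpowAdd_inv_tpowMap {A B : C} (h : A ⟶ B) (a b : ℕ) :
    (tpowAdd A a b).inv ≫ tpowMap h (a + b) =
      (tpowMap h a ⊗ₘ tpowMap h b) ≫ (tpowAdd B a b).inv := by
  rw [Iso.inv_comp_eq, ← reassoc_of% tpowMap_add, Iso.hom_inv_id, Category.comp_id]

theorem genIso_comp {P : PROP.{w}} {D : Type u'} [Category.{v'} D] [MonoidalCategory D]
    (F : P.Obj ⥤ D) [F.Monoidal] (G : D ⥤ C) [G.Monoidal] (n : ℕ) :
    genIso (F ⋙ G) n = tpowIso G (F.obj ⟨1⟩) n ≪≫ G.mapIso (genIso F n) := by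
  ext
  induction n with
  | zero => exact Functor.LaxMonoidal.comp_ε F G
  | succ n ih =>
    change (genIso (F ⋙ G) n).hom ▷ G.obj (F.obj ⟨1⟩) ≫ μ (F ⋙ G) ⟨n⟩ ⟨1⟩ =
      ((tpowIso G (F.obj ⟨1⟩) n).hom ▷ G.obj (F.obj ⟨1⟩) ≫ μ G (tpow (F.obj ⟨1⟩) n) (F.obj ⟨1⟩)) ≫
        G.map ((genIso F n).hom ▷ F.obj ⟨1⟩ ≫ μ F ⟨n⟩ ⟨1⟩)
    rw [Functor.LaxMonoidal.comp_μ, G.map_comp, Category.assoc, ← μ_natural_left_assoc]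
    have ih' := (congrArg (· ▷ G.obj (F.obj ⟨1⟩)) ih).trans (comp_whiskerRight _ _ _)
    exact (congrArg (· ≫ μ G (F.obj ⟨n⟩) (F.obj ⟨1⟩) ≫ G.map (μ F ⟨n⟩ ⟨1⟩)) ih').trans
      (Category.assoc _ _ _)

variable [SymmetricCategory C]

theorem Expr.interp_eq_evalProp {S : Signature} (A : C)
    (m : ∀ o : S.Op, tpow A (S.dom o) ⟶ tpow A (S.cod o)) {a b : ℕ} (f : Expr S a b) :
    f.interp A m = f.evalProp (endProp A) m := by
  induction f with
  | op o => rfl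
  | id a => rfl
  | comp f g hf hg => exact congrArg₂ (endProp A).comp hf hg
  | tensor f g hf hg => exact congrArg₂ (endProp A).tensor hf hg
  | symm a b => rfl

namespace Alg

variable {T : SMTheory}

/-- An algebra, as an algebra in the PROP of morphisms between the tensor powers of the carrier. -/
def toGenAlg (A : Alg C T) : GenAlg T (endProp A.carrier) where
  op := A.op
  eqn h := by
    rw [← Expr.interp_eq_evalProp, ← Expr.interp_eq_evalProp]
    exact A.eqn h

theorem Hom.interp_comm {A B : Alg C T} (h : Hom A B) {a b : ℕ} (f : Expr T.toSignature a b) :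
    tpowMap h.hom a ≫ f.interp B.carrier B.op = f.interp A.carrier A.op ≫ tpowMap h.hom b := by
  induction f with
  | op o => exact h.comm o
  | id a => exact (Category.comp_id _).trans (Category.id_comp _).symm
  | comp f g hf hg => simp only [Expr.interp, Category.assoc, ← hg, reassoc_of% hf]
  | tensor f g hf hg =>
    simp only [Expr.interp, Category.assoc, tpowAdd_inv_tpowMap, reassoc_of% tpowMap_add,
      tensorHom_comp_tensorHom_assoc, hf, hg]
  | symm a b =>
    simp only [Expr.interp, Category.assoc, tpowAdd_inv_tpowMap, reassoc_of% tpowMap_add,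
      BraidedCategory.braiding_naturality_assoc]

/-- The isomorphism of algebras given by an isomorphism of carriers that commutes with the
operators. -/
def isoMk {A B : Alg C T} (e : A.carrier ≅ B.carrier)
    (h : ∀ o : T.Op,
      A.op o = (tpowMapIso e (T.dom o)).hom ≫ B.op o ≫ (tpowMapIso e (T.cod o)).inv) :
    A ≅ B where
  hom := ⟨e.hom, fun o => by
    rw [h, ← tpowMapIso_hom, ← tpowMapIso_hom, Category.assoc, Category.assoc, Iso.inv_hom_id,
      Category.comp_id]⟩
  inv := ⟨e.inv, fun o => by
    rw [h, ← tpowMapIso_inv, ← tpowMapIso_inv, Iso.inv_hom_id_assoc]⟩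
  hom_inv_id := Hom.ext e.hom_inv_id
  inv_hom_id := Hom.ext e.inv_hom_id

end Alg

namespace GenAlg

variable {T : SMTheory} {P : PROP.{w}} {M : GenAlg T P}

theorem interp_ev (F : SymMonFunctor P.Obj C) {a b : ℕ} (f : Expr T.toSignature a b) :
    f.interp ((M.ev C).obj F).carrier ((M.ev C).obj F).op = (genIso F.F a).hom ≫
      F.F.map (f.evalProp P M.op : (⟨a⟩ : P.Obj) ⟶ ⟨b⟩) ≫ (genIso F.F b).inv :=
  interp_gen F.F M.op f

instance : (M.ev C).Faithful where
  map_injective {F G α β} h := by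
    refine SymMonFunctor.Hom.ext (NatTrans.ext (funext fun n => ?_))
    have app_one : α.nat.app ⟨1⟩ = β.nat.app ⟨1⟩ := congrArg Alg.Hom.hom h
    rw [← cancel_epi (genIso F.F n.n).hom]
    exact (genIso_natural α.nat n.n).symm.trans
      ((congrArg (fun f => tpowMap f n.n ≫ (genIso G.F n.n).hom) app_one).trans
        (genIso_natural β.nat n.n))

/-- The monoidal natural transformation determined by its component at the generating object. -/
def homOfApp {F G : SymMonFunctor P.Obj C} (k : F.F.obj ⟨1⟩ ⟶ G.F.obj ⟨1⟩)
    (hk : ∀ {a b : P.Obj} (x : a ⟶ b),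
      tpowMap k a.n ≫ (genIso G.F a.n).hom ≫ G.F.map x ≫ (genIso G.F b.n).inv =
        ((genIso F.F a.n).hom ≫ F.F.map x ≫ (genIso F.F b.n).inv) ≫ tpowMap k b.n) :
    F ⟶ G where
  nat :=
    { app n := (genIso F.F n.n).inv ≫ tpowMap k n.n ≫ (genIso G.F n.n).hom
      naturality a b x := by
        rw [← cancel_epi (genIso F.F a.n).hom, ← cancel_mono (genIso G.F b.n).inv]
        simpa using (hk x).symm }
  isMonoidal :=
    { unit := (Iso.hom_inv_id_assoc (εIso F.F) _).trans (Category.id_comp _)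
      tensor a b := by
        change μ F.F a b ≫ (genIso F.F (a.n + b.n)).inv ≫ tpowMap k (a.n + b.n) ≫
          (genIso G.F (a.n + b.n)).hom = _
        rw [genIso_add, genIso_add]
        simp [reassoc_of% tpowMap_add] }

theorem IsFree.full_ev (hM : IsFree.{w, w'} M) : (M.ev C).Full where
  map_surjective {F G} h := by
    refine ⟨homOfApp h.hom fun {a b} x => ?_,
      Alg.Hom.ext (genIso_one_inv_tpowMap_genIso_one h.hom)⟩
    obtain ⟨t, rfl⟩ := hM.exists_evalProp_eq x
    have interp_comm := h.interp_comm t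
    rwa [interp_ev, interp_ev] at interp_comm

end GenAlg

namespace PROP.Morphism

variable {P : PROP.{w}} {A : C} (φ : P.Morphism (endProp A))

/-- The functor into a symmetric monoidal category that a morphism from a PROP to the PROP of an
object `A` amounts to. It is monoidal (`coreMonoidal`) and symmetric. -/
def functor : P.Obj ⥤ C where
  obj n := tpow A n.n
  map x := φ.map x
  map_id a := φ.map_id a.n
  map_comp f g := φ.map_comp f g

theorem functor_map_eqToHom {a b : P.Obj} (h : a = b) :
    φ.functor.map (eqToHom h) = eqToHom (congrArg (fun n : P.Obj => tpow A n.n) h) :=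
  eqToHom_map φ.functor h

theorem functor_map_whiskerRight {a b : P.Obj} (f : a ⟶ b) (c : P.Obj) :
    φ.functor.map (f ▷ c) = (tpowAdd A a.n c.n).hom ≫ (φ.functor.map f ▷ tpow A c.n) ≫
      (tpowAdd A b.n c.n).inv := by
  refine (φ.map_tensor f (P.id c.n)).trans ?_
  rw [φ.map_id]
  exact congrArg (fun k => (tpowAdd A a.n c.n).hom ≫ k ≫ (tpowAdd A b.n c.n).inv)
    (tensorHom_id (φ.functor.map f) (tpow A c.n))

theorem functor_map_whiskerLeft (c : P.Obj) {a b : P.Obj} (f : a ⟶ b) :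
    φ.functor.map (c ◁ f) = (tpowAdd A c.n a.n).hom ≫ (tpow A c.n ◁ φ.functor.map f) ≫
      (tpowAdd A c.n b.n).inv := by
  refine (φ.map_tensor (P.id c.n) f).trans ?_
  rw [φ.map_id]
  exact congrArg (fun k => (tpowAdd A c.n a.n).hom ≫ k ≫ (tpowAdd A c.n b.n).inv)
    (id_tensorHom (tpow A c.n) (φ.functor.map f))

/-- The monoidal structure of `functor`, given by the isomorphisms between the tensor powers. -/
def coreMonoidal : φ.functor.CoreMonoidal where
  εIso := Iso.refl _
  μIso a b := (tpowAdd A a.n b.n).symm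
  μIso_hom_natural_left f c := by
    rw [functor_map_whiskerRight]
    exact (Iso.inv_hom_id_assoc _ _).symm
  μIso_hom_natural_right c f := by
    rw [functor_map_whiskerLeft]
    exact (Iso.inv_hom_id_assoc _ _).symm
  associativity a b c := by
    rw [P.associator_hom_eq, functor_map_eqToHom]
    change (tpowAdd A a.n b.n).inv ▷ tpow A c.n ≫ (tpowAdd A (a.n + b.n) c.n).inv ≫
        eqToHom (congrArg (tpow A) (Nat.add_assoc a.n b.n c.n)) =
      (α_ (tpow A a.n) (tpow A b.n) (tpow A c.n)).hom ≫
        tpow A a.n ◁ (tpowAdd A b.n c.n).inv ≫ (tpowAdd A a.n (b.n + c.n)).inv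
    rw [← cancel_mono ((tpowAdd A a.n (b.n + c.n)).hom ≫ tpow A a.n ◁ (tpowAdd A b.n c.n).hom)]
    simp [← tpowAdd_add A a.n b.n c.n]
  left_unitality a := by
    rw [P.leftUnitor_hom_eq, functor_map_eqToHom]
    have leftUnitor_eq {X Y : C} (t : X ≅ 𝟙_ C ⊗ Y) (e : X ≅ Y) (h : t = e ≪≫ (λ_ Y).symm) :
        (λ_ Y).hom = 𝟙 (𝟙_ C) ▷ Y ≫ t.inv ≫ e.hom := by
      subst h
      simp
    exact leftUnitor_eq _ _ (tpowAdd_zero_left A a.n)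
  right_unitality a := by
    rw [P.rightUnitor_hom_eq, functor_map_eqToHom]
    change (ρ_ (tpow A a.n)).hom =
      tpow A a.n ◁ 𝟙 (𝟙_ C) ≫ (ρ_ (tpow A a.n)).hom ≫ 𝟙 (tpow A a.n)
    simp

instance : φ.functor.Monoidal := φ.coreMonoidal.toMonoidal

instance : φ.functor.Braided where
  braided a b := by
    have map_braiding : φ.functor.map (β_ a b).hom = (tpowAdd A a.n b.n).hom ≫
      (β_ (tpow A a.n) (tpow A b.n)).hom ≫ (tpowAdd A b.n a.n).inv := φ.map_symm a.n b.n
    rw [map_braiding]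
    exact Iso.inv_hom_id_assoc (tpowAdd A a.n b.n) _

theorem genIso_functor (n : ℕ) : genIso φ.functor n = tpowMapIso (λ_ A) n := by
  ext
  induction n with
  | zero => rfl
  | succ n ih =>
    have whiskerRight_unitors {X : C} (f : X ⟶ tpow A n) : f ▷ (𝟙_ C ⊗ A) ≫
        (α_ (tpow A n) (𝟙_ C) A).inv ≫ (ρ_ (tpow A n)).hom ▷ A = f ⊗ₘ (λ_ A).hom := by
      simp [MonoidalCategory.tensorHom_def]
    refine Eq.trans ?_ (whiskerRight_unitors _)
    exact congrArg (fun f : tpow (𝟙_ C ⊗ A) n ⟶ tpow A n => f ▷ (𝟙_ C ⊗ A) ≫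
      (α_ (tpow A n) (𝟙_ C) A).inv ≫ (ρ_ (tpow A n)).hom ▷ A) ih

end PROP.Morphism

namespace GenAlg

variable {T : SMTheory} {P : PROP.{w}} {M : GenAlg T P}

theorem IsFree.essSurj_ev (hM : IsFree.{w, v} M) : (M.ev C).EssSurj where
  mem_essImage A := by
    obtain ⟨φ, hφ⟩ := hM.exists_morphism A.toGenAlg
    refine ⟨⟨φ.functor, inferInstance⟩, ⟨Alg.isoMk (λ_ A.carrier) fun o => ?_⟩⟩
    change _ = (tpowMapIso (λ_ A.carrier) (T.dom o)).hom ≫ A.op o ≫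
      (tpowMapIso (λ_ A.carrier) (T.cod o)).inv
    rw [← φ.genIso_functor, ← φ.genIso_functor]
    exact congrArg (fun x : tpow A.carrier (T.dom o) ⟶ tpow A.carrier (T.cod o) =>
      (genIso φ.functor (T.dom o)).hom ≫ x ≫ (genIso φ.functor (T.cod o)).inv) (hφ o)

theorem IsFree.isEquivalence_ev (hM : IsFree.{w, v} M) : (M.ev C).IsEquivalence where
  full := hM.full_ev
  essSurj := hM.essSurj_ev

section Naturality

variable (M) {D : Type u'} [Category.{v'} D]
  [MonoidalCategory D] [SymmetricCategory D] (G : SymMonFunctor D C)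

theorem map_ev_op (F : SymMonFunctor P.Obj D) (o : T.Op) :
    ((Alg.map G).obj ((M.ev D).obj F)).op o = ((M.ev C).obj (G.postcomp.obj F)).op o := by
  change (tpowIso G.F (F.F.obj ⟨1⟩) (T.dom o)).hom ≫ G.F.map ((genIso F.F (T.dom o)).hom ≫
      F.F.map (M.op o : (⟨T.dom o⟩ : P.Obj) ⟶ ⟨T.cod o⟩) ≫ (genIso F.F (T.cod o)).inv) ≫
        (tpowIso G.F (F.F.obj ⟨1⟩) (T.cod o)).inv =
    (genIso (F.F ⋙ G.F) (T.dom o)).hom ≫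
      G.F.map (F.F.map (M.op o : (⟨T.dom o⟩ : P.Obj) ⟶ ⟨T.cod o⟩)) ≫
        (genIso (F.F ⋙ G.F) (T.cod o)).inv
  rw [genIso_comp, genIso_comp]
  simp

/-- The naturality of the evaluation at an algebra in a PROP with respect to symmetric monoidal
functors. Its components are identities on the carriers. -/
def evNatIso : M.ev D ⋙ Alg.map G ≅ G.postcomp ⋙ M.ev C :=
  NatIso.ofComponents
    (fun F => Alg.isoMk (Iso.refl (G.F.obj (F.F.obj ⟨1⟩))) fun o =>
      (M.map_ev_op G F o).trans (tpowMapIso_refl_conj _ _).symm)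
    fun _ => Alg.Hom.ext ((Category.comp_id _).trans (Category.id_comp _).symm)

end Naturality

end GenAlg

end UniversalProperty

theorem mainTheorem1 :
    -- the five idags make the object `1` an algebra of the theory in the PROP of idags,
    ∃ M : GenAlg dagTheory dagProp, M.op = dagOp ∧
      -- the PROP of idags is isomorphic to the free PROP (expressions modulo provable equality),
      -- by an isomorphism of PROPs that sends every operator to its idag,
      (∃ Φ : dagTheory.freeProp.Morphism dagProp,
        (∀ o, Φ.map (dagTheory.gen o) = dagOp o) ∧ Φ.IsIso) ∧
      -- it has the universal property of the free PROP: evaluation at this algebra is an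
      -- equivalence between functorial models and algebras in every symmetric monoidal category,
      (∀ (C : Type u) [Category.{v} C] [MonoidalCategory C] [SymmetricCategory C],
        (M.ev C).IsEquivalence) ∧
      -- and these equivalences are natural in the symmetric monoidal category.
      (∀ (D : Type u') [Category.{v'} D] [MonoidalCategory D] [SymmetricCategory D]
        (C : Type u) [Category.{v} C] [MonoidalCategory C] [SymmetricCategory C]
        (G : SymMonFunctor D C),
        ∃ i : M.ev D ⋙ Alg.map G ≅ G.postcomp ⋙ M.ev C,
          ∀ F : SymMonFunctor dagProp.Obj D,
            Alg.Hom.hom (i.hom.app F) = 𝟙 (G.F.obj (F.F.obj ⟨1⟩))) := by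
  exact ⟨dagAlg, rfl, ⟨dagAlg.freeLift, fun _ => rfl, dagAlg_isFree.isIso_freeLift⟩,
    fun _ => dagAlg_isFree.isEquivalence_ev,
    fun _ _ _ _ _ _ _ _ G => ⟨dagAlg.evNatIso G, fun _ => rfl⟩⟩
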